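/- Let $n\ge 3$. For $N\ge n$ consider the TASEP on a ring with $N$ sites $\mathbb{Z}/N$ and $n$ particles labelled $1,\dots,n$, at most one per site. In each step a particle is chosen uniformly at random and tries to jump to the site directly to its left (from $x$ to $x-1$): if that site is vacant it jumps there; if that site holds a particle with a larger label the two particles trade places; if it holds a particle with a smaller label nothing happens. This Markov chain has a unique stationary distribution. Scale the ring to length $1$ (site $x\in\{0,\dots,N-1\}$ becomes the point $x/N$ of the circle $\mathbb{R}/\mathbb{Z}$). As $N\to\infty$ with $n$ fixed, the stationary distributions of the positions of the $n$ particles converge weakly to a probability distribution on $(\mathbb{R}/\mathbb{Z})^n$, called the continuous TASEP on a ring. Let $c_{i,j}=c_{i,j}(n)$ be the probability under this limit distribution that particle $j$ sits directly to the right of particle $i$, i.e. that $j$ is the first other particle met when moving from particle $i$ to the right (in the positive direction) around the circle. Then \begin{enumerate} \item $c_{2,1}=\dfrac{n}{\binom{n+1}{2}}-\dfrac{n}{\binom{n+2}{2}}=\dfrac{4}{(n+1)(n+2)}$; \item $c_{1,2}=\dfrac{n}{\binom{n+2}{2}}+\dfrac{n}{\binom{n+1}{2}}=\dfrac{4}{n+2}$;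 \item $c_{n,n-1}=\dfrac{n^2}{\binom{2n-1}{2}}-\dfrac{n(n-2)}{\binom{2n-2}{2}}-\dfrac{n}{\binom{2n}{2}}=\dfrac{3}{(2n-1)(2n-3)}$. \end{enumerate} -/

import Mathlib

open Filter Topology MeasureTheory

/-- A state of the TASEP with `n` particles labelled `1, …, n` on a ring with `N` sites `ZMod N`:
`σ i` is the site of the particle with label `i + 1` (so `i : Fin n` is the zero-based label),
and no two particles share a site. -/
abbrev Config (n N : ℕ) : Type := Fin n ↪ ZMod N

open Classical in
/-- The particle `i` tries to jump left. If the site to its left holds a particle whose label is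
smaller or equal, nothing happens. Otherwise the contents of the two sites are exchanged: the
particle jumps to a vacant site, or trades places with a particle of larger label. -/
noncomputable def jumpLeft {n N : ℕ} (i : Fin n) (σ : Config n N) : Config n N :=
  if ∃ j, j ≤ i ∧ σ j = σ i - 1 then σ
  else σ.trans (Equiv.swap (σ i) (σ i - 1)).toEmbedding

open Classical in
/-- One step of the chain: a particle is chosen uniformly at random and tries to jump left. -/
noncomputable def transitionProb {n N : ℕ} (σ τ : Config n N) : ENNReal :=
  ((Finset.univ.filter fun i : Fin n => jumpLeft i σ = τ).card : ENNReal) / (n : ENNReal)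

/-- `p` is a stationary distribution of the TASEP chain. -/
def IsStationaryDist {n N : ℕ} (p : PMF (Config n N)) : Prop :=
  ∀ τ, ∑' σ, p σ * transitionProb σ τ = p τ

/-- The positions of the particles after the ring of `N` sites is scaled to length `1`. -/
noncomputable def scaledPositions {n N : ℕ} (σ : Config n N) : Fin n → UnitAddCircle :=
  fun i => (((σ i).val / N : ℝ) : UnitAddCircle)

/-- The law of the scaled positions when the state of the chain has distribution `p`. -/
noncomputable def scaledLaw {n N : ℕ} (p : PMF (Config n N)) :
    ProbabilityMeasure (Fin n → UnitAddCircle) :=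
  ⟨(p.map scaledPositions).toMeasure, inferInstance⟩

/-- `μ` is the continuous TASEP on a ring with particles `1, …, n`: it is the weak limit, as the
number `N = n + k` of sites tends to infinity, of the stationary distributions of the TASEP on `N`
sites, the ring being scaled to length `1`. -/
def IsContinuousTASEP (n : ℕ) (μ : ProbabilityMeasure (Fin n → UnitAddCircle)) : Prop :=
  ∃ p : (k : ℕ) → PMF (Config n (n + k)),
    (∀ k, IsStationaryDist (p k)) ∧ Tendsto (fun k => scaledLaw (p k)) atTop (𝓝 μ)

/-- The distance in `[0, 1)` travelled from `x` to `y` when moving to the right (the positive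
direction) on the circle of length `1`. -/
noncomputable def rightDist (x y : UnitAddCircle) : ℝ :=
  (AddCircle.equivIco (1 : ℝ) 0 (y - x) : ℝ)

/-- Moving right on the circle from particle `i`, the first other particle met is particle `j`. -/
def DirectlyRight {n : ℕ} (i j : Fin n) (x : Fin n → UnitAddCircle) : Prop :=
  i ≠ j ∧ ∀ k, k ≠ i → k ≠ j → rightDist (x i) (x j) < rightDist (x i) (x k)

/-- The two-point correlation: the probability under `μ` that particle `j` sits directly to the
right of particle `i` (zero-based labels). -/
noncomputable def correlation {n : ℕ} (μ : ProbabilityMeasure (Fin n → UnitAddCircle))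
    (i j : Fin n) : ℝ :=
  (μ : Measure (Fin n → UnitAddCircle)).real {x | DirectlyRight i j x}

/-!
The stationary distribution of the TASEP on a ring is described by multiline queues (Ferrari and
Martin). Take independent uniformly random rows of sites of sizes `n, n - 1, …, 1`. In the queue
`fed`, the sites of one row are arrivals and those of the next larger row are services, and time
runs around the ring. Letting every row pass through all rows below it yields the nested sets of the
sites with labels at most `k`. The reason (`fed_bell_bell`, `fed_bell_of_mem`, `sum_bell_multiline`)
is that a jump attempt at a uniformly random site commutes with a queue whose services are uniformly
random. Since from any state a fixed one can be reached (`exists_forall_reaches`), the invariant law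
is unique, also for the chain that records only the label sets of some sizes. This gives
`sum_labelSets_eq_multilineMean`, in which rows of other sizes may be omitted.

The multiline queue depends on the cyclic order of the sites only, so it makes sense for independent
uniform points of `[0, 1)`. Rounding these points down to a ring with `N` sites gives uniformly
random rows up to coincidences that become negligible, and dominated convergence yields the limit
law (`tendsto_multilineMean`, `isContinuousTASEP_iff`). In the limit a two-point correlation is the
probability of an event in a multiline queue with three rows (`correlation_limitLaw`): of sizes
`n, 2, 1` for the labels `1` and `2`, and `n, n - 1, n - 2` for the labels `n` and `n - 1`. All
orders of the points are equally likely, so this is a matter of counting partitions of a ring with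
as many sites as points (`integral_follows`). One site of the middle row is left unused by the top
row, and by rotation it may be taken to be `0` (`card_partitions_follows`).

For the rows `n, 2, 1` the partitions are given by two sites `0 < u < v` and the favourable ones are
listed directly. For the rows `n, n - 1, n - 2`, write `0`, `1`, `2` for the sites of the bottom,
middle and top row. The site `0` is unused and the particle `n - 1` is directly right of the
particle `n` if and only if, in the word of the other sites, every nonempty final segment has more
letters `0` than `1` and at least as many `1` as `2`, and the first letter other than `2` is `0`
(`follows_unused_iff`, `goodPrefix_fiber_iff`). Ballot words are counted by a product formula
(`exists_finset_ballot`) and the words in question by a sum of such numbers with a closed form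
(`exists_finset_leadsZero`).
-/

/-! ### Queues on a linearly ordered set of positions, read cyclically -/

section Order

variable {ι α : Type*} [LinearOrder α]

/-- Moving to the right (upwards, and from the top back to the bottom) from `a`, the position `t`
is met no later than `b`. -/
def CycBtw (a t b : α) : Prop := if a ≤ b then a ≤ t ∧ t ≤ b else a ≤ t ∨ t ≤ b

open Classical in
/-- The members of `S` whose position lies on the cyclic interval from `v a` to `v b`. -/
noncomputable def arc (v : ι → α) (a b : ι) (S : Finset ι) : Finset ι :=
  S.filter fun t => CycBtw (v a) (v t) (v b)

open Classical in
/-- One queue. The members of `B` are arrivals, those of `S` are services, and customers wait while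
time runs cyclically to the right. The result is the set of services that are used. A service at
`z` is used if and only if, on some cyclic interval ending at `z` and starting at an arrival, there
are at least as many arrivals as services. -/
noncomputable def fed (v : ι → α) (S B : Finset ι) : Finset ι :=
  S.filter fun z => ∃ a ∈ B, (arc v a z S).card ≤ (arc v a z B).card

/-- The multiline queue. The rows are listed from the bottom one (the largest) to the top one, and
the `j`-th set of the result consists of the sites of the bottom row reached by the customers that
enter at row `j` and pass through all rows below it. -/
noncomputable def multiline (v : ι → α) : List (Finset ι) → List (Finset ι)
  | [] => []
  | S :: L => S :: (multiline v L).map (fed v S)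

theorem mem_arc {v : ι → α} {a b t : ι} {S : Finset ι} :
    t ∈ arc v a b S ↔ t ∈ S ∧ CycBtw (v a) (v t) (v b) := by
  simp [arc]

theorem mem_fed {v : ι → α} {S B : Finset ι} {z : ι} :
    z ∈ fed v S B ↔ z ∈ S ∧ ∃ a ∈ B, (arc v a z S).card ≤ (arc v a z B).card := by
  simp [fed]

theorem fed_subset (v : ι → α) (S B : Finset ι) : fed v S B ⊆ S := fun _ h => (mem_fed.1 h).1

theorem arc_mono (v : ι → α) (a b : ι) {S T : Finset ι} (h : S ⊆ T) :
    arc v a b S ⊆ arc v a b T := by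
  classical
  exact Finset.filter_subset_filter _ h

theorem fed_mono (v : ι → α) (S : Finset ι) {B C : Finset ι} (h : B ⊆ C) :
    fed v S B ⊆ fed v S C := by
  intro z hz
  obtain ⟨hz, a, ha, hc⟩ := mem_fed.1 hz
  exact mem_fed.2 ⟨hz, a, h ha, hc.trans (Finset.card_le_card (arc_mono v a z h))⟩

end Order

/-! ### The queue on the ring -/

section Ring

variable {N : ℕ}

theorem ZMod.val_sub_eq_ite [NeZero N] (a t : ZMod N) :
    (t - a).val = if a.val ≤ t.val then t.val - a.val else t.val + N - a.val := by
  split_ifs with h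
  · exact ZMod.val_sub h
  · have h1 : (a - t).val = a.val - t.val := ZMod.val_sub (by omega)
    have h2 : a - t ≠ 0 := by
      intro h0; rw [h0, ZMod.val_zero] at h1; omega
    have : NeZero (a - t) := ⟨h2⟩
    have h3 := ZMod.val_neg_of_ne_zero (a - t)
    rw [neg_sub] at h3
    have := ZMod.val_lt a
    omega

theorem cycBtw_val [NeZero N] (a t z : ZMod N) :
    CycBtw a.val t.val z.val ↔ (t - a).val ≤ (z - a).val := by
  have h1 := ZMod.val_lt a
  have h2 := ZMod.val_lt t
  have h3 := ZMod.val_lt z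
  rw [ZMod.val_sub_eq_ite, ZMod.val_sub_eq_ite, CycBtw]
  split_ifs <;> omega

theorem ZMod.val_sub_one [NeZero N] {d : ZMod N} (hd : d ≠ 0) : (d - 1).val + 1 = d.val := by
  have hN : N ≠ 1 := by
    rintro rfl
    exact hd (Subsingleton.elim _ _)
  have h0 : d.val ≠ 0 := by rwa [Ne, ZMod.val_eq_zero]
  have h1 : (1 : ZMod N).val = 1 := by
    have := NeZero.ne N
    exact ZMod.val_one'' hN
  rw [ZMod.val_sub (by omega), h1]
  omega

/-- The number of members of `S` met when walking to the right from `a` to `z` inclusive. -/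
def arcCount (S : Finset (ZMod N)) (a z : ZMod N) : ℕ :=
  (S.filter fun t => (t - a).val ≤ (z - a).val).card

theorem card_arc_val [NeZero N] (S : Finset (ZMod N)) (a z : ZMod N) :
    (arc ZMod.val a z S).card = arcCount S a z := by
  unfold arc arcCount
  congr 1
  ext t
  simp [cycBtw_val]

/-- The indicator function of a finite set. -/
def ind (S : Finset (ZMod N)) (z : ZMod N) : ℕ := if z ∈ S then 1 else 0

theorem ind_of_mem {S : Finset (ZMod N)} {z : ZMod N} (h : z ∈ S) : ind S z = 1 := if_pos h

theorem ind_of_notMem {S : Finset (ZMod N)} {z : ZMod N} (h : z ∉ S) : ind S z = 0 := if_neg h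

theorem sum_ind [NeZero N] (S : Finset (ZMod N)) : ∑ z, ind S z = S.card := by
  simp [ind]

theorem card_filter_eq_ind (S : Finset (ZMod N)) (z : ZMod N) :
    (S.filter fun t => t = z).card = ind S z := by
  rw [Finset.filter_eq', ind]
  split_ifs <;> simp

theorem arcCount_self [NeZero N] (S : Finset (ZMod N)) (a : ZMod N) :
    arcCount S a a = ind S a := by
  rw [← card_filter_eq_ind, arcCount]
  congr 1
  ext t
  simp [sub_eq_zero]

theorem arcCount_step_right [NeZero N] (S : Finset (ZMod N)) {a z : ZMod N} (h : z ≠ a) :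
    arcCount S a z = arcCount S a (z - 1) + ind S z := by
  rw [← card_filter_eq_ind, arcCount, arcCount, ← Finset.card_union_of_disjoint]
  · congr 1
    ext t
    have h1 := ZMod.val_sub_one (sub_ne_zero.2 h)
    have h2 : (t - a).val = (z - a).val ↔ t = z := by
      rw [(ZMod.val_injective N).eq_iff, sub_left_inj]
    rw [show z - 1 - a = z - a - 1 by ring]
    simp only [Finset.mem_filter, Finset.mem_union, ← and_or_left, ← h2]
    refine and_congr_right fun _ => ?_
    omega
  · rw [Finset.disjoint_filter]
    rintro t - h1 rfl
    have h2 := ZMod.val_sub_one (sub_ne_zero.2 h)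
    rw [show t - 1 - a = t - a - 1 by ring] at h1
    omega

theorem arcCount_step_left [NeZero N] (S : Finset (ZMod N)) {a z : ZMod N} (h : z ≠ a - 1) :
    arcCount S (a - 1) z = arcCount S a z + ind S (a - 1) := by
  rw [← card_filter_eq_ind, arcCount, arcCount, ← Finset.card_union_of_disjoint]
  · congr 1
    ext t
    have h1 := ZMod.val_sub_one (sub_ne_zero.2 h)
    simp only [Finset.mem_filter, Finset.mem_union, ← and_or_left]
    refine and_congr_right fun _ => ?_
    rw [show z - (a - 1) - 1 = z - a by ring] at h1
    by_cases ht : t = a - 1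
    · simp [ht]
    · have h2 := ZMod.val_sub_one (sub_ne_zero.2 ht)
      rw [show t - (a - 1) - 1 = t - a by ring] at h2
      simp only [ht, or_false]
      omega
  · rw [Finset.disjoint_filter]
    rintro t - h1 rfl
    have h2 := ZMod.val_sub_one (sub_ne_zero.2 h)
    rw [show z - (a - 1) - 1 = z - a by ring] at h2
    rw [show a - 1 - a = (-1 : ZMod N) by ring] at h1
    have h3 : (0 : ZMod N) = (-1 : ZMod N) + 1 := by ring
    have h4 := ZMod.val_lt (z - (a - 1))
    have h5 : (-1 : ZMod N).val + 1 = N := by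
      obtain ⟨k, rfl⟩ : ∃ k, N = k + 1 := ⟨N - 1, by have := NeZero.ne N; omega⟩
      rw [ZMod.val_neg_one]
    omega

theorem arcCount_full [NeZero N] (S : Finset (ZMod N)) (z : ZMod N) :
    arcCount S z (z - 1) = S.card := by
  rw [arcCount, Finset.filter_true_of_mem]
  intro t _
  have h5 : (-1 : ZMod N).val + 1 = N := by
    obtain ⟨k, rfl⟩ : ∃ k, N = k + 1 := ⟨N - 1, by have := NeZero.ne N; omega⟩
    rw [ZMod.val_neg_one]
  rw [show z - 1 - z = (-1 : ZMod N) by ring]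
  have := ZMod.val_lt (t - z)
  omega

/-- `q z` is the number of customers waiting just to the right of the site `z`. Natural-number
subtraction encodes that a service with nobody waiting is lost. -/
def IsQueue (S B : Finset (ZMod N)) (q : ZMod N → ℕ) : Prop :=
  ∀ z, q z = q (z - 1) + ind B z - ind S z

/-- The largest excess of arrivals over services on an interval ending at `z` solves the queueing
recursion. -/
theorem exists_isQueue [NeZero N] {S B : Finset (ZMod N)} (h : B.card ≤ S.card) :
    ∃ q, IsQueue S B q := by
  obtain ⟨q, hq⟩ : ∃ q : ZMod N → ℕ,
      ∀ z, q z = Finset.univ.sup fun a => arcCount B a z - arcCount S a z := ⟨_, fun _ => rfl⟩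
  have hle : ∀ a z, arcCount B a z - arcCount S a z ≤ q z := fun a z => by
    rw [hq]
    exact Finset.le_sup (f := fun a => arcCount B a z - arcCount S a z) (Finset.mem_univ a)
  refine ⟨q, fun z => le_antisymm ?_ ?_⟩
  · rw [hq z]
    refine Finset.sup_le fun a _ => ?_
    by_cases ha : z = a
    · subst ha
      rw [arcCount_self, arcCount_self]
      omega
    · rw [arcCount_step_right B ha, arcCount_step_right S ha]
      have := hle a (z - 1)
      omega
  · obtain ⟨a, -, ha⟩ := Finset.exists_mem_eq_sup Finset.univ Finset.univ_nonempty
      fun a => arcCount B a (z - 1) - arcCount S a (z - 1)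
    rw [← hq] at ha
    have h1 := hle a z
    have h2 := hle z z
    rw [arcCount_self, arcCount_self] at h2
    by_cases haz : z = a
    · subst haz
      rw [arcCount_full, arcCount_full] at ha
      omega
    · rw [arcCount_step_right B haz, arcCount_step_right S haz] at h1
      omega

theorem arcCount_le_queue [NeZero N] {S B : Finset (ZMod N)} {q : ZMod N → ℕ} (hq : IsQueue S B q)
    (a z : ZMod N) : arcCount B a z ≤ q z + arcCount S a z := by
  induction hd : (z - a).val generalizing z with
  | zero =>
    rw [ZMod.val_eq_zero, sub_eq_zero] at hd
    subst hd
    rw [arcCount_self, arcCount_self, hq z]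
    omega
  | succ d ih =>
    have hza : z ≠ a := by
      rintro rfl
      simp at hd
    have h1 := ZMod.val_sub_one (sub_ne_zero.2 hza)
    have := ih (z - 1) (by rw [show z - 1 - a = z - a - 1 by ring]; omega)
    rw [arcCount_step_right B hza, arcCount_step_right S hza, hq z]
    omega

/-- A customer waits only because, since some arrival, the server has been busy. -/
theorem exists_arcCount_eq [NeZero N] {S B : Finset (ZMod N)} {q : ZMod N → ℕ}
    (hq : IsQueue S B q) (h : B.card < S.card) {y : ZMod N} (hy : 0 < q y) :
    ∃ a ∈ B, q y + arcCount S a y = arcCount B a y := by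
  by_contra hcon
  push Not at hcon
  have key : ∀ d : ℕ, ∀ a : ZMod N, (y - a).val = d →
      q y + arcCount S a y = q (a - 1) + arcCount B a y ∧ 0 < q (a - 1) := by
    intro d
    induction d with
    | zero =>
      intro a hd
      rw [ZMod.val_eq_zero, sub_eq_zero] at hd
      subst hd
      have h1 := hq y
      have h2 := hcon y
      rw [arcCount_self, arcCount_self] at h2 ⊢
      by_cases hyB : y ∈ B
      · have := h2 hyB
        rw [ind_of_mem hyB] at *
        omega
      · rw [ind_of_notMem hyB] at *
        omega
    | succ d ih =>
      intro a hd
      have hya : y ≠ a := by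
        rintro rfl
        simp at hd
      have h1 := ZMod.val_sub_one (sub_ne_zero.2 hya)
      obtain ⟨h2, h3⟩ := ih (a + 1) (by rw [show y - (a + 1) = y - a - 1 by ring]; omega)
      have h4 := fun T => arcCount_step_left T (a := a + 1) (z := y) (by simpa using hya)
      simp only [add_sub_cancel_right] at h2 h3 h4
      have h5 := hq a
      have h6 := hcon a
      rw [h4 S, h4 B] at h6 ⊢
      by_cases haB : a ∈ B
      · have := h6 haB
        rw [ind_of_mem haB] at *
        omega
      · rw [ind_of_notMem haB] at *
        omega
  obtain ⟨h1, -⟩ := key _ (y + 1) rfl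
  have h2 := fun T => arcCount_full T (y + 1)
  simp only [add_sub_cancel_right] at h1 h2
  rw [h2, h2] at h1
  omega

/-- A service is used if and only if it finds a waiting or arriving customer. -/
theorem mem_fed_iff_queue [NeZero N] {S B : Finset (ZMod N)} {q : ZMod N → ℕ}
    (hq : IsQueue S B q) (h : B.card < S.card) {z : ZMod N} :
    z ∈ fed ZMod.val S B ↔ z ∈ S ∧ 0 < q (z - 1) + ind B z := by
  rw [mem_fed]
  refine and_congr_right fun hz => ?_
  simp only [card_arc_val]
  constructor
  · rintro ⟨a, ha, hc⟩
    by_cases hza : z = a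
    · rw [hza, ind_of_mem ha]
      omega
    · rw [arcCount_step_right B hza, arcCount_step_right S hza, ind_of_mem hz] at hc
      have := arcCount_le_queue hq a (z - 1)
      omega
  · intro hpos
    by_cases hzB : z ∈ B
    · exact ⟨z, hzB, by rw [arcCount_self, arcCount_self, ind_of_mem hz, ind_of_mem hzB]⟩
    · rw [ind_of_notMem hzB, add_zero] at hpos
      obtain ⟨a, ha, hc⟩ := exists_arcCount_eq hq h hpos
      have hza : z ≠ a := by
        rintro rfl
        exact hzB ha
      refine ⟨a, ha, ?_⟩
      rw [arcCount_step_right B hza, arcCount_step_right S hza, ind_of_mem hz,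
        ind_of_notMem hzB]
      omega

/-- No customer is lost: the queue length, summed over the ring, is unchanged by a shift. -/
theorem card_fed [NeZero N] {S B : Finset (ZMod N)} (h : B.card < S.card) :
    (fed ZMod.val S B).card = B.card := by
  obtain ⟨q, hq⟩ := exists_isQueue h.le
  have h1 : ∀ z, q z + ind (fed ZMod.val S B) z = q (z - 1) + ind B z := by
    intro z
    have h2 := hq z
    by_cases hz : z ∈ fed ZMod.val S B
    · rw [ind_of_mem hz]
      obtain ⟨hS, hpos⟩ := (mem_fed_iff_queue hq h).1 hz
      rw [ind_of_mem hS] at h2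
      omega
    · rw [ind_of_notMem hz]
      rw [mem_fed_iff_queue hq h] at hz
      by_cases hS : z ∈ S
      · have : ¬ 0 < q (z - 1) + ind B z := fun h' => hz ⟨hS, h'⟩
        omega
      · rw [ind_of_notMem hS] at h2
        omega
  have h3 : ∑ z, (q z + ind (fed ZMod.val S B) z) = ∑ z, (q (z - 1) + ind B z) :=
    Finset.sum_congr rfl fun z _ => h1 z
  have h4 : ∑ z, q (z - 1) = ∑ z, q z := Equiv.sum_comp (Equiv.subRight (1 : ZMod N)) q
  rw [Finset.sum_add_distrib, Finset.sum_add_distrib, sum_ind, sum_ind, h4] at h3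
  omega

/-! ### The queue commutes with the jumps -/

/-- The move of a set of particles when the bell rings at the site `x`: a particle at `x` jumps to
`x - 1` if that site is free. -/
def bell (x : ZMod N) (B : Finset (ZMod N)) : Finset (ZMod N) :=
  if x ∈ B ∧ x - 1 ∉ B then insert (x - 1) (B.erase x) else B

theorem bell_of_notMem {x : ZMod N} {B : Finset (ZMod N)} (h : x ∉ B) : bell x B = B :=
  if_neg fun h' => h h'.1

theorem bell_of_mem {x : ZMod N} {B : Finset (ZMod N)} (h : x - 1 ∈ B) : bell x B = B :=
  if_neg fun h' => h'.2 h

theorem bell_of_jump {x : ZMod N} {B : Finset (ZMod N)} (h : x ∈ B) (h' : x - 1 ∉ B) :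
    bell x B = insert (x - 1) (B.erase x) := if_pos ⟨h, h'⟩

theorem card_bell (x : ZMod N) (B : Finset (ZMod N)) : (bell x B).card = B.card := by
  unfold bell
  split_ifs with h
  · rw [Finset.card_insert_of_notMem fun h' => h.2 (Finset.mem_of_mem_erase h'),
      Finset.card_erase_of_mem h.1]
    have := Finset.card_pos.2 ⟨x, h.1⟩
    omega
  · rfl

theorem mem_bell_of_ne {x z : ZMod N} {B : Finset (ZMod N)} (h1 : z ≠ x) (h2 : z ≠ x - 1) :
    z ∈ bell x B ↔ z ∈ B := by
  unfold bell
  split_ifs <;> simp [h1, h2]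

theorem mem_bell_self {x : ZMod N} (hx : x - 1 ≠ x) {B : Finset (ZMod N)} :
    x ∈ bell x B ↔ x ∈ B ∧ x - 1 ∈ B := by
  unfold bell
  split_ifs with h
  · simp [hx.symm, h.2]
  · tauto

theorem mem_bell_pred {x : ZMod N} {B : Finset (ZMod N)} :
    x - 1 ∈ bell x B ↔ x ∈ B ∨ x - 1 ∈ B := by
  unfold bell
  split_ifs with h
  · simp [h.1]
  · tauto

theorem ind_eq_one_or (S : Finset (ZMod N)) (z : ZMod N) :
    (z ∈ S ∧ ind S z = 1) ∨ (z ∉ S ∧ ind S z = 0) := by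
  by_cases h : z ∈ S
  · exact .inl ⟨h, ind_of_mem h⟩
  · exact .inr ⟨h, ind_of_notMem h⟩

/-- The queue after a simultaneous jump of the arrivals and of the services: it changes at the
site `x - 1` only. -/
theorem isQueue_update [NeZero N] {x : ZMod N} (hx : x - 1 ≠ x) {S S' B B' : Finset (ZMod N)}
    {q : ZMod N → ℕ} (hq : IsQueue S B q)
    (hB : ∀ z, z ≠ x → z ≠ x - 1 → (z ∈ B' ↔ z ∈ B))
    (hS : ∀ z, z ≠ x → z ≠ x - 1 → (z ∈ S' ↔ z ∈ S))
    (hkey : q x = (q (x - 1 - 1) + ind B' (x - 1) - ind S' (x - 1)) + ind B' x - ind S' x) :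
    IsQueue S' B'
      (Function.update q (x - 1) (q (x - 1 - 1) + ind B' (x - 1) - ind S' (x - 1))) := by
  intro z
  have hxx : x - 1 - 1 ≠ x - 1 := fun h => hx (sub_left_injective h)
  by_cases h1 : z = x - 1
  · subst h1
    rw [Function.update_self, Function.update_of_ne hxx]
  · rw [Function.update_of_ne h1]
    by_cases h2 : z = x
    · subst h2
      rw [Function.update_self]
      exact hkey
    · rw [Function.update_of_ne (fun h => h2 (sub_left_injective h)), hq z]
      simp only [ind, hB z h2 h1, hS z h2 h1]

/-- If the site `x - 1` is free for a service whenever the site `x` is, a bell at `x` for both the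
arrivals and the services has the effect of a bell at `x` for the departures. -/
theorem fed_bell_bell [NeZero N] {x : ZMod N} (hx : x - 1 ≠ x) {S B : Finset (ZMod N)}
    (h : B.card < S.card) (hS : ¬ (x - 1 ∈ S ∧ x ∉ S)) :
    fed ZMod.val (bell x S) (bell x B) = bell x (fed ZMod.val S B) := by
  obtain ⟨q, hq⟩ := exists_isQueue h.le
  have hxx : x - 1 - 1 ≠ x - 1 := fun h => hx (sub_left_injective h)
  have m1 := mem_bell_self hx (B := B)
  have m2 := mem_bell_pred (x := x) (B := B)
  have m3 := mem_bell_self hx (B := S)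
  have m4 := mem_bell_pred (x := x) (B := S)
  have q1 := hq x
  have q2 := hq (x - 1)
  have i1 := ind_eq_one_or B x
  have i2 := ind_eq_one_or B (x - 1)
  have i3 := ind_eq_one_or S x
  have i4 := ind_eq_one_or S (x - 1)
  have i5 := ind_eq_one_or (bell x B) x
  have i6 := ind_eq_one_or (bell x B) (x - 1)
  have i7 := ind_eq_one_or (bell x S) x
  have i8 := ind_eq_one_or (bell x S) (x - 1)
  have hq' := isQueue_update (S' := bell x S) (B' := bell x B) hx hq
    (fun z => mem_bell_of_ne) (fun z => mem_bell_of_ne) (by grind)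
  have h' : (bell x B).card < (bell x S).card := by rwa [card_bell, card_bell]
  ext z
  rw [mem_fed_iff_queue hq' h']
  by_cases h2 : z = x
  · subst h2
    rw [mem_bell_self hx (B := fed _ _ _), mem_fed_iff_queue hq h, mem_fed_iff_queue hq h,
      Function.update_self]
    grind
  · by_cases h1 : z = x - 1
    · subst h1
      rw [mem_bell_pred (B := fed _ _ _), mem_fed_iff_queue hq h, mem_fed_iff_queue hq h,
        Function.update_of_ne hxx]
      grind
    · rw [mem_bell_of_ne (B := fed _ _ _) h2 h1, mem_fed_iff_queue hq h,
        Function.update_of_ne (fun h => h2 (sub_left_injective h)), mem_bell_of_ne h2 h1]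
      simp only [ind, mem_bell_of_ne h2 h1]

/-- A jump of the arrivals from a site with a service to a site without one does not change the
departures. -/
theorem fed_bell_of_mem [NeZero N] {x : ZMod N} (hx : x - 1 ≠ x) {S B : Finset (ZMod N)}
    (h : B.card < S.card) (h1 : x ∈ S) (h2 : x - 1 ∉ S) :
    fed ZMod.val S (bell x B) = fed ZMod.val S B := by
  obtain ⟨q, hq⟩ := exists_isQueue h.le
  have hxx : x - 1 - 1 ≠ x - 1 := fun h => hx (sub_left_injective h)
  have m1 := mem_bell_self hx (B := B)
  have m2 := mem_bell_pred (x := x) (B := B)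
  have q1 := hq x
  have q2 := hq (x - 1)
  have i1 := ind_eq_one_or B x
  have i2 := ind_eq_one_or B (x - 1)
  have i3 := ind_of_mem h1
  have i4 := ind_of_notMem h2
  have i5 := ind_eq_one_or (bell x B) x
  have i6 := ind_eq_one_or (bell x B) (x - 1)
  have hq' := isQueue_update (S' := S) (B' := bell x B) hx hq
    (fun z => mem_bell_of_ne) (fun z _ _ => Iff.rfl) (by grind)
  have h' : (bell x B).card < S.card := by rwa [card_bell]
  ext z
  rw [mem_fed_iff_queue hq' h', mem_fed_iff_queue hq h]
  by_cases h3 : z = x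
  · subst h3
    rw [Function.update_self]
    grind
  · by_cases h4 : z = x - 1
    · subst h4
      simp [h2]
    · rw [Function.update_of_ne (fun h => h3 (sub_left_injective h))]
      simp only [ind, mem_bell_of_ne h3 h4]

end Ring

/-! ### The uniform law on the rows is invariant -/

section Rows

variable {N : ℕ}

theorem ZMod.sub_one_ne_self (hN : 1 < N) (x : ZMod N) : x - 1 ≠ x := by
  have : Fact (1 < N) := ⟨hN⟩
  simp

/-- All lists of subsets of the ring whose list of cardinalities is `s`. -/
def rowLists (N : ℕ) [NeZero N] : List ℕ → Finset (List (Finset (ZMod N)))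
  | [] => {[]}
  | k :: s => (Finset.powersetCard k Finset.univ ×ˢ rowLists N s).map
      ⟨fun p => p.1 :: p.2, fun p q h => by
        obtain ⟨h1, h2⟩ := List.cons.inj h
        exact Prod.ext h1 h2⟩

theorem sum_rowLists_cons [NeZero N] (k : ℕ) (s : List ℕ) (g : List (Finset (ZMod N)) → ℝ) :
    ∑ L ∈ rowLists N (k :: s), g L
      = ∑ S ∈ Finset.powersetCard k Finset.univ, ∑ L ∈ rowLists N s, g (S :: L) := by
  rw [rowLists, Finset.sum_map, Finset.sum_product]
  rfl

theorem mem_rowLists [NeZero N] {s : List ℕ} {L : List (Finset (ZMod N))} :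
    L ∈ rowLists N s ↔ L.map Finset.card = s := by
  induction s generalizing L with
  | nil => simp [rowLists]
  | cons k s ih =>
    rw [rowLists, Finset.mem_map]
    constructor
    · rintro ⟨⟨S, L'⟩, h, rfl⟩
      rw [Finset.mem_product, Finset.mem_powersetCard] at h
      change S.card :: L'.map Finset.card = k :: s
      rw [h.1.2, ih.1 h.2]
    · intro h
      cases L with
      | nil => simp at h
      | cons S L =>
        rw [List.map_cons, List.cons.injEq] at h
        exact ⟨(S, L), by simp [Finset.mem_powersetCard, h.1, ih.2 h.2], rfl⟩

theorem map_card_multiline [NeZero N] {L : List (Finset (ZMod N))}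
    (hL : (L.map Finset.card).Pairwise (· > ·)) :
    (multiline ZMod.val L).map Finset.card = L.map Finset.card := by
  induction L with
  | nil => rfl
  | cons S L ih =>
    rw [List.map_cons, List.pairwise_cons] at hL
    rw [multiline, List.map_cons, List.map_cons, List.map_map]
    congr 1
    have h := ih hL.2
    rw [← h] at hL ⊢
    refine List.map_congr_left fun B hB => ?_
    exact card_fed (hL.1 _ (List.mem_map_of_mem hB))

open Classical in
theorem card_ascents_eq_card_descents [NeZero N] (S : Finset (ZMod N)) :
    (Finset.univ.filter fun x => x ∈ S ∧ x - 1 ∉ S).card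
      = (Finset.univ.filter fun x => x - 1 ∈ S ∧ x ∉ S).card := by
  have h1 := Finset.card_filter_add_card_filter_not (s := S) fun x => x - 1 ∈ S
  have h2 := Finset.card_filter_add_card_filter_not
    (s := Finset.univ.filter fun x => x - 1 ∈ S) fun x => x ∈ S
  have h3 : (Finset.univ.filter fun x => x - 1 ∈ S).card = S.card := by
    refine Finset.card_nbij' (fun x => x - 1) (fun x => x + 1) ?_ ?_ ?_ ?_ <;> intro x <;>
      simp
  have h4 : (S.filter fun x => x - 1 ∈ S)
      = (Finset.univ.filter fun x => x - 1 ∈ S).filter fun x => x ∈ S := by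
    ext x
    simp [and_comm]
  have h5 : (Finset.univ.filter fun x => x ∈ S ∧ x - 1 ∉ S) = S.filter fun x => x - 1 ∉ S := by
    ext x
    simp
  rw [h4] at h1
  rw [Finset.filter_filter (fun x => x - 1 ∈ S) fun x => x ∉ S] at h2
  rw [h5]
  omega

open Classical in
/-- For a bell at a fixed site: summed over the service rows that do not block it, ringing for the
arrivals and ringing for the departures have the same effect. -/
theorem sum_unblocked_bell [NeZero N] (hN : 1 < N) {k : ℕ} {L : List (Finset (ZMod N))}
    (hL : ∀ B ∈ L, B.card < k) (g : List (Finset (ZMod N)) → ℝ) (x : ZMod N) :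
    ∑ S ∈ (Finset.powersetCard k Finset.univ).filter fun S => ¬ (x ∈ S ∧ x - 1 ∉ S),
        g (S :: (L.map (bell x)).map (fed ZMod.val S))
      = ∑ S ∈ (Finset.powersetCard k Finset.univ).filter fun S => ¬ (x - 1 ∈ S ∧ x ∉ S),
        g ((S :: L.map (fed ZMod.val S)).map (bell x)) := by
  have hx := ZMod.sub_one_ne_self hN x
  symm
  refine Finset.sum_nbij' (bell x)
    (fun S => if x - 1 ∈ S ∧ x ∉ S then insert x (S.erase (x - 1)) else S) ?_ ?_ ?_ ?_ ?_
  · intro S hS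
    rw [Finset.mem_filter, Finset.mem_powersetCard] at hS ⊢
    rw [mem_bell_self hx, mem_bell_pred, card_bell]
    exact ⟨⟨Finset.subset_univ _, hS.1.2⟩, by tauto⟩
  · intro S hS
    rw [Finset.mem_filter, Finset.mem_powersetCard] at hS ⊢
    split_ifs with h
    · refine ⟨⟨Finset.subset_univ _, ?_⟩, by simp⟩
      rw [Finset.card_insert_of_notMem fun h' => h.2 (Finset.mem_of_mem_erase h'),
        Finset.card_erase_of_mem h.1, hS.1.2]
      have := Finset.card_pos.2 ⟨_, h.1⟩
      omega
    · exact ⟨hS.1, h⟩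
  · intro S hS
    rw [Finset.mem_filter] at hS
    by_cases h : x ∈ S ∧ x - 1 ∉ S
    · have h' : x - 1 ∈ bell x S ∧ x ∉ bell x S := by
        rw [mem_bell_self hx, mem_bell_pred]
        tauto
      rw [if_pos h', bell_of_jump h.1 h.2, Finset.erase_insert, Finset.insert_erase h.1]
      simp [h.2]
    · have h' : bell x S = S := if_neg h
      rw [h', if_neg hS.2]
  · intro S hS
    rw [Finset.mem_filter] at hS
    by_cases h : x - 1 ∈ S ∧ x ∉ S
    · rw [if_pos h, bell_of_jump (by simp) (by simp [hx]), Finset.erase_insert,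
        Finset.insert_erase h.1]
      simp [h.2]
    · rw [if_neg h]
      exact if_neg hS.2
  · intro S hS
    rw [Finset.mem_filter, Finset.mem_powersetCard] at hS
    rw [List.map_cons, List.map_map, List.map_map]
    congr 2
    refine List.map_congr_left fun B hB => ?_
    exact (fed_bell_bell hx (by rw [hS.1.2]; exact hL B hB) hS.2).symm

/-- A uniformly random bell for the arrivals followed by a queue with a uniformly random service
row has the same effect as that queue followed by a uniformly random bell for the departures. -/
theorem sum_bell_fed [NeZero N] (hN : 1 < N) {k : ℕ} {L : List (Finset (ZMod N))}
    (hL : ∀ B ∈ L, B.card < k) (g : List (Finset (ZMod N)) → ℝ) :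
    ∑ S ∈ Finset.powersetCard k Finset.univ, ∑ x,
        g (S :: (L.map (bell x)).map (fed ZMod.val S))
      = ∑ S ∈ Finset.powersetCard k Finset.univ, ∑ x,
        g ((S :: L.map (fed ZMod.val S)).map (bell x)) := by
  classical
  set h : Finset (ZMod N) → ℝ := fun S => g (S :: L.map (fed ZMod.val S)) with hh
  have h1 : ∀ x, ∑ S ∈ (Finset.powersetCard k Finset.univ).filter fun S => x ∈ S ∧ x - 1 ∉ S,
      g (S :: (L.map (bell x)).map (fed ZMod.val S))
        = ∑ S ∈ (Finset.powersetCard k Finset.univ).filter fun S => x ∈ S ∧ x - 1 ∉ S, h S := by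
    intro x
    refine Finset.sum_congr rfl fun S hS => ?_
    rw [Finset.mem_filter, Finset.mem_powersetCard] at hS
    rw [hh, List.map_map]
    congr 2
    refine List.map_congr_left fun B hB => ?_
    exact fed_bell_of_mem (ZMod.sub_one_ne_self hN x) (by rw [hS.1.2]; exact hL B hB)
      hS.2.1 hS.2.2
  have h2 : ∀ x, ∑ S ∈ (Finset.powersetCard k Finset.univ).filter fun S => x - 1 ∈ S ∧ x ∉ S,
      g ((S :: L.map (fed ZMod.val S)).map (bell x))
        = ∑ S ∈ (Finset.powersetCard k Finset.univ).filter fun S => x - 1 ∈ S ∧ x ∉ S, h S := by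
    intro x
    refine Finset.sum_congr rfl fun S hS => ?_
    rw [Finset.mem_filter] at hS
    rw [hh, List.map_cons, List.map_map, bell_of_notMem hS.2.2]
    congr 2
    refine List.map_congr_left fun B hB => ?_
    exact bell_of_notMem fun hxx => hS.2.2 (fed_subset _ _ _ hxx)
  have h3 : ∑ x : ZMod N, ∑ S ∈ (Finset.powersetCard k Finset.univ).filter
        fun S => x ∈ S ∧ x - 1 ∉ S, h S
      = ∑ x : ZMod N, ∑ S ∈ (Finset.powersetCard k Finset.univ).filter
        fun S => x - 1 ∈ S ∧ x ∉ S, h S := by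
    simp only [Finset.sum_filter]
    rw [Finset.sum_comm, Finset.sum_comm (s := Finset.univ)]
    refine Finset.sum_congr rfl fun S _ => ?_
    rw [← Finset.sum_filter, ← Finset.sum_filter, Finset.sum_const, Finset.sum_const,
      card_ascents_eq_card_descents]
  rw [Finset.sum_comm, Finset.sum_comm (s := Finset.powersetCard k Finset.univ)]
  calc _ = ∑ x : ZMod N, (∑ S ∈ (Finset.powersetCard k Finset.univ).filter
              fun S => x ∈ S ∧ x - 1 ∉ S, h S
            + ∑ S ∈ (Finset.powersetCard k Finset.univ).filter fun S => ¬ (x - 1 ∈ S ∧ x ∉ S),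
                g ((S :: L.map (fed ZMod.val S)).map (bell x))) := by
        refine Finset.sum_congr rfl fun x _ => ?_
        rw [← h1, ← sum_unblocked_bell hN hL, Finset.sum_filter_add_sum_filter_not]
    _ = _ := by
        rw [Finset.sum_add_distrib, h3, ← Finset.sum_add_distrib]
        refine Finset.sum_congr rfl fun x _ => ?_
        rw [← h2, Finset.sum_filter_add_sum_filter_not]

/-- **Invariance.** The image of the uniform law on the rows under the multiline queue is invariant
under a bell at a uniformly random site. -/
theorem sum_bell_multiline [NeZero N] (hN : 1 < N) {s : List ℕ} (hs : s.Pairwise (· > ·))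
    (g : List (Finset (ZMod N)) → ℝ) :
    ∑ L ∈ rowLists N s, ∑ x, g ((multiline ZMod.val L).map (bell x))
      = N * ∑ L ∈ rowLists N s, g (multiline ZMod.val L) := by
  induction s generalizing g with
  | nil => simp [rowLists, multiline, ZMod.card]
  | cons k s ih =>
    rw [List.pairwise_cons] at hs
    rw [sum_rowLists_cons, sum_rowLists_cons, Finset.mul_sum]
    simp only [multiline]
    rw [Finset.sum_comm]
    calc _ = ∑ L ∈ rowLists N s, ∑ S ∈ Finset.powersetCard k Finset.univ, ∑ x,
          g (S :: ((multiline ZMod.val L).map (bell x)).map (fed ZMod.val S)) := by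
          refine Finset.sum_congr rfl fun L hL => (sum_bell_fed hN ?_ g).symm
          intro B hB
          rw [mem_rowLists] at hL
          subst hL
          refine hs.1 _ ?_
          rw [← map_card_multiline hs.2]
          exact List.mem_map_of_mem hB
      _ = _ := by
          rw [Finset.sum_comm]
          refine Finset.sum_congr rfl fun S _ => ?_
          exact ih hs.2 fun L => g (S :: L.map (fed ZMod.val S))

end Rows

/-! ### Invariant laws of finite chains driven by random maps -/

section Chain

variable {Y I : Type*} [Fintype Y] [Fintype I]

open Classical in
/-- The number of maps of the family `T` that send `y` to `z`. -/
noncomputable def mapCount (T : I → Y → Y) (y z : Y) : ℝ :=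
  ((Finset.univ.filter fun i => T i y = z).card : ℝ)

theorem sum_mul_mapCount (T : I → Y → Y) (y : Y) (g : Y → ℝ) :
    ∑ z, mapCount T y z * g z = ∑ i, g (T i y) := by
  classical
  simp only [mapCount]
  rw [← Finset.sum_fiberwise (s := Finset.univ) (g := fun i => T i y)]
  refine Finset.sum_congr rfl fun z _ => ?_
  rw [Finset.sum_congr rfl (g := fun _ => g z), Finset.sum_const, nsmul_eq_mul]
  intro i hi
  rw [(Finset.mem_filter.1 hi).2]

/-- `h` is a (signed) invariant weight for the uniformly random choice of a map of the family. -/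
def IsInvariantWeight (T : I → Y → Y) (h : Y → ℝ) : Prop :=
  ∀ z, ∑ y, h y * mapCount T y z = Fintype.card I * h z

theorem isInvariantWeight_of_forall_test {T : I → Y → Y} {h : Y → ℝ}
    (H : ∀ g : Y → ℝ, ∑ y, h y * ∑ i, g (T i y) = Fintype.card I * ∑ y, h y * g y) :
    IsInvariantWeight T h := by
  classical
  intro z
  have := H fun y => if y = z then 1 else 0
  simpa [mapCount] using this

/-- The absolute value of an invariant weight is invariant, since the triangle inequality cannot
be strict at any state. -/
theorem IsInvariantWeight.abs {T : I → Y → Y} {h : Y → ℝ} (hh : IsInvariantWeight T h) :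
    IsInvariantWeight T fun y => |h y| := by
  have hnn : ∀ y z, 0 ≤ mapCount T y z := fun y z => Nat.cast_nonneg _
  have hle : ∀ z ∈ Finset.univ, (Fintype.card I : ℝ) * |h z| ≤ ∑ y, |h y| * mapCount T y z := by
    intro z _
    rw [← Nat.abs_cast (Fintype.card I), ← abs_mul, ← hh z]
    refine (Finset.abs_sum_le_sum_abs _ _).trans_eq (Finset.sum_congr rfl fun y _ => ?_)
    rw [abs_mul, abs_of_nonneg (hnn y z)]
  have hsum : ∑ z, (Fintype.card I : ℝ) * |h z| = ∑ z, ∑ y, |h y| * mapCount T y z := by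
    rw [Finset.sum_comm]
    refine Finset.sum_congr rfl fun y _ => ?_
    have := sum_mul_mapCount T y fun _ => 1
    simp only [mul_one, Finset.sum_const, Finset.card_univ, nsmul_eq_mul] at this
    rw [← Finset.mul_sum, this, mul_comm]
  intro z
  exact ((Finset.sum_eq_sum_iff_of_le hle).1 hsum z (Finset.mem_univ z)).symm

theorem IsInvariantWeight.pos_of_reachable {T : I → Y → Y} {h : Y → ℝ} (hh : IsInvariantWeight T h)
    (hnn : ∀ y, 0 ≤ h y) {y r : Y} (hy : 0 < h y)
    (hr : Relation.ReflTransGen (fun a b => ∃ i, T i a = b) y r) : 0 < h r := by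
  classical
  induction hr with
  | refl => exact hy
  | @tail b c _ hbc ih =>
    obtain ⟨i, rfl⟩ := hbc
    have h1 : 0 < h b * mapCount T b (T i b) := by
      refine mul_pos ih (Nat.cast_pos.2 (Finset.card_pos.2 ⟨i, by simp⟩))
    have h2 : 0 < ∑ y, h y * mapCount T y (T i b) :=
      Finset.sum_pos' (fun y _ => mul_nonneg (hnn y) (Nat.cast_nonneg _))
        ⟨b, Finset.mem_univ b, h1⟩
    rw [hh] at h2
    exact pos_of_mul_pos_right h2 (Nat.cast_nonneg _)

theorem IsInvariantWeight.eq_zero {T : I → Y → Y} {h : Y → ℝ} (hh : IsInvariantWeight T h)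
    (hsum : ∑ y, h y = 0) {r : Y}
    (hr : ∀ y, Relation.ReflTransGen (fun a b => ∃ i, T i a = b) y r) : h = 0 := by
  have hp : IsInvariantWeight T fun y => |h y| + h y := by
    intro z
    have h1 := hh.abs z
    have h2 := hh z
    simp only [add_mul, Finset.sum_add_distrib, mul_add] at h1 h2 ⊢
    rw [h1, h2]
  have hm : IsInvariantWeight T fun y => |h y| - h y := by
    intro z
    have h1 := hh.abs z
    have h2 := hh z
    simp only [sub_mul, Finset.sum_sub_distrib, mul_sub] at h1 h2 ⊢
    rw [h1, h2]
  have hpn : ∀ y, 0 ≤ |h y| + h y := fun y => by linarith [neg_abs_le (h y)]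
  have hmn : ∀ y, 0 ≤ |h y| - h y := fun y => by linarith [le_abs_self (h y)]
  have key : (∀ y, h y ≤ 0) ∨ (∀ y, 0 ≤ h y) := by
    by_contra! hcon
    obtain ⟨⟨y, hy⟩, y', hy'⟩ := hcon
    have h1 := hp.pos_of_reachable hpn (y := y) (by linarith [abs_nonneg (h y)]) (hr y)
    have h2 := hm.pos_of_reachable hmn (y := y') (by linarith [abs_nonneg (h y')]) (hr y')
    rcases abs_cases (h r) with h3 | h3 <;> linarith
  funext y
  rcases key with hk | hk
  · exact (Finset.sum_eq_zero_iff_of_nonpos fun y _ => hk y).1 hsum y (Finset.mem_univ y)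
  · exact (Finset.sum_eq_zero_iff_of_nonneg fun y _ => hk y).1 hsum y (Finset.mem_univ y)

/-- Two weights of the same mass, pushed forward to `Y` and invariant there, have the same
push-forward if some state can be reached from all states. -/
theorem sum_mul_eq_of_invariant {A B : Type*} [Fintype A] [Fintype B] {T : I → Y → Y} {r : Y}
    (hr : ∀ y, Relation.ReflTransGen (fun a b => ∃ i, T i a = b) y r)
    {f : A → Y} {w : A → ℝ} {f' : B → Y} {w' : B → ℝ}
    (hf : ∀ g : Y → ℝ, ∑ a, w a * ∑ i, g (T i (f a)) = Fintype.card I * ∑ a, w a * g (f a))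
    (hf' : ∀ g : Y → ℝ, ∑ b, w' b * ∑ i, g (T i (f' b)) = Fintype.card I * ∑ b, w' b * g (f' b))
    (hsum : ∑ a, w a = ∑ b, w' b) (g : Y → ℝ) :
    ∑ a, w a * g (f a) = ∑ b, w' b * g (f' b) := by
  classical
  set h : Y → ℝ := fun y => (∑ a, if f a = y then w a else 0) - ∑ b, if f' b = y then w' b else 0
    with hdef
  have key : ∀ g : Y → ℝ, ∑ y, h y * g y = ∑ a, w a * g (f a) - ∑ b, w' b * g (f' b) := by
    intro g
    simp only [hdef, sub_mul, Finset.sum_sub_distrib, Finset.sum_mul, ite_mul, zero_mul]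
    congr 1 <;>
    · rw [Finset.sum_comm]
      simp
  have hinv : IsInvariantWeight T h := by
    refine isInvariantWeight_of_forall_test fun g => ?_
    rw [key g, key (fun y => ∑ i, g (T i y)), hf, hf', mul_sub]
  have h0 : h = 0 := by
    refine hinv.eq_zero ?_ hr
    have := key fun _ => 1
    simp only [mul_one] at this
    rw [this, hsum, sub_self]
  have := key g
  rw [h0] at this
  simp only [Pi.zero_apply, zero_mul, Finset.sum_const_zero] at this
  linarith

/-- The matrix of the chain minus the identity kills the constants, so it is singular and kills
some weight from the left. -/
theorem exists_isInvariantWeight [Nonempty Y] (T : I → Y → Y) :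
    ∃ h : Y → ℝ, IsInvariantWeight T h ∧ (∀ y, 0 ≤ h y) ∧ ∑ y, h y = 1 := by
  classical
  set M : Matrix Y Y ℝ := fun y z => mapCount T y z - if y = z then (Fintype.card I : ℝ) else 0
    with hM
  have h1 : M.mulVec (fun _ => 1) = 0 := by
    funext y
    have := sum_mul_mapCount T y fun _ => 1
    simp only [mul_one, Finset.sum_const, Finset.card_univ, nsmul_eq_mul] at this
    simp [Matrix.mulVec, dotProduct, hM, this]
  have h2 : M.det = 0 :=
    Matrix.exists_mulVec_eq_zero_iff.1 ⟨_, fun h => one_ne_zero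
      (congrFun h (Classical.arbitrary Y)), h1⟩
  obtain ⟨v, hv, hvM⟩ := Matrix.exists_vecMul_eq_zero_iff.2 h2
  have hinv : IsInvariantWeight T v := by
    intro z
    have := congrFun hvM z
    simp only [Matrix.vecMul, dotProduct, hM, mul_sub, Finset.sum_sub_distrib, Pi.zero_apply,
      mul_ite, mul_zero, Finset.sum_ite_eq', Finset.mem_univ, if_true] at this
    linarith
  have hpos : 0 < ∑ y, |v y| := by
    obtain ⟨y, hy⟩ := Function.ne_iff.1 hv
    exact Finset.sum_pos' (fun _ _ => abs_nonneg _) ⟨y, Finset.mem_univ y, abs_pos.2 hy⟩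
  refine ⟨fun y => |v y| / ∑ y, |v y|, fun z => ?_, fun y => by positivity, ?_⟩
  · have := hinv.abs z
    simp only [div_mul_eq_mul_div, ← Finset.sum_div]
    rw [this, mul_div_assoc]
  · rw [← Finset.sum_div, div_self hpos.ne']

end Chain

/-! ### The stationary distribution of the TASEP -/

section Tasep

variable {n N : ℕ}

theorem jumpLeft_of_blocked {i : Fin n} {σ : Config n N} (h : ∃ j, j ≤ i ∧ σ j = σ i - 1) :
    jumpLeft i σ = σ := if_pos h

theorem jumpLeft_apply {i : Fin n} {σ : Config n N} (h : ¬ ∃ j, j ≤ i ∧ σ j = σ i - 1)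
    (k : Fin n) : jumpLeft i σ k = Equiv.swap (σ i) (σ i - 1) (σ k) := by
  rw [jumpLeft, if_neg h]
  exact congrArg (fun d => @Equiv.swap _ d (σ i) (σ i - 1) (σ k)) (Subsingleton.elim _ _)

theorem transitionProb_toReal (σ τ : Config n N) :
    (transitionProb σ τ).toReal = mapCount jumpLeft σ τ / n := by
  rw [transitionProb, mapCount, ENNReal.toReal_div, ENNReal.toReal_natCast, ENNReal.toReal_natCast]
  congr!

theorem isStationaryDist_iff [NeZero n] [NeZero N] (p : PMF (Config n N)) :
    IsStationaryDist p ↔ IsInvariantWeight jumpLeft fun σ => (p σ).toReal := by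
  classical
  have hn : (n : ℝ) ≠ 0 := Nat.cast_ne_zero.2 (NeZero.ne n)
  have hfin : ∀ σ τ, p σ * transitionProb σ τ ≠ ⊤ := fun σ τ =>
    ENNReal.mul_ne_top (p.apply_ne_top σ)
      (ENNReal.div_ne_top (ENNReal.natCast_ne_top _) (Nat.cast_ne_zero.2 (NeZero.ne n)))
  refine forall_congr' fun τ => ?_
  rw [tsum_fintype, ← ENNReal.toReal_eq_toReal_iff' (ENNReal.sum_ne_top.2 fun σ _ => hfin σ τ)
    (p.apply_ne_top τ), ENNReal.toReal_sum fun σ _ => hfin σ τ]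
  simp only [ENNReal.toReal_mul, transitionProb_toReal, Fintype.card_fin]
  rw [Finset.sum_congr rfl fun σ _ => (mul_div_assoc _ _ _).symm, ← Finset.sum_div,
    div_eq_iff hn, mul_comm (p τ).toReal]

theorem sum_toReal_pmf {Y : Type*} [Fintype Y] (p : PMF Y) : ∑ y, (p y).toReal = 1 := by
  have := p.tsum_coe
  rw [tsum_fintype] at this
  rw [← ENNReal.toReal_sum fun y _ => p.apply_ne_top y, this, ENNReal.toReal_one]

theorem IsStationaryDist.sum_test [NeZero n] [NeZero N] {p : PMF (Config n N)}
    (hp : IsStationaryDist p) (g : Config n N → ℝ) :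
    ∑ σ, (p σ).toReal * ∑ i, g (jumpLeft i σ) = n * ∑ σ, (p σ).toReal * g σ := by
  have h := (isStationaryDist_iff p).1 hp
  simp only [← sum_mul_mapCount, Finset.mul_sum]
  rw [Finset.sum_comm]
  refine Finset.sum_congr rfl fun τ _ => ?_
  have h' := h τ
  rw [Fintype.card_fin] at h'
  rw [← mul_assoc, ← h', Finset.sum_mul]
  exact Finset.sum_congr rfl fun σ _ => by ring

/-- `τ` can be reached from `σ` by jumps. -/
abbrev Reaches (σ τ : Config n N) : Prop :=
  Relation.ReflTransGen (fun a b : Config n N => ∃ i, jumpLeft i a = b) σ τ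

/-- Once the particles with labels up to `m` stand in a block behind the first one, the next
particle can jump left until it joins the block. -/
theorem exists_reaches_block [NeZero N] (hN : 1 < N) {i₀ i : Fin n} (h0 : i₀ < i) (d : ℕ)
    (σ : Config n N) (hσ : ∀ j < i, (σ j - σ i₀).val = j) (hd : (σ i - σ i₀).val = d) :
    ∃ τ, Reaches σ τ ∧ τ i₀ = σ i₀ ∧ ∀ j ≤ i, (τ j - τ i₀).val = j := by
  have hinj : ∀ a b : ZMod N, (a - σ i₀).val = (b - σ i₀).val → a = b := fun a b h =>
    sub_left_injective (ZMod.val_injective N h)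
  have hlow : (i : ℕ) ≤ d := by
    by_contra! hlt
    have h1 := hσ ⟨d, hlt.trans i.2⟩ hlt
    have h2 := σ.injective (hinj _ _ (hd.trans h1.symm))
    rw [h2] at hlt
    exact lt_irrefl _ hlt
  rcases hlow.eq_or_lt with hid | hid
  · refine ⟨σ, .refl, rfl, fun j hj => ?_⟩
    rcases hj.eq_or_lt with rfl | hj
    · rw [hd, hid]
    · exact hσ j hj
  · have hne : σ i - σ i₀ ≠ 0 := by
      intro h
      rw [h, ZMod.val_zero] at hd
      omega
    have hd' : (σ i - 1 - σ i₀).val + 1 = d := by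
      rw [← hd, ← ZMod.val_sub_one hne, sub_right_comm]
    have hleft : ∀ j < i, σ j ≠ σ i - 1 := by
      intro j hj h
      have h1 := hσ j hj
      rw [h] at h1
      have : (j : ℕ) < i := hj
      omega
    have hfree : ¬ ∃ j, j ≤ i ∧ σ j = σ i - 1 := by
      rintro ⟨j, hj, h⟩
      rcases hj.eq_or_lt with rfl | hj
      · exact ZMod.sub_one_ne_self hN _ h.symm
      · exact hleft j hj h
    have hfix : ∀ j < i, jumpLeft i σ j = σ j := fun j hj => by
      rw [jumpLeft_apply hfree, Equiv.swap_apply_of_ne_of_ne (σ.injective.ne hj.ne) (hleft j hj)]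
    obtain ⟨τ, h1, h2, h3⟩ := exists_reaches_block hN h0 (d - 1) (jumpLeft i σ)
      (fun j hj => by rw [hfix j hj, hfix _ h0, hσ j hj])
      (by rw [hfix _ h0, jumpLeft_apply hfree, Equiv.swap_apply_left]; omega)
    exact ⟨τ, .head ⟨i, rfl⟩ h1, h2.trans (hfix _ h0), h3⟩
termination_by d
decreasing_by omega

theorem exists_reaches_sorted [NeZero N] (hN : 1 < N) (hn : 0 < n) (σ : Config n N) :
    ∃ τ, Reaches σ τ ∧ τ ⟨0, hn⟩ = σ ⟨0, hn⟩ ∧ ∀ j, (τ j - τ ⟨0, hn⟩).val = j := by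
  have key : ∀ m : ℕ, ∃ τ, Reaches σ τ ∧ τ ⟨0, hn⟩ = σ ⟨0, hn⟩ ∧
      ∀ j : Fin n, (j : ℕ) ≤ m → (τ j - τ ⟨0, hn⟩).val = j := by
    intro m
    induction m with
    | zero =>
      refine ⟨σ, .refl, rfl, fun j hj => ?_⟩
      have : j = ⟨0, hn⟩ := Fin.ext (by simpa using hj)
      simp [this]
    | succ m ih =>
      obtain ⟨τ, h1, h2, h3⟩ := ih
      by_cases hm : m + 1 < n
      · obtain ⟨τ', h1', h2', h3'⟩ := exists_reaches_block hN (i₀ := ⟨0, hn⟩) (i := ⟨m + 1, hm⟩)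
          (Fin.mk_lt_mk.2 (Nat.succ_pos m)) _ τ
          (fun j hj => h3 j (Nat.lt_succ_iff.1 (Fin.lt_def.1 hj))) rfl
        exact ⟨τ', h1.trans h1', h2'.trans h2, fun j hj => h3' j hj⟩
      · exact ⟨τ, h1, h2, fun j _ => h3 j (by omega)⟩
  obtain ⟨τ, h1, h2, h3⟩ := key n
  exact ⟨τ, h1, h2, fun j => h3 j j.2.le⟩

theorem reaches_of_val_eq [NeZero N] (hN : 1 < N) (hn : 0 < n) {r : Config n N}
    (hr : ∀ j, (r j).val = j) (k : ℕ) (σ : Config n N) (hσ : (σ ⟨0, hn⟩).val = k) :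
    Reaches σ r := by
  induction k generalizing σ with
  | zero =>
    obtain ⟨τ, h1, h2, h3⟩ := exists_reaches_sorted hN hn σ
    rw [ZMod.val_eq_zero] at hσ
    suffices τ = r by rwa [← this]
    ext j
    apply ZMod.val_injective N
    rw [hr, ← h3 j, h2, hσ, sub_zero]
  | succ k ih =>
    have hfree : ¬ ∃ j, j ≤ ⟨0, hn⟩ ∧ σ j = σ ⟨0, hn⟩ - 1 := by
      rintro ⟨j, hj, h⟩
      have : j = ⟨0, hn⟩ := Fin.ext (Nat.le_zero.1 (Fin.le_def.1 hj))
      rw [this] at h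
      exact ZMod.sub_one_ne_self hN _ h.symm
    refine .head ⟨⟨0, hn⟩, rfl⟩ (ih _ ?_)
    have h0 : σ ⟨0, hn⟩ ≠ 0 := by
      intro h
      rw [h, ZMod.val_zero] at hσ
      omega
    rw [jumpLeft_apply hfree, Equiv.swap_apply_left]
    have := ZMod.val_sub_one h0
    omega

theorem exists_forall_reaches [NeZero N] (hN : 1 < N) (hn : 0 < n) (hnN : n ≤ N) :
    ∃ r : Config n N, ∀ σ, Reaches σ r := by
  have hval : ∀ j : Fin n, ((j : ℕ) : ZMod N).val = j := fun j =>
    ZMod.val_natCast_of_lt (j.2.trans_le hnN)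
  refine ⟨⟨fun j => ((j : ℕ) : ZMod N), fun j k h => Fin.ext ?_⟩, fun σ =>
    reaches_of_val_eq hN hn hval _ σ rfl⟩
  rw [← hval j, ← hval k]
  exact congrArg ZMod.val h

theorem existsUnique_isStationaryDist (hN : 1 < N) (hn : 0 < n) (hnN : n ≤ N) :
    ∃! p : PMF (Config n N), IsStationaryDist p := by
  classical
  have : NeZero n := ⟨hn.ne'⟩
  have : NeZero N := ⟨by omega⟩
  obtain ⟨r, hr⟩ := exists_forall_reaches hN hn hnN
  obtain ⟨h, h1, h2, h3⟩ := @exists_isInvariantWeight _ _ _ _ ⟨r⟩ (jumpLeft (n := n) (N := N))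
  refine ⟨PMF.ofFintype (fun σ => ENNReal.ofReal (h σ)) ?_, ?_, fun p hp => ?_⟩
  · rw [← ENNReal.ofReal_sum_of_nonneg fun σ _ => h2 σ, h3, ENNReal.ofReal_one]
  · refine (isStationaryDist_iff _).2 ?_
    simpa only [PMF.ofFintype_apply, ENNReal.toReal_ofReal (h2 _)] using h1
  · ext τ
    rw [← ENNReal.toReal_eq_toReal_iff' (p.apply_ne_top τ) (PMF.apply_ne_top _ τ)]
    have hp' := (isStationaryDist_iff p).1 hp
    have hz := IsInvariantWeight.eq_zero (T := jumpLeft) (h := fun σ => (p σ).toReal - h σ) (r := r)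
      (fun z => by
        have e1 := hp' z
        have e2 := h1 z
        simp only [sub_mul, Finset.sum_sub_distrib, mul_sub] at e1 e2 ⊢
        rw [e1, e2])
      (by rw [Finset.sum_sub_distrib, sum_toReal_pmf, h3, sub_self]) hr
    have := congrFun hz τ
    rw [PMF.ofFintype_apply, ENNReal.toReal_ofReal (h2 _)]
    simpa [sub_eq_zero] using this

end Tasep

/-! ### The multiline queue yields the stationary distribution -/

section Projection

/-- A chain of nested finite sets is the chain of images of initial segments under one
enumeration. -/
theorem exists_enumeration {α : Type*} [DecidableEq α] [Nonempty α] (L : List (Finset α))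
    (hL : L.Pairwise fun A B => B ⊆ A) (S : Finset α) (hS : ∀ B ∈ L, B ⊆ S) :
    ∃ f : ℕ → α, (Finset.range S.card).image f = S ∧
      ∀ B ∈ L, (Finset.range B.card).image f = B := by
  have enum : ∀ A : Finset α, ∃ e : ℕ → α, (Finset.range A.card).image e = A := by
    intro A
    refine ⟨fun i => if h : i < A.card then (A.equivFin.symm ⟨i, h⟩ : α)
      else Classical.arbitrary α, ?_⟩
    ext a
    simp only [Finset.mem_image, Finset.mem_range]
    constructor
    · rintro ⟨i, hi, rfl⟩
      rw [dif_pos hi]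
      exact Finset.coe_mem _
    · intro ha
      refine ⟨A.equivFin ⟨a, ha⟩, Fin.is_lt _, ?_⟩
      rw [dif_pos (Fin.is_lt _)]
      simp
  induction L generalizing S with
  | nil =>
    obtain ⟨e, he⟩ := enum S
    exact ⟨e, he, by simp⟩
  | cons B₀ L ih =>
    rw [List.pairwise_cons] at hL
    obtain ⟨f, hf, hfL⟩ := ih hL.2 B₀ hL.1
    obtain ⟨e, he⟩ := enum (S \ B₀)
    have hB₀ : B₀ ⊆ S := hS B₀ (by simp)
    set k := B₀.card with hk
    have hlow : ∀ m ≤ k, (Finset.range m).image (fun i => if i < k then f i else e (i - k))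
        = (Finset.range m).image f := by
      intro m hm
      refine Finset.image_congr fun i hi => ?_
      rw [Finset.coe_range, Set.mem_Iio] at hi
      exact if_pos (hi.trans_le hm)
    refine ⟨fun i => if i < k then f i else e (i - k), ?_, ?_⟩
    · have hc : S.card = k + (S \ B₀).card := by
        have := Finset.card_sdiff_add_card_eq_card hB₀
        omega
      rw [hc, Finset.range_add, Finset.image_union, hlow k le_rfl, hf]
      have : (Finset.image (fun i => if i < k then f i else e (i - k))
          (Finset.map (addLeftEmbedding k) (Finset.range (S \ B₀).card))) = S \ B₀ := by
        conv_rhs => rw [← he]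
        rw [Finset.map_eq_image, Finset.image_image]
        refine Finset.image_congr fun i _ => ?_
        simp
      rw [this, Finset.union_sdiff_of_subset hB₀]
    · intro B hB
      rcases List.mem_cons.1 hB with rfl | hB
      · rw [hlow _ le_rfl, hf]
      · rw [hlow _ (Finset.card_le_card (hL.1 B hB)), hfL B hB]

variable {n N : ℕ}

theorem pairwise_multiline [NeZero N] (L : List (Finset (ZMod N))) :
    (multiline ZMod.val L).Pairwise fun A B => B ⊆ A := by
  induction L with
  | nil => exact .nil
  | cons S L ih =>
    rw [multiline, List.pairwise_cons]
    refine ⟨fun B hB => ?_, ih.map _ fun A B h => fed_mono _ _ h⟩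
    obtain ⟨C, -, rfl⟩ := List.mem_map.1 hB
    exact fed_subset _ _ _

/-- The sites of the particles with one of the `k` smallest labels. -/
def labelSet (σ : Config n N) (k : ℕ) : Finset (ZMod N) :=
  (Finset.univ.filter fun i : Fin n => (i : ℕ) < k).map σ

/-- The sets of sites of the particles with one of the `k` smallest labels, for the `k` in a
list: the state of the chain in which only those label sets are recorded. -/
def labelSets (s : List ℕ) (σ : Config n N) : List (Finset (ZMod N)) := s.map (labelSet σ)

theorem mem_labelSet {σ : Config n N} {k : ℕ} {x : ZMod N} :
    x ∈ labelSet σ k ↔ ∃ i : Fin n, (i : ℕ) < k ∧ σ i = x := by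
  simp [labelSet]

theorem apply_mem_labelSet {σ : Config n N} {k : ℕ} {i : Fin n} :
    σ i ∈ labelSet σ k ↔ (i : ℕ) < k := by
  simp [labelSet]

theorem card_labelSet (σ : Config n N) {k : ℕ} (hk : k ≤ n) : (labelSet σ k).card = k := by
  rw [labelSet, Finset.card_map, Fin.card_filter_val_lt]
  omega

theorem bell_labelSet [NeZero N] (hN : 1 < N) (σ : Config n N) (i : Fin n) (k : ℕ) :
    bell (σ i) (labelSet σ k) = labelSet (jumpLeft i σ) k := by
  have hx := ZMod.sub_one_ne_self hN (σ i)
  by_cases hb : ∃ j, j ≤ i ∧ σ j = σ i - 1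
  · rw [jumpLeft_of_blocked hb]
    obtain ⟨j, hj, h⟩ := hb
    by_cases hik : (i : ℕ) < k
    · apply bell_of_mem
      rw [← h, apply_mem_labelSet]
      exact (Fin.le_def.1 hj).trans_lt hik
    · exact bell_of_notMem (by rwa [apply_mem_labelSet])
  · have h1 : ∀ z, z ∈ labelSet (jumpLeft i σ) k
        ↔ Equiv.swap (σ i) (σ i - 1) z ∈ labelSet σ k := by
      intro z
      simp only [mem_labelSet, jumpLeft_apply hb]
      refine exists_congr fun j => and_congr_right fun _ => ?_
      rw [Equiv.swap_apply_eq_iff]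
    have h2 : σ i - 1 ∈ labelSet σ k → σ i ∈ labelSet σ k := by
      rw [apply_mem_labelSet, mem_labelSet]
      rintro ⟨j, hj, h⟩
      by_contra hik
      exact hb ⟨j, Fin.le_def.2 (by omega), h⟩
    ext z
    rw [h1]
    by_cases hz : z = σ i
    · subst hz
      rw [mem_bell_self hx, Equiv.swap_apply_left]
      tauto
    · by_cases hz' : z = σ i - 1
      · subst hz'
        rw [mem_bell_pred, Equiv.swap_apply_right]
        tauto
      · rw [mem_bell_of_ne hz hz', Equiv.swap_apply_of_ne_of_ne hz hz']

theorem map_bell_labelSets [NeZero N] (hN : 1 < N) (s : List ℕ) (σ : Config n N) (i : Fin n) :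
    (labelSets s σ).map (bell (σ i)) = labelSets s (jumpLeft i σ) := by
  rw [labelSets, labelSets, List.map_map]
  exact List.map_congr_left fun k _ => bell_labelSet hN σ i k

theorem map_bell_labelSets_of_vacant (s : List ℕ) (σ : Config n N) {x : ZMod N}
    (hx : ∀ i, σ i ≠ x) : (labelSets s σ).map (bell x) = labelSets s σ := by
  rw [labelSets, List.map_map]
  refine List.map_congr_left fun k _ => bell_of_notMem ?_
  rw [mem_labelSet]
  rintro ⟨i, -, h⟩
  exact hx i h

/-- A bell at a vacant site has no effect, and one at the site of a particle makes it jump. -/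
theorem sum_bell_labelSets [NeZero N] (hN : 1 < N) (hnN : n ≤ N) (s : List ℕ) (σ : Config n N)
    (g : List (Finset (ZMod N)) → ℝ) :
    ∑ x, g ((labelSets s σ).map (bell x))
      = ∑ i, g (labelSets s (jumpLeft i σ)) + ((N : ℝ) - n) * g (labelSets s σ) := by
  rw [← Finset.sum_add_sum_compl (Finset.univ.map σ), Finset.sum_map]
  congr 1
  · exact Finset.sum_congr rfl fun i _ => by rw [map_bell_labelSets hN]
  · rw [Finset.sum_congr rfl (g := fun _ => g (labelSets s σ)), Finset.sum_const,
      Finset.card_compl, Finset.card_map, Finset.card_univ, Fintype.card_fin, ZMod.card,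
      nsmul_eq_mul, Nat.cast_sub hnN]
    intro x hx
    rw [map_bell_labelSets_of_vacant]
    simpa using hx

theorem labelSets_mem_rowLists [NeZero N] {s : List ℕ} (hs : ∀ k ∈ s, k ≤ n) (σ : Config n N) :
    labelSets s σ ∈ rowLists N s := by
  rw [mem_rowLists, labelSets, List.map_map]
  exact (List.map_congr_left fun k hk => card_labelSet σ (hs k hk)).trans (List.map_id s)

theorem exists_labelSets_eq_multiline [NeZero N] {s : List ℕ}
    (hs : (n :: s).Pairwise (· > ·)) {L : List (Finset (ZMod N))}
    (hL : L ∈ rowLists N (n :: s)) :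
    ∃ σ : Config n N, labelSets (n :: s) σ = multiline ZMod.val L := by
  rw [mem_rowLists] at hL
  have h1 := pairwise_multiline L
  have h2 := map_card_multiline (hL ▸ hs)
  rw [hL] at h2
  cases hM : multiline ZMod.val L with
  | nil => simp [hM] at h2
  | cons S M =>
    rw [hM, List.map_cons, List.cons.injEq] at h2
    rw [hM, List.pairwise_cons] at h1
    obtain ⟨f, hf, hfM⟩ := exists_enumeration M h1.2 S h1.1
    have hinj : Set.InjOn f (Finset.range S.card) := by
      rw [← Finset.card_image_iff, hf, Finset.card_range]
    rw [h2.1] at hinj hf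
    refine ⟨⟨fun i => f i, fun i j h => Fin.ext (hinj (by simp) (by simp) h)⟩, ?_⟩
    have hset : ∀ k ≤ n, labelSet ⟨fun i : Fin n => f i, fun i j h =>
        Fin.ext (hinj (by simp) (by simp) h)⟩ k = (Finset.range k).image f := by
      intro k hk
      ext x
      rw [mem_labelSet, Finset.mem_image]
      constructor
      · rintro ⟨i, hi, rfl⟩
        exact ⟨i, Finset.mem_range.2 hi, rfl⟩
      · rintro ⟨i, hi, rfl⟩
        rw [Finset.mem_range] at hi
        exact ⟨⟨i, hi.trans_le hk⟩, hi, rfl⟩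
    rw [labelSets, List.map_cons, hset n le_rfl, hf, ← h2.2, List.map_map]
    congr 1
    refine (List.map_congr_left fun B hB => ?_).trans (List.map_id M)
    have hB' : B.card ≤ n := by
      rw [← h2.1]
      exact Finset.card_le_card (h1.1 B hB)
    rw [Function.comp_apply, hset _ hB', hfM B hB, id]

/-- The mean of `g` over the outputs of the multiline queue with uniformly random rows. -/
noncomputable def multilineMean (N : ℕ) [NeZero N] (s : List ℕ)
    (g : List (Finset (ZMod N)) → ℝ) : ℝ :=
  (∑ L ∈ rowLists N s, g (multiline ZMod.val L)) / (rowLists N s).card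

/-- **Ferrari–Martin.** For a stationary distribution of the TASEP, any record of label sets that
includes the set of all particles has the law of the output of the multiline queue. -/
theorem sum_labelSets_eq_multilineMean [NeZero n] [NeZero N] (hN : 1 < N) (hnN : n ≤ N)
    {p : PMF (Config n N)} (hp : IsStationaryDist p) {s : List ℕ}
    (hs : (n :: s).Pairwise (· > ·)) (g : List (Finset (ZMod N)) → ℝ) :
    ∑ σ, (p σ).toReal * g (labelSets (n :: s) σ) = multilineMean N (n :: s) g := by
  classical
  set s' := n :: s with hs'
  have hle : ∀ k ∈ s', k ≤ n := by
    intro k hk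
    rw [List.pairwise_cons] at hs
    rcases List.mem_cons.1 hk with rfl | hk
    · exact le_rfl
    · exact (hs.1 k hk).le
  obtain ⟨r, hr⟩ := exists_forall_reaches hN (NeZero.pos n) hnN
  let Y := Set.range fun σ : Config n N => labelSets s' σ
  let T : ZMod N → Y → Y := fun x y => ⟨y.1.map (bell x), by
    obtain ⟨_, σ, rfl⟩ := y
    by_cases hx : ∃ i, σ i = x
    · obtain ⟨i, rfl⟩ := hx
      exact ⟨jumpLeft i σ, (map_bell_labelSets hN s' σ i).symm⟩
    · push Not at hx
      exact ⟨σ, (map_bell_labelSets_of_vacant s' σ hx).symm⟩⟩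
  let f : Config n N → Y := fun σ => ⟨labelSets s' σ, σ, rfl⟩
  let f' : {L // L ∈ rowLists N s'} → Y := fun L =>
    ⟨multiline ZMod.val L.1, exists_labelSets_eq_multiline hs L.2⟩
  have hreach : ∀ y : Y, Relation.ReflTransGen (fun a b => ∃ x, T x a = b) y (f r) := by
    rintro ⟨_, σ, rfl⟩
    refine Relation.ReflTransGen.lift f ?_ _ _ (hr σ)
    rintro a _ ⟨i, rfl⟩
    exact ⟨a i, Subtype.ext (map_bell_labelSets hN s' a i)⟩
  have hext : ∀ (h : Y → ℝ) (y : Y), h y = Function.extend Subtype.val h 0 y.1 := fun h y =>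
    (Subtype.val_injective.extend_apply h 0 y).symm
  have hcard : ((rowLists N s').card : ℝ) ≠ 0 :=
    Nat.cast_ne_zero.2 (Finset.card_ne_zero_of_mem (labelSets_mem_rowLists hle r))
  have key := sum_mul_eq_of_invariant (f := f) (w := fun σ => (p σ).toReal) (f' := f')
    (w' := fun _ => ((rowLists N s').card : ℝ)⁻¹) hreach
    (fun h => by
      simp only [hext h]
      set G := Function.extend Subtype.val h 0
      have h1 := hp.sum_test fun σ => G (labelSets s' σ)
      change ∑ σ, (p σ).toReal * ∑ x, G ((labelSets s' σ).map (bell x))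
        = _ * ∑ σ, (p σ).toReal * G (labelSets s' σ)
      simp only [sum_bell_labelSets hN hnN, mul_add, Finset.sum_add_distrib, h1, ZMod.card]
      rw [Finset.sum_congr rfl fun σ _ => mul_left_comm _ ((N : ℝ) - n) _, ← Finset.mul_sum]
      ring)
    (fun h => by
      simp only [hext h]
      set G := Function.extend Subtype.val h 0
      change ∑ L : {L // L ∈ rowLists N s'}, _ * ∑ x, G ((multiline ZMod.val L.1).map (bell x))
        = _ * ∑ L : {L // L ∈ rowLists N s'}, _ * G (multiline ZMod.val L.1)
      rw [← Finset.mul_sum, ← Finset.mul_sum,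
        Finset.sum_coe_sort (rowLists N s') fun L => ∑ x, G ((multiline ZMod.val L).map (bell x)),
        Finset.sum_coe_sort (rowLists N s') fun L => G (multiline ZMod.val L),
        sum_bell_multiline hN hs, ZMod.card]
      ring)
    (by
      rw [sum_toReal_pmf, Finset.sum_const, Finset.card_univ, Fintype.card_coe, nsmul_eq_mul,
        mul_inv_cancel₀ hcard])
    (fun y => g y.1)
  rw [key, ← Finset.mul_sum, Finset.sum_coe_sort (rowLists N s') fun L => g (multiline ZMod.val L),
    multilineMean, div_eq_inv_mul]

end Projection

/-! ### The multiline queue depends on the order of the points only -/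

section SameOrder

variable {ι κ α β : Type*} [LinearOrder α] [LinearOrder β]

/-- Two labellings of `ι` by positions order `ι` in the same way. -/
def SameOrder (v : ι → α) (w : ι → β) : Prop := ∀ a b, v a < v b ↔ w a < w b

theorem SameOrder.le_iff {v : ι → α} {w : ι → β} (h : SameOrder v w) (a b : ι) :
    v a ≤ v b ↔ w a ≤ w b := by
  rw [← not_lt, ← not_lt, h]

theorem SameOrder.arc_eq {v : ι → α} {w : ι → β} (h : SameOrder v w) : arc v = arc w := by
  funext a b S
  ext t
  simp only [mem_arc, CycBtw, h.le_iff]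

theorem SameOrder.fed_eq {v : ι → α} {w : ι → β} (h : SameOrder v w) : fed v = fed w := by
  funext S B
  ext z
  simp only [mem_fed, h.arc_eq]

theorem SameOrder.multiline_eq {v : ι → α} {w : ι → β} (h : SameOrder v w)
    (L : List (Finset ι)) : multiline v L = multiline w L := by
  induction L with
  | nil => rfl
  | cons S L ih => rw [multiline, multiline, ih, h.fed_eq]

theorem arc_image [DecidableEq κ] (v : κ → α) (x : ι → κ) (a b : ι) (S : Finset ι) :
    arc v (x a) (x b) (S.image x) = (arc (v ∘ x) a b S).image x := by
  classical
  rw [arc, arc, Finset.filter_image]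
  rfl

theorem fed_image [DecidableEq κ] (v : κ → α) {x : ι → κ} (hx : Function.Injective x)
    (S B : Finset ι) : fed v (S.image x) (B.image x) = (fed (v ∘ x) S B).image x := by
  classical
  rw [fed, fed, Finset.filter_image]
  congr 1
  refine Finset.filter_congr fun z _ => ?_
  simp only [Finset.exists_mem_image, arc_image, Finset.card_image_of_injective _ hx]

theorem multiline_image [DecidableEq κ] (v : κ → α) {x : ι → κ} (hx : Function.Injective x)
    (L : List (Finset ι)) :
    multiline v (L.map (Finset.image x)) = (multiline (v ∘ x) L).map (Finset.image x) := by
  induction L with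
  | nil => rfl
  | cons S L ih =>
    rw [List.map_cons, multiline, multiline, List.map_cons, ih, List.map_map, List.map_map]
    congr 1
    exact List.map_congr_left fun B _ => fed_image v hx S B

end SameOrder

/-! ### Uniformly random rows from independent uniform points -/

section Rows

/-- The indices of the points: `s k` points for each row `k`. -/
abbrev Idx (s : List ℕ) : Type := Σ k : Fin s.length, Fin (s.get k)

/-- The row `k`, as a set of indices. -/
def idxRow (s : List ℕ) (k : Fin s.length) : Finset (Idx s) := Finset.univ.filter fun a => a.1 = k

/-- The list of the rows, as sets of indices. -/
def idxRows (s : List ℕ) : List (Finset (Idx s)) := List.ofFn (idxRow s)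

theorem image_idxRow {s : List ℕ} {α : Type*} [DecidableEq α] (x : Idx s → α)
    (k : Fin s.length) : (idxRow s k).image x = Finset.univ.image fun j => x ⟨k, j⟩ := by
  ext y
  simp only [idxRow, Finset.mem_image, Finset.mem_filter, Finset.mem_univ, true_and]
  constructor
  · rintro ⟨⟨k', j⟩, rfl, rfl⟩
    exact ⟨j, rfl⟩
  · rintro ⟨j, rfl⟩
    exact ⟨⟨k, j⟩, rfl, rfl⟩

theorem card_idxRow (s : List ℕ) (k : Fin s.length) : (idxRow s k).card = s.get k := by
  have h := image_idxRow (s := s) id k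
  rw [Finset.image_id] at h
  rw [h, Finset.card_image_of_injective _ fun i j h => by simpa using h, Finset.card_univ,
    Fintype.card_fin]

theorem map_card_idxRows (s : List ℕ) : (idxRows s).map Finset.card = s := by
  rw [idxRows, List.map_ofFn]
  conv_rhs => rw [← List.ofFn_get s]
  congr 1
  funext k
  exact card_idxRow s k

theorem map_image_idxRows_mem {N : ℕ} [NeZero N] {s : List ℕ} {x : Idx s → ZMod N}
    (hx : Function.Injective x) : (idxRows s).map (Finset.image x) ∈ rowLists N s := by
  rw [mem_rowLists, List.map_map]
  conv_rhs => rw [← map_card_idxRows s]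
  exact List.map_congr_left fun B _ => Finset.card_image_of_injective B hx

theorem card_filter_image_eq {α : Type*} [Fintype α] [DecidableEq α] {m : ℕ} {S : Finset α}
    (hS : S.card = m) :
    (Finset.univ.filter fun f : Fin m → α => Finset.univ.image f = S).card = m.factorial := by
  have h1 : Fintype.card (Fin m ≃ S) = m.factorial := by
    rw [Fintype.card_equiv (S.equivFinOfCardEq hS).symm, Fintype.card_fin]
  rw [← h1, ← Finset.card_univ]
  symm
  refine Finset.card_bij (fun e _ j => (e j : α)) ?_ ?_ ?_
  · intro e _
    rw [Finset.mem_filter]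
    refine ⟨Finset.mem_univ _, ?_⟩
    ext a
    simp only [Finset.mem_image, Finset.mem_univ, true_and]
    constructor
    · rintro ⟨j, rfl⟩
      exact (e j).2
    · intro ha
      exact ⟨e.symm ⟨a, ha⟩, by simp⟩
  · intro e _ e' _ h
    ext j
    exact congrFun h j
  · intro f hf
    rw [Finset.mem_filter] at hf
    have hmem : ∀ j, f j ∈ S := fun j => by
      rw [← hf.2]
      exact Finset.mem_image_of_mem f (Finset.mem_univ j)
    have hbij : Function.Bijective fun j => (⟨f j, hmem j⟩ : S) := by
      rw [Fintype.bijective_iff_surjective_and_card, Fintype.card_fin, Fintype.card_coe, hS]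
      refine ⟨fun a => ?_, rfl⟩
      obtain ⟨j, -, hj⟩ := Finset.mem_image.1 (hf.2.ge a.2)
      exact ⟨j, Subtype.ext hj⟩
    exact ⟨Equiv.ofBijective _ hbij, Finset.mem_univ _, rfl⟩

/-- Every list of rows of the right sizes is the image of the same number of tuples of points. -/
theorem card_filter_map_image_eq {N : ℕ} [NeZero N] {s : List ℕ} {L : List (Finset (ZMod N))}
    (hL : L ∈ rowLists N s) :
    (Finset.univ.filter fun x : Idx s → ZMod N => (idxRows s).map (Finset.image x) = L).card
      = ∏ k, (s.get k).factorial := by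
  rw [mem_rowLists] at hL
  have hlen : s.length = L.length := by rw [← hL, List.length_map]
  have hcard : ∀ k : Fin s.length, (L.get (k.cast hlen)).card = s.get k := by
    intro k
    subst hL
    simp
  have h1 : ∀ x : Idx s → ZMod N, (idxRows s).map (Finset.image x) = L ↔
      ∀ k, (Finset.univ.image fun j => x ⟨k, j⟩) = L.get (k.cast hlen) := by
    intro x
    have hL' : L = List.ofFn fun k : Fin s.length => L.get (k.cast hlen) := by
      refine List.ext_get (by simp [hlen]) fun i h1 h2 => ?_
      simp
    conv_lhs => rw [hL', idxRows, List.map_ofFn, List.ofFn_inj, funext_iff]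
    simp only [Function.comp_apply, image_idxRow]
  simp only [h1]
  rw [← Finset.prod_congr rfl fun k _ => card_filter_image_eq (hcard k), ← Fintype.card_piFinset]
  refine Finset.card_nbij' (fun x k j => x ⟨k, j⟩) (fun y a => y a.1 a.2) ?_ ?_ ?_ ?_
  · intro x hx
    simpa [Fintype.mem_piFinset] using hx
  · intro y hy
    simpa [Fintype.mem_piFinset] using hy
  · intro x _
    rfl
  · intro y _
    rfl

open Classical in
/-- The mean over uniformly random rows, expressed through tuples of points that need not be
distinct. -/
theorem multilineMean_eq_div {N : ℕ} [NeZero N] (s : List ℕ) (g : List (Finset (ZMod N)) → ℝ) :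
    multilineMean N s g
      = (∑ x : Idx s → ZMod N, if (idxRows s).map (Finset.image x) ∈ rowLists N s then
            g (multiline ZMod.val ((idxRows s).map (Finset.image x))) else 0)
        / ∑ x : Idx s → ZMod N,
            if (idxRows s).map (Finset.image x) ∈ rowLists N s then 1 else 0 := by
  have key : ∀ G : List (Finset (ZMod N)) → ℝ,
      ∑ x : Idx s → ZMod N, (if (idxRows s).map (Finset.image x) ∈ rowLists N s then
        G ((idxRows s).map (Finset.image x)) else 0)
      = (∏ k, (s.get k).factorial : ℕ) * ∑ L ∈ rowLists N s, G L := by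
    intro G
    rw [← Finset.sum_filter, ← Finset.sum_fiberwise_of_maps_to (t := rowLists N s)
      (g := fun x => (idxRows s).map (Finset.image x)) (by simp), Finset.mul_sum]
    refine Finset.sum_congr rfl fun L hL => ?_
    rw [Finset.filter_filter, Finset.sum_congr rfl (g := fun _ => G L), Finset.sum_const,
      nsmul_eq_mul, ← card_filter_map_image_eq hL]
    · congr 3
      ext x
      simp only [Finset.mem_filter, Finset.mem_univ, true_and]
      exact ⟨fun h => h.2, fun h => ⟨h ▸ hL, h⟩⟩
    · intro x hx
      rw [(Finset.mem_filter.1 hx).2.2]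
  rw [key fun L => g (multiline ZMod.val L), key fun _ => 1, mul_div_mul_left, multilineMean]
  · simp
  · exact Nat.cast_ne_zero.2 (Finset.prod_ne_zero_iff.2 fun k _ => Nat.factorial_ne_zero _)

end Rows

/-! ### Independent uniform points and their discretizations -/

section Cube

variable {ι : Type*}

/-- All points lie in `[0, 1)` and no two of them coincide. -/
def Generic (u : ι → ℝ) : Prop := (∀ a, u a ∈ Set.Ico (0 : ℝ) 1) ∧ Function.Injective u

/-- The sites of the ring with `N` sites to which the points of `[0, 1)` are rounded down. -/
noncomputable def disc (N : ℕ) (u : ι → ℝ) : ι → ZMod N := fun a => ((⌊N * u a⌋₊ : ℕ) : ZMod N)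

theorem measurable_disc (N : ℕ) : Measurable (disc N : (ι → ℝ) → ι → ZMod N) := by
  refine measurable_pi_iff.2 fun a => ?_
  exact measurable_from_top.comp (Nat.measurable_floor.comp ((measurable_pi_apply a).const_mul _))

theorem val_disc {N : ℕ} [NeZero N] {u : ι → ℝ} {a : ι} (h : u a ∈ Set.Ico (0 : ℝ) 1) :
    (disc N u a).val = ⌊N * u a⌋₊ := by
  have hN : (0 : ℝ) < N := Nat.cast_pos.2 (NeZero.pos N)
  apply ZMod.val_natCast_of_lt
  rw [Nat.floor_lt (mul_nonneg hN.le h.1)]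
  nlinarith [h.2]

variable [Fintype ι]

/-- The uniform law on `[0, 1)`. -/
noncomputable def unifIco : Measure ℝ := volume.restrict (Set.Ico 0 1)

instance : IsProbabilityMeasure unifIco := ⟨by simp [unifIco]⟩

/-- The law of independent uniform points of `[0, 1)`. -/
noncomputable def cube (ι : Type*) [Fintype ι] : Measure (ι → ℝ) := Measure.pi fun _ => unifIco

instance : IsProbabilityMeasure (cube ι) := by
  unfold cube
  infer_instance

theorem cube_eq_restrict :
    cube ι = (volume : Measure (ι → ℝ)).restrict (Set.univ.pi fun _ => Set.Ico 0 1) := by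
  rw [cube, volume_pi, Measure.restrict_pi_pi]
  rfl

theorem ae_generic : ∀ᵐ u ∂cube ι, Generic u := by
  rw [cube_eq_restrict]
  have h1 := ae_restrict_mem (μ := (volume : Measure (ι → ℝ)))
    (MeasurableSet.univ_pi fun _ : ι => measurableSet_Ico (a := (0 : ℝ)) (b := 1))
  have h2 : ∀ a b : ι, a ≠ b → ∀ᵐ u : ι → ℝ, u a ≠ u b := by
    classical
    intro a b hab
    let W : Submodule ℝ (ι → ℝ) := LinearMap.ker
      (LinearMap.proj (R := ℝ) (φ := fun _ : ι => ℝ) a - LinearMap.proj b)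
    have hW : W ≠ ⊤ := by
      intro h
      have : (Pi.single a 1 : ι → ℝ) ∈ W := h ▸ Submodule.mem_top
      simp [W, hab] at this
    have := Measure.addHaar_submodule (volume : Measure (ι → ℝ)) W hW
    rw [ae_iff]
    convert this using 2
    ext u
    simp [W, sub_eq_zero]
  have h3 : ∀ᵐ u : ι → ℝ, ∀ a b, a ≠ b → u a ≠ u b := by
    simp only [ae_all_iff]
    exact h2
  filter_upwards [h1, ae_restrict_of_ae h3] with u hu hu'
  exact ⟨fun a => hu a (Set.mem_univ a), fun a b h => by_contra fun hab => hu' a b hab h⟩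

theorem unifIco_floor {N : ℕ} [NeZero N] (x : ZMod N) :
    unifIco {t | ((⌊N * t⌋₊ : ℕ) : ZMod N) = x} = ENNReal.ofReal (1 / N) := by
  have hN : (0 : ℝ) < N := Nat.cast_pos.2 (NeZero.pos N)
  rw [unifIco, Measure.restrict_apply' measurableSet_Ico]
  have : {t : ℝ | ((⌊N * t⌋₊ : ℕ) : ZMod N) = x} ∩ Set.Ico 0 1
      = Set.Ico ((x.val : ℝ) / N) ((x.val + 1) / N) := by
    have hx : ((x.val : ℝ) + 1) / N ≤ 1 := by
      rw [div_le_one hN]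
      exact_mod_cast ZMod.val_lt x
    ext t
    rw [Set.mem_inter_iff, Set.mem_ofPred_eq, Set.mem_Ico, Set.mem_Ico, div_le_iff₀ hN,
      lt_div_iff₀ hN, mul_comm t]
    constructor
    · rintro ⟨h1, h2⟩
      have h3 := val_disc (N := N) (u := fun _ : Unit => t) (a := ()) h2
      simp only [disc, h1] at h3
      rw [eq_comm, Nat.floor_eq_iff (mul_nonneg hN.le h2.1)] at h3
      exact h3
    · rintro ⟨h1, h2⟩
      have h0 : 0 ≤ N * t := (Nat.cast_nonneg _).trans h1
      have h3 := (Nat.floor_eq_iff h0).2 ⟨h1, h2⟩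
      refine ⟨by rw [h3, ZMod.natCast_zmod_val], nonneg_of_mul_nonneg_right h0 hN, ?_⟩
      rw [div_le_one hN] at hx
      nlinarith
  rw [this, Real.volume_Ico]
  congr 1
  ring

/-- The roundings of independent uniform points are independent and uniform on the ring. -/
theorem integral_disc [DecidableEq ι] {N : ℕ} [NeZero N] (F : (ι → ZMod N) → ℝ) :
    ∫ u, F (disc N u) ∂cube ι = (∑ x, F x) / (N : ℝ) ^ Fintype.card ι := by
  have hP : IsProbabilityMeasure ((cube ι).map (disc N)) :=
    Measure.isProbabilityMeasure_map (measurable_disc N).aemeasurable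
  rw [← integral_map (measurable_disc N).aemeasurable
    (measurable_of_finite F).aestronglyMeasurable, integral_fintype (.of_finite), Finset.sum_div]
  refine Finset.sum_congr rfl fun x _ => ?_
  have h1 : disc N ⁻¹' {x}
      = Set.univ.pi fun a => {t : ℝ | ((⌊N * t⌋₊ : ℕ) : ZMod N) = x a} := by
    ext u
    simp [disc, funext_iff]
  rw [map_measureReal_apply (measurable_disc N) (measurableSet_singleton x), h1, Measure.real, cube,
    Measure.pi_pi]
  simp only [unifIco_floor, Finset.prod_const, ENNReal.toReal_pow, Finset.card_univ]
  rw [ENNReal.toReal_ofReal (by positivity), smul_eq_mul, one_div, inv_pow]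
  ring

theorem eventually_sameOrder_disc {u : ι → ℝ} (hu : Generic u) :
    ∀ᶠ N in atTop, N ≠ 0 → SameOrder u fun a => (disc N u a).val := by
  have h : ∀ a b, ∀ᶠ N : ℕ in atTop, N ≠ 0 → (u a < u b ↔ (disc N u a).val < (disc N u b).val) := by
    intro a b
    by_cases hab : u a < u b
    · have h1 := tendsto_natCast_atTop_atTop (R := ℝ).eventually_ge_atTop (1 / (u b - u a))
      filter_upwards [h1] with N hN hN0
      have : NeZero N := ⟨hN0⟩
      rw [val_disc (hu.1 a), val_disc (hu.1 b)]
      refine iff_of_true hab ?_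
      rw [div_le_iff₀ (sub_pos.2 hab)] at hN
      have h0 : 0 ≤ N * u a := mul_nonneg (Nat.cast_nonneg _) (hu.1 a).1
      rw [← Nat.add_one_le_iff, ← Nat.floor_add_one h0]
      exact Nat.floor_le_floor (by linarith)
    · refine Filter.Eventually.of_forall fun N hN0 => ?_
      have : NeZero N := ⟨hN0⟩
      rw [val_disc (hu.1 a), val_disc (hu.1 b)]
      refine iff_of_false hab (not_lt.2 (Nat.floor_le_floor ?_))
      exact mul_le_mul_of_nonneg_left (not_lt.1 hab) (Nat.cast_nonneg _)
  have h' := fun a => Filter.eventually_all.2 (h a)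
  filter_upwards [Filter.eventually_all.2 h'] with N hN hN0 a b
  exact hN a b hN0

theorem eventually_multiline_disc {s : List ℕ} {u : Idx s → ℝ} (hu : Generic u) :
    ∀ᶠ N in atTop, N ≠ 0 → (SameOrder u fun a => (disc N u a).val) ∧
      Function.Injective (disc N u) ∧
      multiline ZMod.val ((idxRows s).map (Finset.image (disc N u)))
        = (multiline u (idxRows s)).map (Finset.image (disc N u)) := by
  filter_upwards [eventually_sameOrder_disc hu] with N h hN
  have h := h hN
  have hinj : Function.Injective (disc N u) := by
    intro a b hab
    apply hu.2
    have h1 := h.le_iff a b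
    have h2 := h.le_iff b a
    rw [hab] at h1 h2
    exact le_antisymm (h1.2 le_rfl) (h2.2 le_rfl)
  refine ⟨h, hinj, ?_⟩
  rw [multiline_image _ hinj]
  exact congrArg _ (h.multiline_eq _).symm

open Classical in
/-- Means over discrete uniform rows converge to means over independent uniform points of
`[0, 1)`: rounding the latter down yields the former, up to coincidences whose probability tends
to `0`, and preserves the order of the points eventually. -/
theorem tendsto_multilineMean {ν : ℕ → ℕ} (hν : Tendsto ν atTop atTop) [∀ k, NeZero (ν k)]
    (s : List ℕ) {G : ∀ k, List (Finset (ZMod (ν k))) → ℝ} {C : ℝ} (hC : ∀ k L, |G k L| ≤ C)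
    {H : (Idx s → ℝ) → ℝ}
    (hH : ∀ u, Generic u → Tendsto (fun k =>
      G k ((multiline u (idxRows s)).map (Finset.image (disc (ν k) u)))) atTop (𝓝 (H u))) :
    Tendsto (fun k => multilineMean (ν k) s (G k)) atTop (𝓝 (∫ u, H u ∂cube (Idx s))) := by
  -- applied to `G` and to the constant `1`, since `multilineMean_eq_div` is a quotient of such sums
  have main : ∀ (G : ∀ k, List (Finset (ZMod (ν k))) → ℝ) (C : ℝ), (∀ k L, |G k L| ≤ C) →
      ∀ H : (Idx s → ℝ) → ℝ, (∀ u, Generic u → Tendsto (fun k =>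
        G k ((multiline u (idxRows s)).map (Finset.image (disc (ν k) u)))) atTop (𝓝 (H u))) →
      Tendsto (fun k => ∫ u, (if (idxRows s).map (Finset.image (disc (ν k) u)) ∈ rowLists (ν k) s
        then G k (multiline ZMod.val ((idxRows s).map (Finset.image (disc (ν k) u)))) else 0)
        ∂cube (Idx s)) atTop (𝓝 (∫ u, H u ∂cube (Idx s))) := by
    intro G C hC H hH
    refine tendsto_integral_of_dominated_convergence (fun _ => C) ?_ (integrable_const C) ?_ ?_
    · intro k
      exact ((measurable_of_finite fun x : Idx s → ZMod (ν k) =>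
        if (idxRows s).map (Finset.image x) ∈ rowLists (ν k) s
        then G k (multiline ZMod.val ((idxRows s).map (Finset.image x))) else 0).comp
        (measurable_disc (ν k))).aestronglyMeasurable
    · intro k
      refine Filter.Eventually.of_forall fun u => ?_
      rw [Real.norm_eq_abs]
      split_ifs
      · exact hC k _
      · rw [abs_zero]
        exact (abs_nonneg _).trans (hC k [])
    · filter_upwards [ae_generic] with u hu
      refine (hH u hu).congr' ?_
      filter_upwards [hν.eventually (eventually_multiline_disc hu)] with k hk
      obtain ⟨-, hinj, hk⟩ := hk (NeZero.ne _)
      rw [if_pos (map_image_idxRows_mem hinj), hk]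
  have h1 := main G C hC H hH
  have h2 := main (fun _ _ => 1) 1 (by simp) (fun _ => 1) (by simp)
  rw [integral_const, probReal_univ, one_smul] at h2
  have h3 := h1.div h2 one_ne_zero
  rw [div_one] at h3
  refine h3.congr fun k => ?_
  rw [multilineMean_eq_div]
  have e := fun F => integral_disc (ι := Idx s) (N := ν k) F
  rw [Pi.div_apply, e (fun x => if (idxRows s).map (Finset.image x) ∈ rowLists (ν k) s
        then G k (multiline ZMod.val ((idxRows s).map (Finset.image x))) else 0),
    e (fun x => if (idxRows s).map (Finset.image x) ∈ rowLists (ν k) s then 1 else 0),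
    div_div_div_cancel_right₀]
  exact pow_ne_zero _ (Nat.cast_ne_zero.2 (NeZero.ne (ν k)))

end Cube

/-! ### Layers of a nested list of sets -/

section Layer

variable {ι κ α β : Type*} [LinearOrder α] [LinearOrder β]

/-- The difference of two consecutive sets of a list; the set after the last one is empty. -/
def layer [DecidableEq ι] (L : List (Finset ι)) (a : ℕ) : Finset ι := L.getD a ∅ \ L.getD (a + 1) ∅

theorem getD_map_image [DecidableEq κ] (x : ι → κ) (L : List (Finset ι)) (a : ℕ) :
    (L.map (Finset.image x)).getD a ∅ = (L.getD a ∅).image x := by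
  rw [← Finset.image_empty x, List.getD_map]

theorem layer_map_image [DecidableEq ι] [DecidableEq κ] {x : ι → κ}
    (hx : Function.Injective x) (L : List (Finset ι)) (a : ℕ) :
    layer (L.map (Finset.image x)) a = (layer L a).image x := by
  rw [layer, layer, getD_map_image, getD_map_image, Finset.image_sdiff _ _ hx]

/-- Moving to the right from a point of the layer `a`, the first other point of the largest set is
the one of the layer `b`. -/
def Follows [DecidableEq ι] (v : ι → α) (L : List (Finset ι)) (a b : ℕ) : Prop :=
  ∀ p ∈ layer L a, ∀ q ∈ layer L b, ∀ c ∈ L.getD 0 ∅, c ≠ p → c ≠ q → ¬ CycBtw (v p) (v c) (v q)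

theorem SameOrder.cycBtw_iff {v : ι → α} {w : ι → β} (h : SameOrder v w) (a b c : ι) :
    CycBtw (v a) (v b) (v c) ↔ CycBtw (w a) (w b) (w c) := by
  simp only [CycBtw, h.le_iff]

theorem SameOrder.follows_iff [DecidableEq ι] {v : ι → α} {w : ι → β} (h : SameOrder v w)
    (L : List (Finset ι)) (a b : ℕ) : Follows v L a b ↔ Follows w L a b := by
  simp only [Follows, h.cycBtw_iff]

theorem follows_map_image [DecidableEq ι] [DecidableEq κ] (v : κ → α) {x : ι → κ}
    (hx : Function.Injective x) (L : List (Finset ι)) (a b : ℕ) :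
    Follows v (L.map (Finset.image x)) a b ↔ Follows (v ∘ x) L a b := by
  simp only [Follows, layer_map_image hx, getD_map_image, Finset.forall_mem_image, hx.ne_iff,
    Function.comp_apply]

/-- The member of a one-point set. -/
noncomputable def point [Nonempty ι] (A : Finset ι) : ι := Classical.epsilon fun a => a ∈ A

theorem point_singleton [Nonempty ι] (a : ι) : point {a} = a := by
  simp only [point, Finset.mem_singleton, Classical.epsilon_singleton]

end Layer

/-! ### Scaled positions -/

section Scaled

variable {n N : ℕ}

theorem rightDist_coe {s t : ℝ} (hs : s ∈ Set.Ico (0 : ℝ) 1) (ht : t ∈ Set.Ico (0 : ℝ) 1) :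
    rightDist (s : UnitAddCircle) (t : UnitAddCircle) = if s ≤ t then t - s else t - s + 1 := by
  have key : ∀ r : ℝ, r ∈ Set.Ico (0 : ℝ) (0 + 1) →
      (AddCircle.equivIco (1 : ℝ) 0 (r : UnitAddCircle) : ℝ) = r := fun r hr => by
    rw [AddCircle.equivIco_coe_eq hr]
  rw [rightDist, ← AddCircle.coe_sub]
  split_ifs with h
  · exact key _ ⟨by linarith, by linarith [hs.1, ht.2]⟩
  · rw [← key (t - s + 1) ⟨by linarith [hs.2, ht.1], by linarith⟩, AddCircle.coe_add,
      AddCircle.coe_period, add_zero]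

theorem rightDist_lt_iff {s t r : ℝ} (hs : s ∈ Set.Ico (0 : ℝ) 1) (ht : t ∈ Set.Ico (0 : ℝ) 1)
    (hr : r ∈ Set.Ico (0 : ℝ) 1) :
    rightDist (s : UnitAddCircle) (t : UnitAddCircle) < rightDist (s : UnitAddCircle) r
      ↔ ¬ CycBtw s r t := by
  obtain ⟨hs0, hs1⟩ := hs
  obtain ⟨ht0, ht1⟩ := ht
  obtain ⟨hr0, hr1⟩ := hr
  rw [rightDist_coe ⟨hs0, hs1⟩ ⟨ht0, ht1⟩, rightDist_coe ⟨hs0, hs1⟩ ⟨hr0, hr1⟩, CycBtw]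
  split_ifs with h1 h2 h2
  · rw [not_and, not_le]
    exact ⟨fun h _ => by linarith, fun h => by linarith [h h2]⟩
  · rw [not_and]
    exact ⟨fun _ h => absurd h h2, fun _ => by linarith⟩
  · rw [not_or]
    exact ⟨fun h => by linarith, fun h => absurd h2 h.1⟩
  · rw [not_or, not_le, not_le]
    exact ⟨fun h => ⟨not_le.1 h2, by linarith⟩, fun h => by linarith [h.2]⟩

theorem directlyRight_coe_iff {y : Fin n → ℝ} (hy : ∀ i, y i ∈ Set.Ico (0 : ℝ) 1) {i j : Fin n} :
    DirectlyRight i j (fun k => (y k : UnitAddCircle))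
      ↔ i ≠ j ∧ ∀ k, k ≠ i → k ≠ j → ¬ CycBtw (y i) (y k) (y j) := by
  simp only [DirectlyRight, rightDist_lt_iff (hy _) (hy _) (hy _)]

/-- The point `x / N` of the circle. -/
noncomputable def scaleSite (x : ZMod N) : UnitAddCircle := ((x.val / N : ℝ) : UnitAddCircle)

theorem val_div_mem_Ico [NeZero N] (x : ZMod N) : (x.val / N : ℝ) ∈ Set.Ico (0 : ℝ) 1 := by
  have hN : (0 : ℝ) < N := Nat.cast_pos.2 (NeZero.pos N)
  refine ⟨by positivity, ?_⟩
  rw [div_lt_one hN]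
  exact_mod_cast ZMod.val_lt x

theorem directlyRight_scaleSite_iff [NeZero N] {y : Fin n → ZMod N} {i j : Fin n} :
    DirectlyRight i j (fun k => scaleSite (y k))
      ↔ i ≠ j ∧ ∀ k, k ≠ i → k ≠ j → ¬ CycBtw (y i).val (y k).val (y j).val := by
  have hN : (0 : ℝ) < N := Nat.cast_pos.2 (NeZero.pos N)
  have h := directlyRight_coe_iff (y := fun k => ((y k).val / N : ℝ))
    (fun k => val_div_mem_Ico (y k)) (i := i) (j := j)
  have ho : SameOrder (fun k => ((y k).val / N : ℝ)) fun k => (y k).val := fun a b => by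
    rw [div_lt_div_iff_of_pos_right hN, Nat.cast_lt]
  simp only [ho.cycBtw_iff] at h
  exact h

theorem follows_labelSets_iff [NeZero N] {s : List ℕ} (σ : Config n N) {i j : Fin n} (hij : i ≠ j)
    {a b : ℕ} (ha : layer (labelSets (n :: s) σ) a = {σ i})
    (hb : layer (labelSets (n :: s) σ) b = {σ j}) :
    Follows ZMod.val (labelSets (n :: s) σ) a b ↔ DirectlyRight i j (scaledPositions σ) := by
  have h := directlyRight_scaleSite_iff (y := σ) (i := i) (j := j)
  refine Iff.trans ?_ h.symm
  have h0 : (labelSets (n :: s) σ).getD 0 ∅ = labelSet σ n := rfl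
  simp only [Follows, ha, hb, h0, Finset.mem_singleton, forall_eq, mem_labelSet, Fin.is_lt,
    true_and, forall_exists_index, forall_apply_eq_imp_iff, σ.injective.ne_iff, hij, ne_eq,
    not_false_eq_true]

theorem tendsto_scaleSite_disc {ι : Type*} {u : ι → ℝ} (hu : Generic u) {ν : ℕ → ℕ}
    (hν : Tendsto ν atTop atTop) [∀ k, NeZero (ν k)] (a : ι) :
    Tendsto (fun k => scaleSite (disc (ν k) u a)) atTop (𝓝 (u a : UnitAddCircle)) := by
  have h1 := (tendsto_nat_floor_mul_div_atTop (R := ℝ) (hu.1 a).1).comp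
    (tendsto_natCast_atTop_atTop.comp hν)
  have h2 := ((AddCircle.continuous_mk' (1 : ℝ)).tendsto (u a)).comp h1
  refine h2.congr fun k => ?_
  simp only [Function.comp_apply, scaleSite, val_disc (hu.1 a), mul_comm (u a)]
  rfl

end Scaled

/-! ### The limit law -/

section Limit

variable {n : ℕ}

/-- The list `n, n - 1, …, 1, 0`. -/
def downFrom : ℕ → List ℕ
  | 0 => [0]
  | n + 1 => (n + 1) :: downFrom n

theorem downFrom_eq_cons (n : ℕ) : downFrom n = n :: (downFrom n).tail := by
  cases n <;> rfl

theorem le_of_mem_downFrom {k : ℕ} (h : k ∈ downFrom n) : k ≤ n := by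
  induction n with
  | zero => simpa [downFrom] using h
  | succ n ih =>
    rcases List.mem_cons.1 h with rfl | h
    · exact le_rfl
    · exact (ih h).trans (Nat.le_succ n)

theorem pairwise_downFrom (n : ℕ) : (downFrom n).Pairwise (· > ·) := by
  induction n with
  | zero => simp [downFrom]
  | succ n ih =>
    exact List.pairwise_cons.2 ⟨fun k hk => Nat.lt_succ_of_le (le_of_mem_downFrom hk), ih⟩

theorem getD_map_downFrom {β : Type*} (f : ℕ → β) (d : β) {k : ℕ} (hk : k ≤ n) :
    ((downFrom n).map f).getD (n - k) d = f k := by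
  induction n with
  | zero =>
    obtain rfl : k = 0 := Nat.le_zero.1 hk
    rfl
  | succ n ih =>
    rcases hk.eq_or_lt with rfl | hk
    · simp [downFrom]
    · rw [Nat.succ_sub (Nat.lt_succ_iff.1 hk)]
      exact ih (Nat.lt_succ_iff.1 hk)

theorem labelSet_succ_sdiff {N : ℕ} (σ : Config n N) (i : Fin n) :
    labelSet σ (i + 1) \ labelSet σ i = {σ i} := by
  ext x
  rw [Finset.mem_sdiff, mem_labelSet, Finset.mem_singleton]
  constructor
  · rintro ⟨⟨j, hj, rfl⟩, h⟩
    rw [apply_mem_labelSet] at h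
    rw [Fin.ext (show (j : ℕ) = i by omega)]
  · rintro rfl
    exact ⟨⟨i, Nat.lt_succ_self _, rfl⟩, by rw [apply_mem_labelSet]; exact lt_irrefl _⟩

theorem layer_labelSets_downFrom {N : ℕ} (σ : Config n N) (i : Fin n) :
    layer (labelSets (downFrom n) σ) (n - (i + 1)) = {σ i} := by
  have h : n - ((i : ℕ) + 1) + 1 = n - i := by omega
  rw [layer, labelSets, getD_map_downFrom _ _ i.2, h, getD_map_downFrom _ _ i.2.le,
    labelSet_succ_sdiff]

/-- The point taken by the particle `i` in the limit. With all rows `n, n - 1, …, 0` present, the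
layer `n - (i + 1)` is the difference of the sets of the `i + 1` and of the `i` smallest labels. -/
noncomputable def limitIdx (u : Idx (downFrom n) → ℝ) [Nonempty (Idx (downFrom n))] (i : Fin n) :
    Idx (downFrom n) :=
  point (layer (multiline u (idxRows (downFrom n))) (n - (i + 1)))

instance [NeZero n] : Nonempty (Idx (downFrom n)) := by
  rw [downFrom_eq_cons]
  exact ⟨⟨⟨0, by simp⟩, ⟨0, NeZero.pos n⟩⟩⟩

/-- The positions of the particles in the limit, as a function of the points in the rows. -/
noncomputable def limitPositions [NeZero n] (u : Idx (downFrom n) → ℝ) : Fin n → UnitAddCircle :=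
  fun i => (u (limitIdx u i) : UnitAddCircle)

/-- In the limit too, every layer has one point: for fine roundings, the order of the points is that
of an output of the multiline queue on a ring. -/
theorem layer_multiline_downFrom [NeZero n] {u : Idx (downFrom n) → ℝ} (hu : Generic u)
    (i : Fin n) :
    layer (multiline u (idxRows (downFrom n))) (n - (i + 1)) = {limitIdx u i} := by
  obtain ⟨N, hN, hNn⟩ := ((eventually_multiline_disc hu).and (eventually_ge_atTop (n + 1))).exists
  have : NeZero N := ⟨by omega⟩
  obtain ⟨-, hinj, h⟩ := hN (NeZero.ne N)
  have hmem := map_image_idxRows_mem hinj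
  have hpw := pairwise_downFrom n
  obtain ⟨σ, hσ⟩ : ∃ σ : Config n N, labelSets (downFrom n) σ = multiline ZMod.val
      ((idxRows (downFrom n)).map (Finset.image (disc N u))) := by
    generalize (idxRows (downFrom n)).map (Finset.image (disc N u)) = L at hmem
    rw [downFrom_eq_cons] at hmem hpw ⊢
    exact exists_labelSets_eq_multiline hpw hmem
  have h1 := layer_labelSets_downFrom σ i
  rw [hσ, h, layer_map_image hinj] at h1
  have h2 := congrArg Finset.card h1
  rw [Finset.card_image_of_injective _ hinj, Finset.card_singleton, Finset.card_eq_one] at h2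
  obtain ⟨a, ha⟩ := h2
  rw [limitIdx, ha, point_singleton]

theorem layer_map_multiline_downFrom [NeZero n] {N : ℕ} {u : Idx (downFrom n) → ℝ} (hu : Generic u)
    (hinj : Function.Injective (disc N u)) (i : Fin n) :
    point (layer ((multiline u (idxRows (downFrom n))).map (Finset.image (disc N u)))
      (n - (i + 1))) = disc N u (limitIdx u i) := by
  rw [layer_map_image hinj, layer_multiline_downFrom hu, Finset.image_singleton, point_singleton]

theorem sum_eq_multilineMean_downFrom [NeZero n] {N : ℕ} [NeZero N] (hN : 1 < N) (hnN : n ≤ N)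
    {p : PMF (Config n N)} (hp : IsStationaryDist p) (f : (Fin n → ZMod N) → ℝ) :
    ∑ σ, (p σ).toReal * f σ
      = multilineMean N (downFrom n) fun L => f fun i => point (layer L (n - (i + 1))) := by
  have hpw := pairwise_downFrom n
  have h := downFrom_eq_cons n
  have : ∀ s, s.Pairwise (· > ·) → s = n :: s.tail → ∀ g,
      ∑ σ, (p σ).toReal * g (labelSets s σ) = multilineMean N s g := by
    intro s hs hs' g
    rw [hs'] at hs ⊢
    exact sum_labelSets_eq_multilineMean hN hnN hp hs g
  rw [← this _ hpw h]
  simp only [layer_labelSets_downFrom, point_singleton]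

/-- The limit positions are an almost everywhere limit of functions of the roundings of the points,
which take finitely many values. -/
theorem aemeasurable_limitPositions [NeZero n] :
    AEMeasurable (limitPositions (n := n)) (cube (Idx (downFrom n))) := by
  refine aemeasurable_of_tendsto_metrizable_ae (μ := cube (Idx (downFrom n)))
    (g := limitPositions) (ι := ℕ) atTop (f := fun k u (i : Fin n) => scaleSite (point (layer
    (multiline ZMod.val ((idxRows (downFrom n)).map (Finset.image (disc (k + 1) u))))
      (n - (i + 1))))) (fun k => ?_) ?_
  · exact ((measurable_of_finite fun (x : Idx (downFrom n) → ZMod (k + 1)) (i : Fin n) =>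
      scaleSite (point (layer (multiline ZMod.val ((idxRows (downFrom n)).map (Finset.image x)))
        (n - (i + 1))))).comp (measurable_disc (k + 1))).aemeasurable
  · filter_upwards [ae_generic] with u hu
    refine tendsto_pi_nhds.2 fun i => ?_
    refine (tendsto_scaleSite_disc hu (tendsto_add_atTop_nat 1) (limitIdx u i)).congr' ?_
    filter_upwards [(tendsto_add_atTop_nat 1).eventually (eventually_multiline_disc hu)] with k hk
    obtain ⟨-, hinj, hk⟩ := hk (NeZero.ne _)
    rw [hk, layer_map_multiline_downFrom hu hinj]

/-- The law of the positions of the particles when the multiline queue is fed with independent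
uniform points. It is the continuous TASEP, by `isContinuousTASEP_iff`. -/
noncomputable def limitLaw (n : ℕ) [NeZero n] : ProbabilityMeasure (Fin n → UnitAddCircle) :=
  ⟨(cube (Idx (downFrom n))).map limitPositions,
    Measure.isProbabilityMeasure_map aemeasurable_limitPositions⟩

theorem integral_scaledLaw {N : ℕ} [NeZero N] (p : PMF (Config n N))
    (f : BoundedContinuousFunction (Fin n → UnitAddCircle) ℝ) :
    ∫ x, f x ∂(scaledLaw p : Measure (Fin n → UnitAddCircle))
      = ∑ σ, (p σ).toReal * f (scaledPositions σ) := by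
  classical
  let _ : MeasurableSpace (Config n N) := ⊤
  have hm : Measurable (scaledPositions : Config n N → Fin n → UnitAddCircle) := measurable_from_top
  change ∫ x, f x ∂(p.map scaledPositions).toMeasure = _
  rw [← PMF.toMeasure_map _ p hm, integral_map hm.aemeasurable
    f.continuous.measurable.aestronglyMeasurable, PMF.integral_eq_sum]
  rfl

theorem tendsto_scaledLaw (hn : 1 < n) [NeZero n] {p : (k : ℕ) → PMF (Config n (n + k))}
    (hp : ∀ k, IsStationaryDist (p k)) :
    Tendsto (fun k => scaledLaw (p k)) atTop (𝓝 (limitLaw n)) := by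
  have : ∀ k, NeZero (n + k) := fun k => ⟨by omega⟩
  have hν : Tendsto (fun k => n + k) atTop atTop :=
    tendsto_atTop_mono (fun k => Nat.le_add_left k n) tendsto_id
  rw [ProbabilityMeasure.tendsto_iff_forall_integral_tendsto]
  intro f
  have h1 : ∫ x, f x ∂(limitLaw n : Measure (Fin n → UnitAddCircle))
      = ∫ u, f (limitPositions u) ∂cube (Idx (downFrom n)) :=
    integral_map aemeasurable_limitPositions f.continuous.measurable.aestronglyMeasurable
  rw [h1]
  refine (tendsto_multilineMean hν (downFrom n) (G := fun k L => f fun i =>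
    scaleSite (point (layer L (n - (i + 1))))) (C := ‖f‖) (fun k L => f.norm_coe_le_norm _)
    fun u hu => ?_).congr fun k => ?_
  · have h2 : Tendsto (fun k i => scaleSite (disc (n + k) u (limitIdx u i))) atTop
        (𝓝 (limitPositions u)) := tendsto_pi_nhds.2 fun i => tendsto_scaleSite_disc hu hν _
    refine ((f.continuous.tendsto _).comp h2).congr' ?_
    filter_upwards [hν.eventually (eventually_multiline_disc hu)] with k hk
    obtain ⟨-, hinj, -⟩ := hk (NeZero.ne _)
    simp only [Function.comp_apply, layer_map_multiline_downFrom hu hinj]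
  · rw [integral_scaledLaw, ← sum_eq_multilineMean_downFrom (by omega) (by omega) (hp k)
      fun y => f fun i => scaleSite (y i)]
    rfl

theorem isContinuousTASEP_iff (hn : 1 < n) [NeZero n]
    (μ : ProbabilityMeasure (Fin n → UnitAddCircle)) :
    IsContinuousTASEP n μ ↔ μ = limitLaw n := by
  constructor
  · rintro ⟨p, hp, h⟩
    exact tendsto_nhds_unique h (tendsto_scaledLaw hn hp)
  · rintro rfl
    have h := fun k => (existsUnique_isStationaryDist (n := n) (N := n + k) (by omega) (by omega)
      (by omega)).exists
    choose p hp using h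
    exact ⟨p, hp, tendsto_scaledLaw hn hp⟩

theorem measurable_rightDist {i j : Fin n} :
    Measurable fun x : Fin n → UnitAddCircle => rightDist (x i) (x j) := by
  exact measurable_subtype_coe.comp ((AddCircle.measurableEquivIco (1 : ℝ) 0).measurable.comp
    ((measurable_pi_apply j).sub (measurable_pi_apply i)))

theorem measurableSet_directlyRight (i j : Fin n) :
    MeasurableSet {x : Fin n → UnitAddCircle | DirectlyRight i j x} := by
  by_cases hij : i = j
  · simp [DirectlyRight, hij]
  · simp only [DirectlyRight, ne_eq, hij, not_false_eq_true, true_and]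
    have : {x : Fin n → UnitAddCircle | ∀ k, ¬ k = i → ¬ k = j →
        rightDist (x i) (x j) < rightDist (x i) (x k)}
        = ⋂ k, ⋂ _ : ¬ k = i, ⋂ _ : ¬ k = j,
          {x | rightDist (x i) (x j) < rightDist (x i) (x k)} := by
      ext x
      simp
    rw [this]
    exact .iInter fun k => .iInter fun _ => .iInter fun _ =>
      measurableSet_lt measurable_rightDist measurable_rightDist

open Classical in
/-- **Reduction to few rows.** A two-point correlation in the limit is computed from the multiline
queue with the rows `n :: s` alone, provided that the particles `i` and `j` are layers of it. -/
theorem correlation_limitLaw (hn : 1 < n) [NeZero n] {s : List ℕ} (hs : (n :: s).Pairwise (· > ·))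
    {i j : Fin n} (hij : i ≠ j) {a b : ℕ}
    (ha : ∀ N, ∀ σ : Config n N, layer (labelSets (n :: s) σ) a = {σ i})
    (hb : ∀ N, ∀ σ : Config n N, layer (labelSets (n :: s) σ) b = {σ j}) :
    correlation (limitLaw n) i j
      = ∫ u, (if Follows u (multiline u (idxRows (n :: s))) a b then 1 else 0)
        ∂cube (Idx (n :: s)) := by
  have : ∀ k, NeZero (n + k) := fun k => ⟨by omega⟩
  have hν : Tendsto (fun k => n + k) atTop atTop :=
    tendsto_atTop_mono (fun k => Nat.le_add_left k n) tendsto_id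
  have h1 : correlation (limitLaw n) i j
      = ∫ u, (if DirectlyRight i j (limitPositions u) then 1 else 0) ∂cube (Idx (downFrom n)) := by
    have hm := measurableSet_directlyRight i j
    have e1 := integral_indicator_one (μ := (limitLaw n : Measure (Fin n → UnitAddCircle))) hm
    have e2 := integral_map (μ := cube (Idx (downFrom n))) aemeasurable_limitPositions
      (f := ({x : Fin n → UnitAddCircle | DirectlyRight i j x}).indicator
        (1 : (Fin n → UnitAddCircle) → ℝ))
      (measurable_one.indicator hm).aestronglyMeasurable
    rw [correlation, ← e1]
    refine e2.trans (integral_congr_ae (.of_forall fun u => ?_))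
    simp [Set.indicator_apply]
  choose p hp using fun k => (existsUnique_isStationaryDist (n := n) (N := n + k) (by omega)
    (by omega) (by omega)).exists
  have h2 := tendsto_multilineMean hν (downFrom n) (G := fun k L =>
    if DirectlyRight i j fun i => scaleSite (point (layer L (n - (i + 1)))) then 1 else 0) (C := 1)
    (fun k L => by split_ifs <;> simp)
    (H := fun u => if DirectlyRight i j (limitPositions u) then 1 else 0) fun u hu => by
      refine tendsto_const_nhds.congr' ?_
      filter_upwards [hν.eventually (eventually_multiline_disc hu)] with k hk
      obtain ⟨ho, hinj, -⟩ := hk (NeZero.ne _)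
      simp only [layer_map_multiline_downFrom hu hinj]
      refine if_congr ?_ rfl rfl
      change DirectlyRight i j (fun i => (u (limitIdx u i) : UnitAddCircle)) ↔ _
      rw [directlyRight_scaleSite_iff,
        directlyRight_coe_iff (y := fun i => u (limitIdx u i)) fun i => hu.1 _]
      simp only [ho.cycBtw_iff]
  have h3 := tendsto_multilineMean hν (n :: s) (G := fun k L =>
    if Follows ZMod.val L a b then 1 else 0) (C := 1)
    (fun k L => by split_ifs <;> simp)
    (H := fun u => if Follows u (multiline u (idxRows (n :: s))) a b then 1 else 0) fun u hu => by
      refine tendsto_const_nhds.congr' ?_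
      filter_upwards [hν.eventually (eventually_multiline_disc hu)] with k hk
      obtain ⟨ho, hinj, -⟩ := hk (NeZero.ne _)
      rw [follows_map_image _ hinj]
      exact if_congr (ho.follows_iff _ a b) rfl rfl
  -- both sides are the limit of the probability that `j` is directly right of `i` on `n + k` sites
  rw [h1]
  refine tendsto_nhds_unique h2 (h3.congr fun k => ?_)
  rw [← sum_labelSets_eq_multilineMean (by omega) (by omega) (hp k) hs,
    ← sum_eq_multilineMean_downFrom (by omega) (by omega) (hp k)
      fun y => if DirectlyRight i j fun i => scaleSite (y i) then 1 else 0]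
  refine Finset.sum_congr rfl fun σ _ => ?_
  congr 1
  exact if_congr (follows_labelSets_iff σ hij (ha _ σ) (hb _ σ)) rfl rfl

end Limit

/-! ### All orders of independent uniform points are equally likely -/

section Exchange

variable {ι : Type*} [Fintype ι]

open Classical in
/-- The number of positions below that of `a`. -/
noncomputable def rank (u : ι → ℝ) (a : ι) : ℕ := (Finset.univ.filter fun b => u b < u a).card

theorem rank_lt_rank {u : ι → ℝ} {a b : ι} (h : u a < u b) : rank u a < rank u b := by
  classical
  refine Finset.card_lt_card (Finset.ssubset_iff_of_subset ?_ |>.2 ⟨a, ?_, ?_⟩)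
  · intro c hc
    rw [Finset.mem_filter] at hc ⊢
    exact ⟨hc.1, hc.2.trans h⟩
  · simpa using h
  · simp

theorem rank_lt_card (u : ι → ℝ) (a : ι) : rank u a < Fintype.card ι := by
  classical
  rw [← Finset.card_univ]
  refine Finset.card_lt_card (Finset.ssubset_univ_iff.2 fun h => ?_)
  have : a ∈ Finset.univ.filter fun b => u b < u a := by
    rw [h]
    exact Finset.mem_univ a
  simp at this

theorem val_eq_rank {M : ℕ} [NeZero M] (x : ι ≃ ZMod M) {u : ι → ℝ}
    (h : SameOrder u fun a => (x a).val) (a : ι) : (x a).val = rank u a := by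
  classical
  have h1 : rank u a = (Finset.univ.filter fun z : ZMod M => z.val < (x a).val).card := by
    rw [rank, ← Finset.card_map x.toEmbedding]
    congr 1
    ext z
    simp only [Finset.mem_map, Finset.mem_filter, Finset.mem_univ, true_and, h _ a,
      Equiv.coe_toEmbedding]
    constructor
    · rintro ⟨b, hb, rfl⟩
      exact hb
    · intro hz
      exact ⟨x.symm z, by simpa using hz, by simp⟩
  rw [h1]
  have hlt := ZMod.val_lt (x a)
  generalize (x a).val = k at hlt
  obtain ⟨m, rfl⟩ : ∃ m, M = m + 1 := ⟨M - 1, by have := NeZero.ne M; omega⟩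
  have := Fin.card_filter_val_lt (n := m + 1) (m := k)
  rw [min_eq_right hlt.le] at this
  exact this.symm

theorem existsUnique_sameOrder {M : ℕ} [NeZero M] (hM : Fintype.card ι = M) {u : ι → ℝ}
    (hu : Function.Injective u) : ∃! x : ι ≃ ZMod M, SameOrder u fun a => (x a).val := by
  have hval : ∀ a, ((rank u a : ℕ) : ZMod M).val = rank u a := fun a =>
    ZMod.val_natCast_of_lt (hM ▸ rank_lt_card u a)
  have hinj : Function.Injective fun a => ((rank u a : ℕ) : ZMod M) := by
    intro a b h
    have h' : rank u a = rank u b := by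
      rw [← hval a, ← hval b]
      exact congrArg ZMod.val h
    rcases lt_trichotomy (u a) (u b) with h1 | h1 | h1
    · exact absurd h' (rank_lt_rank h1).ne
    · exact hu h1
    · exact absurd h' (rank_lt_rank h1).ne'
  have hbij := (Fintype.bijective_iff_injective_and_card _).2 ⟨hinj, by rw [hM, ZMod.card]⟩
  refine ⟨Equiv.ofBijective _ hbij, fun a b => ?_, fun y hy => ?_⟩
  · simp only [Equiv.ofBijective_apply, hval]
    refine ⟨rank_lt_rank, fun h => ?_⟩
    by_contra hle
    rcases (not_lt.1 hle).eq_or_lt with h1 | h1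
    · rw [hu h1] at h
      exact lt_irrefl _ h
    · exact lt_asymm h (rank_lt_rank h1)
  · ext a
    apply ZMod.val_injective M
    rw [val_eq_rank y hy, Equiv.ofBijective_apply, hval]

theorem measurableSet_sameOrder {β : Type*} [LinearOrder β] (w : ι → β) :
    MeasurableSet {u : ι → ℝ | SameOrder u w} := by
  have : {u : ι → ℝ | SameOrder u w} = ⋂ a, ⋂ b, {u | u a < u b ↔ w a < w b} := by
    ext u
    simp [SameOrder]
  rw [this]
  refine .iInter fun a => .iInter fun b => ?_
  by_cases h : w a < w b
  · simp only [h, iff_true]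
    exact measurableSet_lt (measurable_pi_apply a) (measurable_pi_apply b)
  · simp only [h, iff_false, not_lt]
    exact measurableSet_le (measurable_pi_apply b) (measurable_pi_apply a)

/-- Independent uniform points are exchangeable. -/
theorem cube_sameOrder_comp (π : Equiv.Perm ι) {β : Type*} [LinearOrder β] (w : ι → β) :
    cube ι {u | SameOrder u (w ∘ π)} = cube ι {u | SameOrder u w} := by
  have h := measurePreserving_piCongrLeft (fun _ : ι => unifIco) π
  rw [cube, ← h.measure_preimage (measurableSet_sameOrder w).nullMeasurableSet]
  congr 1
  ext u
  have hu : ∀ a, (MeasurableEquiv.piCongrLeft (fun _ : ι => ℝ) π u) (π a) = u a := fun a =>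
    Equiv.piCongrLeft_apply_apply (fun _ => ℝ) π u a
  rw [Set.mem_preimage, Set.mem_ofPred_eq, Set.mem_ofPred_eq]
  constructor
  · intro h' a b
    obtain ⟨a, rfl⟩ := π.surjective a
    obtain ⟨b, rfl⟩ := π.surjective b
    rw [hu, hu]
    exact h' a b
  · intro h' a b
    have := h' (π a) (π b)
    rwa [hu, hu] at this

open Classical in
/-- The probability of an event that depends on the order of independent uniform points only is
the proportion of orders in it. -/
theorem integral_order_event [DecidableEq ι] {M : ℕ} [NeZero M] (hM : Fintype.card ι = M)
    {E : (ι → ℝ) → Prop}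
    {E' : (ι ≃ ZMod M) → Prop}
    (h : ∀ u (x : ι ≃ ZMod M), SameOrder u (fun a => (x a).val) → (E u ↔ E' x)) :
    ∫ u, (if E u then (1 : ℝ) else 0) ∂cube ι
      = ((Finset.univ.filter E').card : ℝ) / M.factorial := by
  have hae : ∀ f : (ι ≃ ZMod M) → ℝ, ∀ F : (ι → ℝ) → ℝ,
      (∀ u x, SameOrder u (fun a => (x a).val) → F u = f x) →
      ∫ u, F u ∂cube ι
        = ∑ x, f x * (cube ι).real {u | SameOrder u fun a => (x a).val} := by
    intro f F hF
    have h1 : ∀ᵐ u ∂cube ι, F u = ∑ x : ι ≃ ZMod M,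
        ({u | SameOrder u fun a => (x a).val}).indicator (fun _ => f x) u := by
      filter_upwards [ae_generic] with u hu
      obtain ⟨x, hx, huniq⟩ := existsUnique_sameOrder hM hu.2
      rw [Finset.sum_eq_single x, Set.indicator_of_mem (by exact hx), hF u x hx]
      · intro y _ hy
        exact Set.indicator_of_notMem (fun hy' => hy (huniq y hy')) _
      · simp
    rw [integral_congr_ae h1, integral_finsetSum]
    · refine Finset.sum_congr rfl fun x _ => ?_
      rw [integral_indicator_const _ (measurableSet_sameOrder _), smul_eq_mul, mul_comm]
    · intro x _
      exact (integrable_const (f x)).indicator (measurableSet_sameOrder _)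
  obtain ⟨e⟩ : Nonempty (ι ≃ ZMod M) := ⟨Fintype.equivOfCardEq (by rw [hM, ZMod.card])⟩
  have hconst : ∀ x : ι ≃ ZMod M, (cube ι).real {u | SameOrder u fun a => (x a).val}
      = (cube ι).real {u | SameOrder u fun a => (e a).val} := by
    intro x
    have := cube_sameOrder_comp (x.trans e.symm) fun a => (e a).val
    rw [Measure.real, Measure.real, ← this]
    congr 3
    ext u
    simp [Function.comp_def]
  have htot := hae (fun _ => 1) (fun _ => 1) fun _ _ _ => rfl
  have hev := hae (fun x => if E' x then 1 else 0) (fun u => if E u then 1 else 0)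
    fun u x hx => if_congr (h u x hx) rfl rfl
  simp only [hconst] at htot hev
  rw [← Finset.sum_mul, Finset.sum_const, Finset.card_univ, Fintype.card_equiv e, hM,
    integral_const, probReal_univ, smul_eq_mul, nsmul_eq_mul, mul_one, mul_one] at htot
  rw [hev, ← Finset.sum_mul, Finset.sum_boole, eq_div_iff (by positivity), mul_assoc,
    mul_comm _ (M.factorial : ℝ), ← htot, mul_one]

end Exchange

/-! ### Reduction to counting partitions of a ring -/

section Partition

/-- The lists of rows with sizes `s` on a ring with `M` sites that cover the ring. -/
def partitions (M : ℕ) [NeZero M] (s : List ℕ) : Finset (List (Finset (ZMod M))) :=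
  (rowLists M s).filter fun L => ∀ z, ∃ S ∈ L, z ∈ S

theorem card_idx (s : List ℕ) : Fintype.card (Idx s) = s.sum := by
  rw [Fintype.card_sigma]
  simp only [Fintype.card_fin]
  rw [← List.sum_ofFn, List.ofFn_get]

open Classical in
/-- Each partition of the ring into rows arises from the same number of placements of the points. -/
theorem card_equiv_filter {M : ℕ} [NeZero M] {s : List ℕ} (hM : s.sum = M)
    (Q : List (Finset (ZMod M)) → Prop) :
    (Finset.univ.filter fun x : Idx s ≃ ZMod M => Q ((idxRows s).map (Finset.image x))).card
      = (∏ k, (s.get k).factorial) * ((partitions M s).filter Q).card := by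
  have h1 : (Finset.univ.filter fun x : Idx s ≃ ZMod M =>
      Q ((idxRows s).map (Finset.image x))).card
      = (Finset.univ.filter fun x : Idx s → ZMod M =>
        (idxRows s).map (Finset.image x) ∈ (partitions M s).filter Q).card := by
    refine Finset.card_bij (fun x _ => x) ?_ ?_ ?_
    · intro x hx
      simp only [Finset.mem_filter, Finset.mem_univ, true_and, partitions] at hx ⊢
      refine ⟨⟨map_image_idxRows_mem x.injective, fun z => ?_⟩, hx⟩
      refine ⟨_, List.mem_map_of_mem (List.mem_ofFn.2 ⟨(x.symm z).1, rfl⟩), ?_⟩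
      exact Finset.mem_image.2 ⟨x.symm z, by simp [idxRow], by simp⟩
    · intro x _ y _ hxy
      exact DFunLike.coe_injective hxy
    · intro x hx
      simp only [Finset.mem_filter, Finset.mem_univ, true_and, partitions] at hx
      have hsurj : Function.Surjective x := by
        intro z
        obtain ⟨S, hS, hz⟩ := hx.1.2 z
        obtain ⟨J, -, rfl⟩ := List.mem_map.1 hS
        obtain ⟨a, -, ha⟩ := Finset.mem_image.1 hz
        exact ⟨a, ha⟩
      have hbij := (Fintype.bijective_iff_surjective_and_card x).2
        ⟨hsurj, by rw [card_idx, hM, ZMod.card]⟩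
      exact ⟨Equiv.ofBijective x hbij, by simpa using hx.2, rfl⟩
  rw [h1, Finset.card_eq_sum_card_fiberwise (t := (partitions M s).filter Q)
    (f := fun x : Idx s → ZMod M => (idxRows s).map (Finset.image x))
    (fun x hx => by simpa using hx),
    Finset.sum_congr rfl (g := fun _ => ∏ k, (s.get k).factorial), Finset.sum_const, smul_eq_mul,
    mul_comm]
  intro L hL
  rw [← card_filter_map_image_eq (Finset.mem_filter.1 (Finset.mem_filter.1 hL).1).1,
    Finset.filter_filter]
  congr 1
  ext x
  simp only [Finset.mem_filter, Finset.mem_univ, true_and]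
  exact ⟨fun h => h.2, fun h => ⟨by rw [h]; simpa using hL, h⟩⟩

open Classical in
/-- When the ring has as many sites as there are points, uniformly random points form a
uniformly random partition of the ring. -/
theorem integral_follows {M : ℕ} [NeZero M] {s : List ℕ} (hM : s.sum = M) (a b : ℕ) :
    ∫ u, (if Follows u (multiline u (idxRows s)) a b then (1 : ℝ) else 0) ∂cube (Idx s)
      = ((∏ k, (s.get k).factorial : ℕ) : ℝ)
        * ((partitions M s).filter fun L => Follows ZMod.val (multiline ZMod.val L) a b).card
        / M.factorial := by
  have e := card_equiv_filter hM fun L => Follows ZMod.val (multiline ZMod.val L) a b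
  rw [integral_order_event (M := M) (by rw [card_idx, hM])
    (E' := fun x => Follows ZMod.val (multiline ZMod.val ((idxRows s).map (Finset.image x))) a b),
    e, Nat.cast_mul]
  intro u x hx
  rw [multiline_image _ x.injective, follows_map_image _ x.injective, hx.multiline_eq,
    hx.follows_iff]
  rfl

variable {M : ℕ} [NeZero M]

theorem cycBtw_val_add (t a b c : ZMod M) :
    CycBtw (a + t).val (b + t).val (c + t).val ↔ CycBtw a.val b.val c.val := by
  simp only [cycBtw_val, add_sub_add_right_eq_sub]

theorem fed_val_add (t : ZMod M) : fed (fun z => (z + t).val) = fed (ZMod.val : ZMod M → ℕ) := by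
  have h : arc (fun z => (z + t).val) = arc (ZMod.val : ZMod M → ℕ) := by
    funext a b S
    ext z
    simp only [mem_arc, cycBtw_val_add]
  funext S B
  ext z
  simp only [mem_fed, h]

theorem multiline_val_add (t : ZMod M) (L : List (Finset (ZMod M))) :
    multiline (fun z => (z + t).val) L = multiline ZMod.val L := by
  induction L with
  | nil => rfl
  | cons S L ih => rw [multiline, multiline, ih, fed_val_add]

theorem fed_translate (t : ZMod M) (S B : Finset (ZMod M)) :
    fed ZMod.val (S.image (· + t)) (B.image (· + t)) = (fed ZMod.val S B).image (· + t) := by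
  rw [fed_image _ (add_left_injective t)]
  exact congrArg (fun f => (f S B).image (· + t)) (fed_val_add t)

theorem follows_translate (t : ZMod M) (L : List (Finset (ZMod M))) (a b : ℕ) :
    Follows ZMod.val (multiline ZMod.val (L.map (Finset.image (· + t)))) a b
      ↔ Follows ZMod.val (multiline ZMod.val L) a b := by
  rw [multiline_image _ (add_left_injective t), follows_map_image _ (add_left_injective t)]
  have h : multiline (ZMod.val ∘ (· + t)) L = multiline ZMod.val L := multiline_val_add t L
  rw [h]
  simp only [Follows, Function.comp_apply, cycBtw_val_add]

theorem translate_mem_partitions {s : List ℕ} (t : ZMod M) {L : List (Finset (ZMod M))}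
    (hL : L ∈ partitions M s) : L.map (Finset.image (· + t)) ∈ partitions M s := by
  rw [partitions, Finset.mem_filter, mem_rowLists] at hL ⊢
  refine ⟨?_, fun z => ?_⟩
  · rw [List.map_map, ← hL.1]
    exact List.map_congr_left fun B _ => Finset.card_image_of_injective B (add_left_injective t)
  · obtain ⟨S, hS, hz⟩ := hL.2 (z - t)
    exact ⟨_, List.mem_map_of_mem hS, Finset.mem_image.2 ⟨_, hz, sub_add_cancel z t⟩⟩

/-- In three rows, the sites of the middle row that the top row leaves unused. -/
noncomputable def unused (L : List (Finset (ZMod M))) : Finset (ZMod M) :=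
  L.getD 1 ∅ \ fed ZMod.val (L.getD 1 ∅) (L.getD 2 ∅)

theorem unused_translate (t : ZMod M) (L : List (Finset (ZMod M))) :
    unused (L.map (Finset.image (· + t))) = (unused L).image (· + t) := by
  rw [unused, unused, getD_map_image, getD_map_image, fed_translate,
    Finset.image_sdiff _ _ (add_left_injective t)]

open Classical in
/-- If the top row leaves one site of the middle row unused, that site may be assumed to be `0`. -/
theorem card_partitions_follows {p q r : ℕ} (hqr : q = r + 1) (a b : ℕ) :
    ((partitions M [p, q, r]).filter fun L => Follows ZMod.val (multiline ZMod.val L) a b).card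
      = M * ((partitions M [p, q, r]).filter fun L =>
        Follows ZMod.val (multiline ZMod.val L) a b ∧ unused L = {0}).card := by
  set A := (partitions M [p, q, r]).filter fun L => Follows ZMod.val (multiline ZMod.val L) a b
    with hA
  have h1 : ∀ L ∈ A, ∃ w, unused L = {w} := by
    intro L hL
    rw [hA, Finset.mem_filter, partitions, Finset.mem_filter, mem_rowLists] at hL
    match L, hL.1.1 with
    | [P, Q, R], h =>
      simp only [List.map_cons, List.map_nil, List.cons.injEq, and_true] at h
      rw [← Finset.card_eq_one]
      change (Q \ fed ZMod.val Q R).card = 1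
      rw [Finset.card_sdiff_of_subset (fed_subset _ _ _), card_fed (by omega)]
      omega
  choose! w hw using h1
  have h2 := Finset.card_eq_sum_card_fiberwise (s := A) (t := Finset.univ) (f := w) (by simp)
  rw [h2, Finset.sum_congr rfl (g := fun _ => ((partitions M [p, q, r]).filter fun L =>
        Follows ZMod.val (multiline ZMod.val L) a b ∧ unused L = {0}).card), Finset.sum_const,
    Finset.card_univ, ZMod.card, smul_eq_mul]
  intro t _
  have hback : ∀ (t : ZMod M) (L : List (Finset (ZMod M))),
      (L.map (Finset.image (· + t))).map (Finset.image (· - t)) = L := by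
    intro t L
    rw [List.map_map]
    refine (List.map_congr_left fun B _ => ?_).trans (List.map_id L)
    rw [Function.comp_apply, Finset.image_image, id]
    simp [Function.comp_def]
  refine Finset.card_nbij' (fun L => L.map (Finset.image (· - t)))
    (fun L => L.map (Finset.image (· + t))) ?_ ?_ ?_ ?_
  · intro L hL
    rw [Finset.mem_coe, Finset.mem_filter] at hL
    have hLA := hL.1
    rw [hA, Finset.mem_filter] at hLA
    simp only [sub_eq_add_neg, Finset.mem_coe, Finset.mem_filter]
    refine ⟨translate_mem_partitions _ hLA.1, (follows_translate _ _ _ _).2 hLA.2, ?_⟩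
    rw [unused_translate, hw L hL.1, hL.2]
    simp
  · intro L hL
    rw [Finset.mem_coe, Finset.mem_filter] at hL
    have hLA : L.map (Finset.image (· + t)) ∈ A := by
      rw [hA, Finset.mem_filter]
      exact ⟨translate_mem_partitions _ hL.1, (follows_translate _ _ _ _).2 hL.2.1⟩
    rw [Finset.mem_coe, Finset.mem_filter]
    refine ⟨hLA, ?_⟩
    have h3 := hw _ hLA
    rw [unused_translate, hL.2.2, Finset.image_singleton, zero_add, Finset.singleton_inj] at h3
    exact h3.symm
  · intro L _
    have := hback (-t) L
    simpa [sub_eq_add_neg] using this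
  · intro L _
    exact hback t L

end Partition

/-! ### The labels `1` and `2` -/

section Arcs

variable {M : ℕ}

theorem arcCount_union {S T : Finset (ZMod M)} (h : Disjoint S T) (a z : ZMod M) :
    arcCount (S ∪ T) a z = arcCount S a z + arcCount T a z := by
  rw [arcCount, Finset.filter_union, Finset.card_union_of_disjoint]
  · rfl
  · exact Finset.disjoint_filter_filter h

theorem arcCount_singleton (p a z : ZMod M) :
    arcCount {p} a z = if (p - a).val ≤ (z - a).val then 1 else 0 := by
  rw [arcCount, Finset.filter_singleton]
  split_ifs <;> simp

theorem arcCount_pair {p q : ZMod M} (h : p ≠ q) (a z : ZMod M) :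
    arcCount {p, q} a z = arcCount {p} a z + arcCount {q} a z := by
  rw [Finset.insert_eq, arcCount_union (Finset.disjoint_singleton.2 h)]

variable [NeZero M]

theorem card_filter_val_lt {k : ℕ} (hk : k ≤ M) :
    (Finset.univ.filter fun z : ZMod M => z.val < k).card = k := by
  obtain ⟨m, rfl⟩ : ∃ m, M = m + 1 := ⟨M - 1, by have := NeZero.ne M; omega⟩
  have := Fin.card_filter_val_lt (n := m + 1) (m := k)
  rwa [min_eq_right hk] at this

theorem arcCount_univ (a z : ZMod M) : arcCount Finset.univ a z = (z - a).val + 1 := by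
  rw [arcCount, ← card_filter_val_lt (M := M) (k := (z - a).val + 1) (ZMod.val_lt _)]
  refine Finset.card_nbij' (fun t => t - a) (fun t => t + a) ?_ ?_ ?_ ?_ <;> intro t <;>
    simp

theorem arcCount_sdiff (S : Finset (ZMod M)) (a z : ZMod M) :
    arcCount (Finset.univ \ S) a z + arcCount S a z = (z - a).val + 1 := by
  rw [← arcCount_union Finset.sdiff_disjoint, Finset.sdiff_union_of_subset (Finset.subset_univ _),
    arcCount_univ]

theorem val_natCast_sub {x y : ℕ} (hx : x < M) (hy : y < M) :
    ((x : ZMod M) - (y : ZMod M)).val = if y ≤ x then x - y else x + M - y := by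
  rw [ZMod.val_sub_eq_ite, ZMod.val_natCast_of_lt hx, ZMod.val_natCast_of_lt hy]

theorem natCast_inj_of_lt {x y : ℕ} (hx : x < M) (hy : y < M) :
    (x : ZMod M) = (y : ZMod M) ↔ x = y := by
  rw [← (ZMod.val_injective M).eq_iff, ZMod.val_natCast_of_lt hx, ZMod.val_natCast_of_lt hy]

theorem mem_fed_val {S B : Finset (ZMod M)} {z : ZMod M} :
    z ∈ fed ZMod.val S B ↔ z ∈ S ∧ ∃ a ∈ B, arcCount S a z ≤ arcCount B a z := by
  rw [mem_fed]
  simp only [card_arc_val]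

end Arcs

section Pairs

variable {n : ℕ}

/-- The partition of the ring into the top row `{u}`, the middle row `{0, v}` and a bottom row. -/
def pairRows (n u v : ℕ) : List (Finset (ZMod (n + 3))) :=
  [Finset.univ \ {((0 : ℕ) : ZMod (n + 3)), (v : ZMod (n + 3)), (u : ZMod (n + 3))},
    {((0 : ℕ) : ZMod (n + 3)), ↑v}, {(u : ZMod (n + 3))}]

theorem natCast_mem_pairRows_bottom {u v c : ℕ} (huv : u < v) (hv : v < n + 3) (hc : c < n + 3) :
    (c : ZMod (n + 3)) ∈ Finset.univ \ {((0 : ℕ) : ZMod (n + 3)), (v : ZMod (n + 3)),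
      (u : ZMod (n + 3))} ↔ c ≠ 0 ∧ c ≠ v ∧ c ≠ u := by
  rw [Finset.mem_sdiff, Finset.mem_insert, Finset.mem_insert, Finset.mem_singleton,
    natCast_inj_of_lt hc (by omega), natCast_inj_of_lt hc hv, natCast_inj_of_lt hc (by omega)]
  simp

theorem arcCount_bottom {u v : ℕ} (hu : 0 < u) (huv : u < v) (hv : v < n + 3)
    (a z : ZMod (n + 3)) :
    arcCount (Finset.univ \ {((0 : ℕ) : ZMod (n + 3)), (v : ZMod (n + 3)), (u : ZMod (n + 3))}) a z
      + arcCount {((0 : ℕ) : ZMod (n + 3)), (v : ZMod (n + 3))} a z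
      + arcCount {(u : ZMod (n + 3))} a z = (z - a).val + 1 := by
  rw [← arcCount_sdiff {((0 : ℕ) : ZMod (n + 3)), (v : ZMod (n + 3)), (u : ZMod (n + 3))} a z,
    add_assoc, ← arcCount_union]
  · congr 2
    ext t
    simp only [Finset.mem_insert, Finset.mem_union, Finset.mem_singleton, or_assoc]
  · rw [Finset.disjoint_singleton_right, Finset.mem_insert, Finset.mem_singleton,
      natCast_inj_of_lt (by omega) (by omega), natCast_inj_of_lt (by omega) (by omega)]
    omega

/-- The customer entering at `u` walks right to `v`, so the site `0` stays unused. -/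
theorem fed_pair {u v : ℕ} (hu : 0 < u) (huv : u < v) (hv : v < n + 3) :
    fed ZMod.val {((0 : ℕ) : ZMod (n + 3)), (v : ZMod (n + 3))} {(u : ZMod (n + 3))}
      = {(v : ZMod (n + 3))} := by
  have h0v : ((0 : ℕ) : ZMod (n + 3)) ≠ (v : ZMod (n + 3)) := by
    rw [Ne, natCast_inj_of_lt (by omega) hv]
    omega
  ext z
  simp only [mem_fed_val, Finset.mem_insert, Finset.mem_singleton, exists_eq_left,
    arcCount_pair h0v, arcCount_singleton]
  constructor
  · rintro ⟨rfl | rfl, h⟩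
    · simp only [val_natCast_sub (show 0 < n + 3 by omega) (huv.trans hv),
        val_natCast_sub hv (huv.trans hv), val_natCast_sub (huv.trans hv) (huv.trans hv)] at h
      split_ifs at h <;> omega
    · rfl
  · rintro rfl
    refine ⟨.inr rfl, ?_⟩
    simp only [val_natCast_sub (show 0 < n + 3 by omega) (huv.trans hv),
        val_natCast_sub hv (huv.trans hv), val_natCast_sub (huv.trans hv) (huv.trans hv)]
    split_ifs <;> omega

/-- For `0 < u < v`, the customer entering at `u` is served at `v` in the middle row and at `s` in
the bottom row, where it becomes the particle `1`. The particle `2` is at the service `t` left to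
the customer entering at `0`. -/
theorem layers_pairRows (hn : 3 ≤ n) {u v s t : ℕ} (hu : 0 < u) (huv : u < v) (hv : v < n + 3)
    (hst : v = 2 ∧ s = 3 ∧ t = 4 ∨
      v = n + 2 ∧ (u = 1 ∧ s = 2 ∧ t = 3 ∨ u = 2 ∧ s = 1 ∧ t = 3 ∨ 3 ≤ u ∧ s = 1 ∧ t = 2) ∨
      3 ≤ v ∧ v ≤ n + 1 ∧ s = v + 1 ∧ (u = 1 ∧ t = 2 ∨ 2 ≤ u ∧ t = 1)) :
    layer (multiline ZMod.val (pairRows n u v)) 1 = {(t : ZMod (n + 3))} ∧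
      layer (multiline ZMod.val (pairRows n u v)) 2 = {(s : ZMod (n + 3))} := by
  have hs3 : s < n + 3 := by omega
  have ht3 : t < n + 3 := by omega
  have h0v : ((0 : ℕ) : ZMod (n + 3)) ≠ (v : ZMod (n + 3)) := by
    rw [Ne, natCast_inj_of_lt (by omega) hv]
    omega
  obtain ⟨P, hP⟩ : ∃ P : Finset (ZMod (n + 3)), P = Finset.univ \ {((0 : ℕ) : ZMod (n + 3)),
    (v : ZMod (n + 3)), (u : ZMod (n + 3))} := ⟨_, rfl⟩
  obtain ⟨Q, hQ⟩ : ∃ Q : Finset (ZMod (n + 3)), Q = {((0 : ℕ) : ZMod (n + 3)),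
    (v : ZMod (n + 3))} := ⟨_, rfl⟩
  have hmP : ∀ c : ℕ, c < n + 3 → c ≠ 0 ∧ c ≠ v ∧ c ≠ u → (c : ZMod (n + 3)) ∈ P := fun c hc h =>
    hP ▸ (natCast_mem_pairRows_bottom huv hv hc).2 h
  have harc : ∀ a z, arcCount P a z + (arcCount {((0 : ℕ) : ZMod (n + 3))} a z +
      arcCount {(v : ZMod (n + 3))} a z) + arcCount {(u : ZMod (n + 3))} a z
        = (z - a).val + 1 := fun a z => by
    rw [hP, ← arcCount_pair h0v]
    exact arcCount_bottom hu huv hv a z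
  have hQcard : Q.card = 2 := hQ ▸ Finset.card_pair h0v
  have hPcard : n ≤ P.card := by
    have h1 := Finset.le_card_sdiff ({((0 : ℕ) : ZMod (n + 3)), (v : ZMod (n + 3)),
      (u : ZMod (n + 3))} : Finset (ZMod (n + 3))) Finset.univ
    have h2 := Finset.card_le_three (a := ((0 : ℕ) : ZMod (n + 3))) (b := (v : ZMod (n + 3)))
      (c := (u : ZMod (n + 3)))
    rw [Finset.card_univ, ZMod.card, ← hP] at h1
    omega
  have hs : fed ZMod.val P {(v : ZMod (n + 3))} = {(s : ZMod (n + 3))} := by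
    have hmem : (s : ZMod (n + 3)) ∈ fed ZMod.val P {(v : ZMod (n + 3))} := by
      rw [mem_fed_val]
      refine ⟨hmP s hs3 (by omega), v, by simp, ?_⟩
      have h1 := harc (v : ZMod (n + 3)) (s : ZMod (n + 3))
      simp only [arcCount_singleton, val_natCast_sub (show 0 < n + 3 by omega) hv,
        val_natCast_sub hv hv,
        val_natCast_sub hs3 hv,
        val_natCast_sub (huv.trans hv) hv] at h1 ⊢
      split_ifs at h1 ⊢ <;> omega
    symm
    refine Finset.eq_of_subset_of_card_le (Finset.singleton_subset_iff.2 hmem) ?_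
    rw [card_fed (by rw [Finset.card_singleton]; omega), Finset.card_singleton,
      Finset.card_singleton]
  have hstne : (t : ZMod (n + 3)) ≠ (s : ZMod (n + 3)) := by
    rw [Ne, natCast_inj_of_lt ht3 hs3]
    omega
  have ht : fed ZMod.val P Q = {(t : ZMod (n + 3)), (s : ZMod (n + 3))} := by
    have hmem : (t : ZMod (n + 3)) ∈ fed ZMod.val P Q := by
      rw [mem_fed_val]
      refine ⟨hmP t ht3 (by omega), ?_⟩
      -- for `v = n + 2` the customers that enter at `v` and at `0` form one busy period
      by_cases hvn : v = n + 2
      · refine ⟨v, by simp [hQ], ?_⟩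
        have h1 := harc (v : ZMod (n + 3)) (t : ZMod (n + 3))
        rw [hQ, arcCount_pair h0v]
        simp only [arcCount_singleton, val_natCast_sub (show 0 < n + 3 by omega) hv,
          val_natCast_sub hv hv, val_natCast_sub ht3 hv, val_natCast_sub (huv.trans hv) hv] at h1 ⊢
        split_ifs at h1 ⊢ <;> omega
      · refine ⟨((0 : ℕ) : ZMod (n + 3)), by simp [hQ], ?_⟩
        have h1 := harc ((0 : ℕ) : ZMod (n + 3)) (t : ZMod (n + 3))
        rw [hQ, arcCount_pair h0v]
        simp only [arcCount_singleton, val_natCast_sub (show 0 < n + 3 by omega)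
          (show 0 < n + 3 by omega), val_natCast_sub hv (show 0 < n + 3 by omega),
          val_natCast_sub ht3 (show 0 < n + 3 by omega),
          val_natCast_sub (huv.trans hv) (show 0 < n + 3 by omega)] at h1 ⊢
        split_ifs at h1 ⊢ <;> omega
    have hmem' : (s : ZMod (n + 3)) ∈ fed ZMod.val P Q :=
      fed_mono _ P (B := {(v : ZMod (n + 3))}) (by simp [hQ]) (hs.ge (Finset.mem_singleton_self _))
    symm
    refine Finset.eq_of_subset_of_card_le ?_ ?_
    · intro z hz
      rcases Finset.mem_insert.1 hz with rfl | hz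
      · exact hmem
      · rw [Finset.mem_singleton.1 hz]
        exact hmem'
    · rw [card_fed (by omega), hQcard, Finset.card_pair hstne]
  have hfed := fed_pair hu huv hv
  have e1 : layer (multiline ZMod.val (pairRows n u v)) 1
      = fed ZMod.val P Q \ fed ZMod.val P (fed ZMod.val Q {(u : ZMod (n + 3))}) := by
    rw [hP, hQ]
    rfl
  have e2 : layer (multiline ZMod.val (pairRows n u v)) 2
      = fed ZMod.val P (fed ZMod.val Q {(u : ZMod (n + 3))}) \ ∅ := by
    rw [hP, hQ]
    rfl
  rw [e1, e2, hQ, hfed, ← hQ, hs, ht]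
  refine ⟨?_, Finset.sdiff_empty⟩
  rw [Finset.insert_sdiff_of_notMem _ (by simpa using hstne), sdiff_self]
  rfl

theorem follows_pairRows_iff {u v p q a b : ℕ} (huv : u < v) (hv : v < n + 3) (hp : p < n + 3)
    (hq : q < n + 3)
    (h1 : layer (multiline ZMod.val (pairRows n u v)) a = {(p : ZMod (n + 3))})
    (h2 : layer (multiline ZMod.val (pairRows n u v)) b = {(q : ZMod (n + 3))}) :
    Follows ZMod.val (multiline ZMod.val (pairRows n u v)) a b ↔
      ∀ c, c < n + 3 → c ≠ 0 → c ≠ v → c ≠ u → c ≠ p → c ≠ q →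
        ¬ (if p ≤ c then c - p else c + (n + 3) - p)
          ≤ (if p ≤ q then q - p else q + (n + 3) - p) := by
  have h0 : (multiline ZMod.val (pairRows n u v)).getD 0 ∅ = Finset.univ \
    {((0 : ℕ) : ZMod (n + 3)), (v : ZMod (n + 3)), (u : ZMod (n + 3))} := rfl
  simp only [Follows, h1, h2, h0, Finset.mem_singleton, forall_eq, cycBtw_val]
  rw [val_natCast_sub hq hp]
  constructor
  · intro h c hc hc0 hcv hcu hcp hcq
    have := h c ((natCast_mem_pairRows_bottom huv hv hc).2 ⟨hc0, hcv, hcu⟩)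
      (by rwa [Ne, natCast_inj_of_lt hc hp]) (by rwa [Ne, natCast_inj_of_lt hc hq])
    rwa [val_natCast_sub hc hp] at this
  · intro h c hc hcp hcq
    obtain ⟨c, hc', rfl⟩ : ∃ k : ℕ, k < n + 3 ∧ (k : ZMod (n + 3)) = c :=
      ⟨c.val, ZMod.val_lt c, ZMod.natCast_zmod_val c⟩
    rw [natCast_mem_pairRows_bottom huv hv hc'] at hc
    rw [Ne, natCast_inj_of_lt hc' hp] at hcp
    rw [Ne, natCast_inj_of_lt hc' hq] at hcq
    rw [val_natCast_sub hc' hp]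
    exact h c hc' hc.1 hc.2.1 hc.2.2 hcp hcq

/-- The cases of `layers_pairRows` are exhaustive. -/
theorem exists_classes (hn : 3 ≤ n) {u v : ℕ} (hu : 0 < u) (huv : u < v) (hv : v < n + 3) :
    ∃ s t : ℕ, s < n + 3 ∧ t < n + 3 ∧ (v = 2 ∧ s = 3 ∧ t = 4 ∨
      v = n + 2 ∧ (u = 1 ∧ s = 2 ∧ t = 3 ∨ u = 2 ∧ s = 1 ∧ t = 3 ∨ 3 ≤ u ∧ s = 1 ∧ t = 2) ∨
      3 ≤ v ∧ v ≤ n + 1 ∧ s = v + 1 ∧ (u = 1 ∧ t = 2 ∨ 2 ≤ u ∧ t = 1)) := by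
  by_cases h1 : v = 2
  · exact ⟨3, 4, by omega, by omega, .inl ⟨h1, rfl, rfl⟩⟩
  by_cases h2 : v = n + 2
  · by_cases h3 : u = 1
    · exact ⟨2, 3, by omega, by omega, by omega⟩
    · by_cases h4 : u = 2
      · exact ⟨1, 3, by omega, by omega, by omega⟩
      · exact ⟨1, 2, by omega, by omega, by omega⟩
  · by_cases h3 : u = 1
    · exact ⟨v + 1, 2, by omega, by omega, by omega⟩
    · exact ⟨v + 1, 1, by omega, by omega, by omega⟩

theorem follows_one_two_iff (hn : 3 ≤ n) {u v : ℕ} (hu : 0 < u) (huv : u < v) (hv : v < n + 3) :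
    Follows ZMod.val (multiline ZMod.val (pairRows n u v)) 1 2 ↔ v = 3 := by
  obtain ⟨s, t, hs, ht, hst⟩ := exists_classes hn hu huv hv
  obtain ⟨h1, h2⟩ := layers_pairRows hn hu huv hv hst
  rw [follows_pairRows_iff huv hv ht hs h1 h2]
  constructor
  · -- some site among `2, 3, 4, 5` separates the two particles
    intro h
    by_contra hv3
    have h2 := h 2 (by omega)
    have h3 := h 3 (by omega)
    have h4 := h 4 (by omega)
    have h5 := h 5 (by omega)
    split_ifs at h2 h3 h4 h5 <;> omega
  · intro hv3 c
    split_ifs <;> omega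

theorem follows_two_one_iff (hn : 3 ≤ n) {u v : ℕ} (hu : 0 < u) (huv : u < v) (hv : v < n + 3) :
    Follows ZMod.val (multiline ZMod.val (pairRows n u v)) 2 1
      ↔ v = 2 ∨ v = n + 1 ∨ v = n + 2 := by
  obtain ⟨s, t, hs, ht, hst⟩ := exists_classes hn hu huv hv
  obtain ⟨h1, h2⟩ := layers_pairRows hn hu huv hv hst
  rw [follows_pairRows_iff huv hv hs ht h2 h1]
  constructor
  · -- the site `n + 2` separates the two particles
    intro h
    by_contra hv3
    have h2 := h (n + 2) (by omega)
    split_ifs at h2 <;> omega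
  · intro hv3 c
    split_ifs <;> omega

theorem pairRows_injective {u v u' v' : ℕ} (hu : 0 < u) (hv : v < n + 3) (huv : u < v)
    (hv' : v' < n + 3) (huv' : u' < v') (h : pairRows n u v = pairRows n u' v') :
    u = u' ∧ v = v' := by
  simp only [pairRows, List.cons.injEq, and_true] at h
  refine ⟨(natCast_inj_of_lt (by omega) (by omega)).1 (Finset.singleton_injective h.2.2), ?_⟩
  have h1 : (v : ZMod (n + 3)) ∈ ({((0 : ℕ) : ZMod (n + 3)), ↑v'} : Finset (ZMod (n + 3))) :=
    h.2.1 ▸ by simp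
  rw [Finset.mem_insert, Finset.mem_singleton, natCast_inj_of_lt hv (by omega),
    natCast_inj_of_lt hv hv'] at h1
  omega

theorem pairRows_mem {u v : ℕ} (hu : 0 < u) (huv : u < v) (hv : v < n + 3) :
    pairRows n u v ∈ partitions (n + 3) [n, 2, 1] ∧ unused (pairRows n u v) = {0} := by
  have h0v : ((0 : ℕ) : ZMod (n + 3)) ≠ (v : ZMod (n + 3)) := by
    rw [Ne, natCast_inj_of_lt (by omega) hv]
    omega
  have h0u : ((0 : ℕ) : ZMod (n + 3)) ≠ (u : ZMod (n + 3)) := by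
    rw [Ne, natCast_inj_of_lt (by omega) (by omega)]
    omega
  have hvu : (v : ZMod (n + 3)) ≠ (u : ZMod (n + 3)) := by
    rw [Ne, natCast_inj_of_lt hv (by omega)]
    omega
  constructor
  · rw [partitions, Finset.mem_filter, mem_rowLists]
    refine ⟨?_, fun z => ?_⟩
    · simp only [pairRows, List.map_cons, List.map_nil, Finset.card_singleton,
        Finset.card_pair h0v]
      rw [Finset.card_sdiff_of_subset (Finset.subset_univ _), Finset.card_univ, ZMod.card,
        Finset.card_eq_three.2 ⟨_, _, _, h0v, h0u, hvu, rfl⟩]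
      rfl
    · by_cases hz : z ∈ Finset.univ \ {((0 : ℕ) : ZMod (n + 3)), (v : ZMod (n + 3)),
        (u : ZMod (n + 3))}
      · exact ⟨_, List.mem_cons_self, hz⟩
      · simp only [Finset.mem_sdiff, Finset.mem_univ, true_and, not_not, Finset.mem_insert,
          Finset.mem_singleton] at hz
        rcases hz with h | h | h
        · exact ⟨_, .tail _ (.head _), by simp [h]⟩
        · exact ⟨_, .tail _ (.head _), by simp [h]⟩
        · exact ⟨_, .tail _ (.tail _ (.head _)), by simp [h]⟩
  · have e : unused (pairRows n u v) = {((0 : ℕ) : ZMod (n + 3)), (v : ZMod (n + 3))} \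
      fed ZMod.val {((0 : ℕ) : ZMod (n + 3)), (v : ZMod (n + 3))} {(u : ZMod (n + 3))} := rfl
    rw [e, fed_pair hu huv hv, Finset.insert_sdiff_of_notMem _ (by simpa using h0v), sdiff_self]
    simp

/-- The partitions of the ring whose unused site is `0` are those with `0 < u < v`. -/
theorem exists_eq_pairRows {L : List (Finset (ZMod (n + 3)))}
    (hL : L ∈ partitions (n + 3) [n, 2, 1]) (hL0 : unused L = {0}) :
    ∃ u v : ℕ, 0 < u ∧ u < v ∧ v < n + 3 ∧ L = pairRows n u v := by
  rw [partitions, Finset.mem_filter, mem_rowLists] at hL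
  obtain ⟨h, hcov⟩ := hL
  obtain ⟨P, Q, R, rfl⟩ := List.length_eq_three.1
    (show L.length = 3 by simpa using congrArg List.length h)
  · simp only [List.map_cons, List.map_nil, List.cons.injEq, and_true] at h
    obtain ⟨hP, hQ, hR⟩ := h
    obtain ⟨U, rfl⟩ := Finset.card_eq_one.1 hR
    change Q \ fed ZMod.val Q {U} = {0} at hL0
    have h0 : (0 : ZMod (n + 3)) ∈ Q ∧ (0 : ZMod (n + 3)) ∉ fed ZMod.val Q {U} := by
      rw [← Finset.mem_sdiff, hL0]
      exact Finset.mem_singleton_self 0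
    obtain ⟨V, hV⟩ := Finset.card_eq_one.1
      (show (Q.erase 0).card = 1 by rw [Finset.card_erase_of_mem h0.1, hQ])
    have hQV : Q = {((0 : ℕ) : ZMod (n + 3)), V} := by
      rw [← Finset.insert_erase h0.1, hV, Nat.cast_zero]
    have h0V : ((0 : ℕ) : ZMod (n + 3)) ≠ V := by
      intro h
      have : V ∈ Q.erase 0 := hV ▸ Finset.mem_singleton_self V
      rw [← h] at this
      simp at this
    have hsub : Finset.univ \ (Q ∪ {U}) ⊆ P := by
      intro z hz
      obtain ⟨S, hS, hzS⟩ := hcov z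
      simp only [List.mem_cons, List.not_mem_nil, or_false] at hS
      simp only [Finset.mem_sdiff, Finset.mem_univ, true_and, Finset.mem_union, not_or] at hz
      rcases hS with rfl | rfl | rfl
      · exact hzS
      · exact absurd hzS hz.1
      · exact absurd hzS hz.2
    have hc1 := Finset.card_le_card hsub
    have hc2 := Finset.card_union_le Q {U}
    have hc3 := Finset.card_sdiff_of_subset (Finset.subset_univ (Q ∪ {U}))
    rw [Finset.card_univ, ZMod.card] at hc3
    have hUQ : U ∉ Q := by
      intro h
      rw [Finset.union_eq_left.2 (Finset.singleton_subset_iff.2 h)] at hc1 hc3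
      omega
    have hPeq := Finset.eq_of_subset_of_card_le hsub (by omega)
    rw [hQV, Finset.mem_insert, Finset.mem_singleton, not_or] at hUQ
    obtain ⟨u, hu, rfl⟩ : ∃ k : ℕ, k < n + 3 ∧ (k : ZMod (n + 3)) = U :=
      ⟨U.val, ZMod.val_lt U, ZMod.natCast_zmod_val U⟩
    obtain ⟨v, hv, rfl⟩ : ∃ k : ℕ, k < n + 3 ∧ (k : ZMod (n + 3)) = V :=
      ⟨V.val, ZMod.val_lt V, ZMod.natCast_zmod_val V⟩
    rw [natCast_inj_of_lt hu (by omega), natCast_inj_of_lt hu hv] at hUQ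
    rw [Ne, natCast_inj_of_lt (by omega) hv] at h0V
    refine ⟨u, v, by omega, ?_, hv, ?_⟩
    · -- otherwise the arrival at `u` would be served at `0`
      by_contra huv
      apply h0.2
      rw [mem_fed_val]
      refine ⟨h0.1, _, Finset.mem_singleton_self _, ?_⟩
      rw [hQV]
      have h1 : arcCount {((0 : ℕ) : ZMod (n + 3)), (v : ZMod (n + 3))} (u : ZMod (n + 3))
          ((0 : ℕ) : ZMod (n + 3)) ≤ arcCount {(u : ZMod (n + 3))} (u : ZMod (n + 3))
            ((0 : ℕ) : ZMod (n + 3)) := by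
        rw [arcCount_pair (by rwa [Ne, natCast_inj_of_lt (by omega) hv])]
        simp only [arcCount_singleton, val_natCast_sub hv hu, val_natCast_sub hu hu,
          val_natCast_sub (show 0 < n + 3 by omega) hu]
        split_ifs <;> omega
      rwa [Nat.cast_zero, ← Nat.cast_zero] at h1
    · rw [← hPeq, hQV, pairRows, Finset.insert_union, Finset.insert_eq _ {_}]
      rfl

open Classical in
theorem card_pairs_eq (a b : ℕ) (T : Finset (ℕ × ℕ))
    (hT : ∀ u v, (u, v) ∈ T ↔ 0 < u ∧ u < v ∧ v < n + 3 ∧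
      Follows ZMod.val (multiline ZMod.val (pairRows n u v)) a b) :
    ((partitions (n + 3) [n, 2, 1]).filter fun L =>
      Follows ZMod.val (multiline ZMod.val L) a b ∧ unused L = {0}).card = T.card := by
  symm
  refine Finset.card_bij (fun x _ => pairRows n x.1 x.2) ?_ ?_ ?_
  · rintro ⟨u, v⟩ h
    obtain ⟨h1, h2, h3, h4⟩ := (hT u v).1 h
    obtain ⟨h5, h6⟩ := pairRows_mem h1 h2 h3
    exact Finset.mem_filter.2 ⟨h5, h4, h6⟩
  · rintro ⟨u, v⟩ h ⟨u', v'⟩ h' heq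
    obtain ⟨h1, h2, h3, -⟩ := (hT u v).1 h
    obtain ⟨-, h2', h3', -⟩ := (hT u' v').1 h'
    obtain ⟨rfl, rfl⟩ := pairRows_injective h1 h3 h2 h3' h2' heq
    rfl
  · intro L hL
    obtain ⟨h1, h2, h3⟩ := Finset.mem_filter.1 hL
    obtain ⟨u, v, hu, huv, hv, rfl⟩ := exists_eq_pairRows h1 h3
    exact ⟨(u, v), (hT u v).2 ⟨hu, huv, hv, h2⟩, rfl⟩

open Classical in
theorem card_partitions_one_two (hn : 3 ≤ n) :
    ((partitions (n + 3) [n, 2, 1]).filter fun L =>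
      Follows ZMod.val (multiline ZMod.val L) 1 2 ∧ unused L = {0}).card = 2 := by
  rw [card_pairs_eq 1 2 {(1, 3), (2, 3)}]
  · rfl
  · intro u v
    simp only [Finset.mem_insert, Finset.mem_singleton, Prod.mk.injEq]
    constructor
    · intro h
      have h1 : 0 < u ∧ u < v ∧ v < n + 3 := by omega
      exact ⟨h1.1, h1.2.1, h1.2.2, (follows_one_two_iff hn h1.1 h1.2.1 h1.2.2).2 (by omega)⟩
    · rintro ⟨h1, h2, h3, h4⟩
      rw [follows_one_two_iff hn h1 h2 h3] at h4
      omega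

open Classical in
theorem card_partitions_two_one (hn : 3 ≤ n) :
    ((partitions (n + 3) [n, 2, 1]).filter fun L =>
      Follows ZMod.val (multiline ZMod.val L) 2 1 ∧ unused L = {0}).card = 2 * n + 2 := by
  rw [card_pairs_eq 2 1 ({(1, 2)} ∪ ((Finset.Icc 1 n ×ˢ {n + 1}) ∪
    (Finset.Icc 1 (n + 1) ×ˢ {n + 2})))]
  · rw [Finset.card_union_of_disjoint, Finset.card_union_of_disjoint, Finset.card_product,
      Finset.card_product]
    · simp
      omega
    · rw [Finset.disjoint_left]
      rintro ⟨u, v⟩ h1 h2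
      simp only [Finset.mem_product, Finset.mem_singleton] at h1 h2
      omega
    · rw [Finset.disjoint_left]
      rintro ⟨u, v⟩ h1 h2
      simp only [Finset.mem_union, Finset.mem_product, Finset.mem_singleton, Prod.mk.injEq] at h1 h2
      omega
  · intro u v
    simp only [Finset.mem_union, Finset.mem_product, Finset.mem_Icc, Finset.mem_singleton,
      Prod.mk.injEq]
    constructor
    · intro h
      have h1 : 0 < u ∧ u < v ∧ v < n + 3 := by omega
      exact ⟨h1.1, h1.2.1, h1.2.2, (follows_two_one_iff hn h1.1 h1.2.1 h1.2.2).2 (by omega)⟩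
    · rintro ⟨h1, h2, h3, h4⟩
      rw [follows_two_one_iff hn h1 h2 h3] at h4
      omega

end Pairs

/-! ### The labels `n` and `n - 1`: a condition on initial segments -/

section Prefix

variable {M : ℕ}

/-- The cyclic interval in the criterion for a used service may start anywhere, not only at an
arrival. -/
theorem mem_fed_of_arcCount_le [NeZero M] {S B : Finset (ZMod M)} (h : B.card < S.card)
    {a z : ZMod M} (hz : z ∈ S) (hle : arcCount S a z ≤ arcCount B a z) :
    z ∈ fed ZMod.val S B := by
  obtain ⟨q, hq⟩ := exists_isQueue h.le
  refine (mem_fed_iff_queue hq h).2 ⟨hz, ?_⟩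
  by_cases hza : z = a
  · subst hza
    rw [arcCount_self, arcCount_self, ind_of_mem hz] at hle
    omega
  · rw [arcCount_step_right B hza, arcCount_step_right S hza, ind_of_mem hz] at hle
    have := arcCount_le_queue hq a (z - 1)
    omega

/-- The number of members of `S` among the sites `0, …, y - 1`. -/
def prefixCount (S : Finset (ZMod M)) (y : ℕ) : ℕ := (S.filter fun z => z.val < y).card

theorem arcCount_add_prefixCount [NeZero M] (S : Finset (ZMod M)) (a z : ZMod M) :
    arcCount S a z + prefixCount S a.val
      = prefixCount S (z.val + 1) + if a.val ≤ z.val then 0 else S.card := by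
  rw [arcCount, prefixCount, prefixCount]
  simp only [← cycBtw_val, CycBtw]
  split_ifs with h
  · rw [Finset.card_filter, Finset.card_filter, Finset.card_filter, ← Finset.sum_add_distrib,
      add_zero]
    refine Finset.sum_congr rfl fun t _ => ?_
    split_ifs <;> omega
  · rw [Finset.card_filter, Finset.card_filter, Finset.card_filter, Finset.card_eq_sum_ones,
      ← Finset.sum_add_distrib, ← Finset.sum_add_distrib]
    refine Finset.sum_congr rfl fun t _ => ?_
    split_ifs <;> omega

theorem prefixCount_zero (S : Finset (ZMod M)) : prefixCount S 0 = 0 := by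
  simp [prefixCount]

theorem prefixCount_full [NeZero M] (S : Finset (ZMod M)) : prefixCount S M = S.card := by
  rw [prefixCount, Finset.filter_true_of_mem fun z _ => ZMod.val_lt z]

theorem prefixCount_mono (S : Finset (ZMod M)) {x y : ℕ} (h : x ≤ y) :
    prefixCount S x ≤ prefixCount S y :=
  Finset.card_le_card fun z hz => by
    rw [Finset.mem_filter] at hz ⊢
    exact ⟨hz.1, hz.2.trans_le h⟩

theorem prefixCount_succ [NeZero M] (S : Finset (ZMod M)) {y : ℕ} (hy : y < M) :
    prefixCount S (y + 1) = prefixCount S y + ind S (y : ZMod M) := by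
  rw [prefixCount, prefixCount, ← card_filter_eq_ind, Finset.card_filter, Finset.card_filter,
    Finset.card_filter, ← Finset.sum_add_distrib]
  refine Finset.sum_congr rfl fun t _ => ?_
  have : t = (y : ZMod M) ↔ t.val = y := by
    rw [← (ZMod.val_injective M).eq_iff, ZMod.val_natCast_of_lt hy]
  simp only [this]
  split_ifs <;> omega

theorem prefixCount_eq_of_forall [NeZero M] {S : Finset (ZMod M)} {x y : ℕ} (hxy : x ≤ y)
    (hy : y ≤ M) (h : ∀ c, x ≤ c → c < y → (c : ZMod M) ∉ S) :
    prefixCount S y = prefixCount S x := by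
  induction y, hxy using Nat.le_induction with
  | base => rfl
  | succ y hxy ih =>
    rw [prefixCount_succ S (by omega), ind_of_notMem (h y hxy (by omega)), add_zero]
    exact ih (by omega) fun c hc hc' => h c hc (by omega)

theorem mem_fed_iff_prefixCount [NeZero M] {S B : Finset (ZMod M)} (h : B.card < S.card) {z : ℕ}
    (hzM : z < M) :
    (z : ZMod M) ∈ fed ZMod.val S B ↔ (z : ZMod M) ∈ S ∧ ∃ a, a < M ∧
      prefixCount S (z + 1) + prefixCount B a + (if a ≤ z then 0 else S.card)
        ≤ prefixCount B (z + 1) + prefixCount S a + (if a ≤ z then 0 else B.card) := by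
  have key : ∀ a : ZMod M, arcCount S a z ≤ arcCount B a z ↔
      prefixCount S (z + 1) + prefixCount B a.val + (if a.val ≤ z then 0 else S.card)
        ≤ prefixCount B (z + 1) + prefixCount S a.val + (if a.val ≤ z then 0 else B.card) := by
    intro a
    have h1 := arcCount_add_prefixCount S a z
    have h2 := arcCount_add_prefixCount B a z
    rw [ZMod.val_natCast_of_lt hzM] at h1 h2
    split_ifs at h1 h2 ⊢ <;> omega
  constructor
  · intro hz
    obtain ⟨hz, a, -, ha⟩ := mem_fed_val.1 hz
    exact ⟨hz, a.val, ZMod.val_lt a, (key a).1 ha⟩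
  · rintro ⟨hz, a, haM, ha⟩
    refine mem_fed_of_arcCount_le h hz (a := (a : ZMod M)) ((key a).2 ?_)
    rwa [ZMod.val_natCast_of_lt haM]

end Prefix

section Characterization

variable {m : ℕ} {P Q R : Finset (ZMod (3 * m + 3))}

/-- The three rows of sizes `m + 2`, `m + 1` and `m` partition the ring, and the site `0` belongs to
the middle row. -/
structure IsSplit (P Q R : Finset (ZMod (3 * m + 3))) : Prop where
  card_bottom : P.card = m + 2
  card_middle : Q.card = m + 1
  card_top : R.card = m
  cover : ∀ z, z ∈ P ∨ z ∈ Q ∨ z ∈ R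
  zero_mem : (0 : ZMod (3 * m + 3)) ∈ Q

/-- The condition on three rows, in terms of the numbers of their members in initial segments, for
the site `0` to be the unused one and for the particles `n` and `n - 1` to be neighbours. -/
def GoodPrefix (P Q R : Finset (ZMod (3 * m + 3))) : Prop :=
  (∀ y, 1 ≤ y → y < 3 * m + 3 →
    prefixCount P y ≤ prefixCount Q y ∧ prefixCount Q y ≤ prefixCount R y + 1) ∧
  ∃ t, 1 ≤ t ∧ t < 3 * m + 3 ∧ (t : ZMod (3 * m + 3)) ∈ P ∧
    ∀ y, 1 ≤ y → y < t → (y : ZMod (3 * m + 3)) ∈ R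

theorem IsSplit.sum_prefixCount (h : IsSplit P Q R) {y : ℕ} (hy : y ≤ 3 * m + 3) :
    prefixCount P y + prefixCount Q y + prefixCount R y = y := by
  have hge : ∀ y, y ≤ 3 * m + 3 → ∀ x, x ≤ y →
      prefixCount P x + prefixCount Q x + prefixCount R x + (y - x)
        ≤ prefixCount P y + prefixCount Q y + prefixCount R y := by
    intro y
    induction y with
    | zero =>
      intro _ x hx
      rw [Nat.le_zero.1 hx]
      omega
    | succ y ih =>
      intro hy x hx
      rcases hx.eq_or_lt with rfl | hx
      · omega
      have h1 := ih (by omega) x (by omega)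
      rw [prefixCount_succ P (by omega), prefixCount_succ Q (by omega),
        prefixCount_succ R (by omega)]
      have : 1 ≤ ind P (y : ZMod (3 * m + 3)) + ind Q (y : ZMod (3 * m + 3))
          + ind R (y : ZMod (3 * m + 3)) := by
        rcases h.cover y with h2 | h2 | h2 <;> rw [ind_of_mem h2] <;> omega
      omega
  have h1 := hge _ le_rfl y hy
  have h2 := hge y hy 0 (by omega)
  rw [prefixCount_full, prefixCount_full, prefixCount_full, h.card_bottom, h.card_middle,
    h.card_top] at h1
  omega

theorem IsSplit.ind_add (h : IsSplit P Q R) {y : ℕ} (hy : y < 3 * m + 3) :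
    ind P (y : ZMod (3 * m + 3)) + ind Q (y : ZMod (3 * m + 3))
      + ind R (y : ZMod (3 * m + 3)) = 1 := by
  have h1 := h.sum_prefixCount hy.le
  have h2 := h.sum_prefixCount (y := y + 1) hy
  rw [prefixCount_succ P hy, prefixCount_succ Q hy, prefixCount_succ R hy] at h2
  omega

theorem IsSplit.prefixCount_one (h : IsSplit P Q R) :
    prefixCount P 1 = 0 ∧ prefixCount Q 1 = 1 ∧ prefixCount R 1 = 0 := by
  have h1 := h.sum_prefixCount (y := 1) (by omega)
  have h2 : prefixCount Q 1 = 1 := by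
    have := prefixCount_succ Q (y := 0) (by omega)
    rwa [prefixCount_zero, Nat.cast_zero, ind_of_mem h.zero_mem, zero_add] at this
  omega

theorem zero_notMem_fed_iff (h : IsSplit P Q R) :
    (0 : ZMod (3 * m + 3)) ∉ fed ZMod.val Q R ↔
      ∀ y, 1 ≤ y → y < 3 * m + 3 → prefixCount Q y ≤ prefixCount R y + 1 := by
  have h0 := mem_fed_iff_prefixCount (S := Q) (B := R) (z := 0)
    (by rw [h.card_middle, h.card_top]; omega) (by omega)
  rw [Nat.cast_zero] at h0
  rw [h0, h.card_middle, h.card_top]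
  obtain ⟨-, h2, h3⟩ := h.prefixCount_one
  simp only [zero_add, h2, h3, h.zero_mem, true_and, not_exists, not_and]
  constructor
  · intro h y hy hyM
    have := h y hyM
    rw [if_neg (by omega), if_neg (by omega)] at this
    omega
  · intro h y hyM
    rcases Nat.eq_zero_or_pos y with rfl | hy
    · simp [prefixCount_zero]
    · have := h y hy hyM
      rw [if_neg (by omega), if_neg (by omega)]
      omega

theorem IsSplit.prefixCount_erase (h : IsSplit P Q R) {y : ℕ} (hy : 1 ≤ y) :
    prefixCount (Q.erase 0) y + 1 = prefixCount Q y := by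
  rw [prefixCount, prefixCount, Finset.filter_erase, Finset.card_erase_of_mem]
  · have : 0 < (Q.filter fun z => z.val < y).card :=
      Finset.card_pos.2 ⟨0, Finset.mem_filter.2 ⟨h.zero_mem, by rw [ZMod.val_zero]; omega⟩⟩
    omega
  · exact Finset.mem_filter.2 ⟨h.zero_mem, by rw [ZMod.val_zero]; omega⟩

theorem exists_natCast {M : ℕ} [NeZero M] (z : ZMod M) : ∃ k : ℕ, k < M ∧ (k : ZMod M) = z :=
  ⟨z.val, ZMod.val_lt z, ZMod.natCast_zmod_val z⟩

/-- If the particle `n - 1`, at `t`, is directly right of the particle `n`, at `z`, then `z` is the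
last site and `t` is the first site after `0` outside of the top row. -/
theorem goodPrefix_of_follows (h : IsSplit P Q R)
    (hQR : ∀ y, 1 ≤ y → y < 3 * m + 3 → prefixCount Q y ≤ prefixCount R y + 1) {z t : ℕ}
    (hz : z < 3 * m + 3) (ht : t < 3 * m + 3) (hzt : z ≠ t)
    (hzP : (z : ZMod (3 * m + 3)) ∈ P) (hzQ : (z : ZMod (3 * m + 3)) ∉ fed ZMod.val P Q)
    (htQ : (t : ZMod (3 * m + 3)) ∈ fed ZMod.val P Q)
    (htQ' : (t : ZMod (3 * m + 3)) ∉ fed ZMod.val P (Q.erase 0))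
    (hP : ∀ c, c < 3 * m + 3 → (c : ZMod (3 * m + 3)) ∈ P → c ≠ z → c ≠ t →
      ¬ (if z ≤ c then c - z else c + (3 * m + 3) - z)
          ≤ (if z ≤ t then t - z else t + (3 * m + 3) - z)) :
    GoodPrefix P Q R := by
  have hcard : (Q.erase 0).card = m := by
    rw [Finset.card_erase_of_mem h.zero_mem, h.card_middle, Nat.add_sub_cancel]
  rw [mem_fed_iff_prefixCount (by rw [h.card_bottom, h.card_middle]; omega) (by omega),
    h.card_bottom, h.card_middle] at hzQ htQ
  rw [mem_fed_iff_prefixCount (by rw [h.card_bottom, hcard]; omega) (by omega),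
    h.card_bottom, hcard] at htQ'
  obtain ⟨htP, p, hp, hple⟩ := htQ
  have hz1 : ∀ a, a < 3 * m + 3 → ¬ prefixCount P (z + 1) + prefixCount Q a
      + (if a ≤ z then 0 else m + 2) ≤ prefixCount Q (z + 1) + prefixCount P a
      + (if a ≤ z then 0 else m + 1) := fun a ha hle => hzQ ⟨hzP, a, ha, hle⟩
  have ht1 : ∀ a, a < 3 * m + 3 → ¬ prefixCount P (t + 1) + prefixCount (Q.erase 0) a
      + (if a ≤ t then 0 else m + 2) ≤ prefixCount (Q.erase 0) (t + 1) + prefixCount P a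
      + (if a ≤ t then 0 else m) := fun a ha hle => htQ' ⟨htP, a, ha, hle⟩
  have e1 := h.prefixCount_erase (y := t + 1) (by omega)
  have e2 := fun {y : ℕ} (hy : 1 ≤ y) => h.prefixCount_erase hy
  have s1 := prefixCount_succ P ht
  have s2 := prefixCount_succ P hz
  rw [ind_of_mem htP] at s1
  rw [ind_of_mem hzP] at s2
  have fP : prefixCount P (3 * m + 3) = m + 2 := by rw [prefixCount_full, h.card_bottom]
  have fQ : prefixCount Q (3 * m + 3) = m + 1 := by rw [prefixCount_full, h.card_middle]
  have fR : prefixCount R (3 * m + 3) = m := by rw [prefixCount_full, h.card_top]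
  have z0 := prefixCount_zero P
  have z1 := prefixCount_zero Q
  have z2 := prefixCount_zero (Q.erase (0 : ZMod (3 * m + 3)))
  obtain ⟨o1, o2, o3⟩ := h.prefixCount_one
  rcases lt_or_gt_of_ne hzt with hlt | hlt
  · -- the customer served at `t` would already have been served at `z`
    exfalso
    have hPc : prefixCount P t = prefixCount P (z + 1) :=
      prefixCount_eq_of_forall hlt ht.le fun c hc hc' hcP =>
        hP c (by omega) hcP (by omega) (by omega) (by split_ifs <;> omega)
    have h1 := ht1 (z + 1) (by omega)
    have h2 := hz1 p hp
    have h3 := ht1 p hp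
    have h4 := e2 (y := z + 1) (by omega)
    rw [if_pos (by omega), if_pos (by omega)] at h1
    rcases Nat.eq_zero_or_pos p with rfl | hp0
    · rw [if_pos (by omega), if_pos (by omega)] at h2 hple
      omega
    · have h5 := e2 (y := p) hp0
      split_ifs at h2 h3 hple <;> omega
  · have hPc : prefixCount P (3 * m + 3) = prefixCount P (z + 1) :=
      prefixCount_eq_of_forall hz le_rfl fun c hc hc' hcP =>
        hP c (by omega) hcP (by omega) (by omega) (by split_ifs <;> omega)
    have hPt : prefixCount P t = prefixCount P 0 :=
      prefixCount_eq_of_forall (Nat.zero_le t) ht.le fun c _ hc' hcP =>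
        hP c (by omega) hcP (by omega) (by omega) (by split_ifs <;> omega)
    have hQt : prefixCount Q (t + 1) = 1 := by
      have h1 := ht1 0 (by omega)
      have := prefixCount_mono Q (show 1 ≤ t + 1 by omega)
      simp only [Nat.zero_le, if_true] at h1
      omega
    -- the sites after `z` lie in the top row, but by `hQR` no more of them than in the middle row
    have hzM : z + 1 = 3 * m + 3 := by
      by_contra hne
      have h1 := ht1 (z + 1) (by omega)
      rw [if_neg (by omega), if_neg (by omega)] at h1
      have h2 := hQR (z + 1) (by omega) (by omega)
      have h3 := h.sum_prefixCount (y := z + 1) (by omega)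
      have h4 := e2 (y := z + 1) (by omega)
      have h5 := prefixCount_mono Q (show z + 1 ≤ 3 * m + 3 by omega)
      have h6 := prefixCount_mono R (show z + 1 ≤ 3 * m + 3 by omega)
      omega
    have ht0 : 1 ≤ t := by
      rcases Nat.eq_zero_or_pos t with rfl | h0
      · rw [zero_add] at s1
        omega
      · exact h0
    refine ⟨fun y hy hyM => ⟨?_, hQR y hy hyM⟩, t, ht0, ht, htP, fun y hy hyt => ?_⟩
    · have h1 := hz1 y hyM
      rw [if_pos (by omega), if_pos (by omega), hzM] at h1
      omega
    · by_contra hyR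
      have h1 := h.ind_add (y := y) (by omega)
      rw [ind_of_notMem hyR] at h1
      have h2 := prefixCount_succ P (y := y) (by omega)
      have h3 := prefixCount_succ Q (y := y) (by omega)
      have h4 := prefixCount_mono P (show y + 1 ≤ t by omega)
      have h5 := prefixCount_mono Q (show y + 1 ≤ t + 1 by omega)
      have h6 := prefixCount_mono Q hy
      omega

/-- Conversely, under the condition on initial segments, the particle `n` is at the last site and
the particle `n - 1` at the first site of the bottom row. -/
theorem GoodPrefix.exists_follows (h : IsSplit P Q R) (hg : GoodPrefix P Q R) :
    ∃ t, 1 ≤ t ∧ t < 3 * m + 2 ∧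
      ((3 * m + 2 : ℕ) : ZMod (3 * m + 3)) ∈ P \ fed ZMod.val P Q ∧
      (t : ZMod (3 * m + 3)) ∈ fed ZMod.val P Q \ fed ZMod.val P (Q.erase 0) ∧
      ∀ c, c < t → (c : ZMod (3 * m + 3)) ∉ P := by
  obtain ⟨h1, t, ht0, ht, htP, htR⟩ := hg
  have hcard : (Q.erase 0).card = m := by
    rw [Finset.card_erase_of_mem h.zero_mem, h.card_middle, Nat.add_sub_cancel]
  have fP : prefixCount P (3 * m + 2 + 1) = m + 2 := by
    rw [← h.card_bottom]
    exact prefixCount_full P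
  have fQ : prefixCount Q (3 * m + 2 + 1) = m + 1 := by
    rw [← h.card_middle]
    exact prefixCount_full Q
  have z0 := prefixCount_zero P
  have z1 := prefixCount_zero Q
  have z2 := prefixCount_zero (Q.erase (0 : ZMod (3 * m + 3)))
  obtain ⟨o1, o2, o3⟩ := h.prefixCount_one
  have hnP : ∀ c, c < t → (c : ZMod (3 * m + 3)) ∉ P := by
    intro c hc hcP
    have i1 := h.ind_add (y := c) (by omega)
    rw [ind_of_mem hcP] at i1
    rcases Nat.eq_zero_or_pos c with rfl | hc0
    · rw [Nat.cast_zero, ind_of_mem h.zero_mem] at i1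
      omega
    · rw [ind_of_mem (htR c hc0 hc)] at i1
      omega
  have hnQ : ∀ c, 1 ≤ c → c < t + 1 → (c : ZMod (3 * m + 3)) ∉ Q := by
    intro c hc0 hc hcQ
    have i1 := h.ind_add (y := c) (by omega)
    rw [ind_of_mem hcQ] at i1
    rcases Nat.lt_succ_iff_lt_or_eq.1 hc with hc | rfl
    · rw [ind_of_mem (htR c hc0 hc)] at i1
      omega
    · rw [ind_of_mem htP] at i1
      omega
  have p1 : prefixCount P (t + 1) = 1 := by
    rw [prefixCount_succ P ht, ind_of_mem htP,
      prefixCount_eq_of_forall (Nat.zero_le t) ht.le fun c _ => hnP c, z0]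
  have q1 : prefixCount Q (t + 1) = 1 := by
    rw [prefixCount_eq_of_forall (show 1 ≤ t + 1 by omega) ht hnQ, o2]
  have hlast : ((3 * m + 2 : ℕ) : ZMod (3 * m + 3)) ∈ P := by
    have i1 := prefixCount_succ P (y := 3 * m + 2) (by omega)
    have i2 := h1 (3 * m + 2) (by omega) (by omega)
    have i3 := prefixCount_mono Q (show 3 * m + 2 ≤ 3 * m + 2 + 1 by omega)
    by_contra hn
    rw [ind_of_notMem hn] at i1
    omega
  have htM : t < 3 * m + 2 := by
    by_contra hn
    have : t + 1 = 3 * m + 2 + 1 := by omega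
    rw [this] at p1
    omega
  refine ⟨t, ht0, htM, ?_, ?_, hnP⟩
  · refine Finset.mem_sdiff.2 ⟨hlast, ?_⟩
    rw [mem_fed_iff_prefixCount (by rw [h.card_bottom, h.card_middle]; omega) (by omega),
      h.card_bottom, h.card_middle, fP, fQ]
    rintro ⟨-, a, ha, hle⟩
    rw [if_pos (by omega), if_pos (by omega)] at hle
    rcases Nat.eq_zero_or_pos a with rfl | ha0
    · omega
    · have := h1 a ha0 ha
      omega
  · rw [Finset.mem_sdiff, mem_fed_iff_prefixCount (by rw [h.card_bottom, h.card_middle]; omega)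
      (by omega), mem_fed_iff_prefixCount (by rw [h.card_bottom, hcard]; omega) (by omega),
      h.card_bottom, h.card_middle, hcard, p1, q1]
    refine ⟨⟨htP, 0, by omega, by simp [prefixCount_zero]⟩, ?_⟩
    rintro ⟨-, a, ha, hle⟩
    have e1 := h.prefixCount_erase (y := t + 1) (by omega)
    rcases Nat.eq_zero_or_pos a with rfl | ha0
    · simp only [Nat.zero_le, if_true] at hle
      omega
    · have e2 := h.prefixCount_erase ha0
      have e3 := h1 a ha0 ha
      by_cases hat : a ≤ t
      · rw [if_pos hat, if_pos hat] at hle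
        have := prefixCount_eq_of_forall (Nat.zero_le a) ha.le fun c _ hc => hnP c (by omega)
        omega
      · rw [if_neg hat, if_neg hat] at hle
        omega

theorem follows_unused_iff (h : IsSplit P Q R) :
    (Follows ZMod.val (multiline ZMod.val [P, Q, R]) 0 1 ∧ unused [P, Q, R] = {0})
      ↔ GoodPrefix P Q R := by
  have hun : unused [P, Q, R] = Q \ fed ZMod.val Q R := rfl
  have hcard : (Q.erase 0).card = m := by
    rw [Finset.card_erase_of_mem h.zero_mem, h.card_middle, Nat.add_sub_cancel]
  have huniff : unused [P, Q, R] = {0} ↔ (0 : ZMod (3 * m + 3)) ∉ fed ZMod.val Q R := by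
    rw [hun]
    constructor
    · intro h1
      have : (0 : ZMod (3 * m + 3)) ∈ Q \ fed ZMod.val Q R := h1 ▸ Finset.mem_singleton_self 0
      exact (Finset.mem_sdiff.1 this).2
    · intro h1
      symm
      refine Finset.eq_of_subset_of_card_le
        (Finset.singleton_subset_iff.2 (Finset.mem_sdiff.2 ⟨h.zero_mem, h1⟩)) ?_
      rw [Finset.card_sdiff_of_subset (fed_subset _ _ _),
        card_fed (by rw [h.card_middle, h.card_top]; omega), h.card_middle, h.card_top,
        Finset.card_singleton]
      omega
  have l0 : layer (multiline ZMod.val [P, Q, R]) 0 = P \ fed ZMod.val P Q := rfl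
  have hfed : unused [P, Q, R] = {0} → fed ZMod.val Q R = Q.erase 0 := by
    intro h1
    rw [hun] at h1
    rw [Finset.erase_eq, ← h1, Finset.sdiff_sdiff_eq_self (fed_subset _ _ _)]
  have l1 : unused [P, Q, R] = {0} → layer (multiline ZMod.val [P, Q, R]) 1
      = fed ZMod.val P Q \ fed ZMod.val P (Q.erase 0) := by
    intro h1
    rw [← hfed h1]
    rfl
  have c0 : ∃ z : ℕ, z < 3 * m + 3 ∧ P \ fed ZMod.val P Q = {(z : ZMod (3 * m + 3))} := by
    obtain ⟨z, hz⟩ := Finset.card_eq_one.1 (show (P \ fed ZMod.val P Q).card = 1 by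
      rw [Finset.card_sdiff_of_subset (fed_subset _ _ _),
        card_fed (by rw [h.card_bottom, h.card_middle]; omega), h.card_bottom, h.card_middle]
      omega)
    obtain ⟨k, hk, rfl⟩ := exists_natCast z
    exact ⟨k, hk, hz⟩
  have c1 : ∃ t : ℕ, t < 3 * m + 3 ∧ fed ZMod.val P Q \ fed ZMod.val P (Q.erase 0)
      = {(t : ZMod (3 * m + 3))} := by
    obtain ⟨z, hz⟩ := Finset.card_eq_one.1
      (show (fed ZMod.val P Q \ fed ZMod.val P (Q.erase 0)).card = 1 by
      rw [Finset.card_sdiff_of_subset (fed_mono _ _ (Finset.erase_subset _ _)),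
        card_fed (by rw [h.card_bottom, h.card_middle]; omega),
        card_fed (by rw [h.card_bottom, hcard]; omega), h.card_middle, hcard]
      omega)
    obtain ⟨k, hk, rfl⟩ := exists_natCast z
    exact ⟨k, hk, hz⟩
  obtain ⟨z, hz, hzeq⟩ := c0
  obtain ⟨t, ht, hteq⟩ := c1
  have hfol : unused [P, Q, R] = {0} → (Follows ZMod.val (multiline ZMod.val [P, Q, R]) 0 1 ↔
      ∀ c, c < 3 * m + 3 → (c : ZMod (3 * m + 3)) ∈ P → c ≠ z → c ≠ t →
      ¬ (if z ≤ c then c - z else c + (3 * m + 3) - z)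
          ≤ (if z ≤ t then t - z else t + (3 * m + 3) - z)) := by
    intro h1
    have hg : (multiline ZMod.val [P, Q, R]).getD 0 ∅ = P := rfl
    simp only [Follows, l0, l1 h1, hzeq, hteq, hg, Finset.mem_singleton, forall_eq, cycBtw_val]
    rw [val_natCast_sub ht hz]
    constructor
    · intro h c hc hcP hcz hct
      have := h c hcP (by rwa [Ne, natCast_inj_of_lt hc hz]) (by rwa [Ne, natCast_inj_of_lt hc ht])
      rwa [val_natCast_sub hc hz] at this
    · intro h c hcP hcz hct
      obtain ⟨c, hc, rfl⟩ := exists_natCast c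
      rw [Ne, natCast_inj_of_lt hc hz] at hcz
      rw [Ne, natCast_inj_of_lt hc ht] at hct
      rw [val_natCast_sub hc hz]
      exact h c hc hcP hcz hct
  have hzm := Finset.mem_sdiff.1 (hzeq.ge (Finset.mem_singleton_self _))
  have htm := Finset.mem_sdiff.1 (hteq.ge (Finset.mem_singleton_self _))
  constructor
  · rintro ⟨h1, h2⟩
    refine goodPrefix_of_follows h ((zero_notMem_fed_iff h).1 (huniff.1 h2)) hz ht ?_ hzm.1 hzm.2
      htm.1 htm.2 ((hfol h2).1 h1)
    rintro rfl
    exact hzm.2 htm.1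
  · intro hg
    have h2 : unused [P, Q, R] = {0} :=
      huniff.2 ((zero_notMem_fed_iff h).2 fun y hy hyM => (hg.1 y hy hyM).2)
    refine ⟨(hfol h2).2 ?_, h2⟩
    obtain ⟨t', ht0, htM, h3, h4, h5⟩ := hg.exists_follows h
    rw [hzeq, Finset.mem_singleton, natCast_inj_of_lt (by omega) hz] at h3
    rw [hteq, Finset.mem_singleton, natCast_inj_of_lt (by omega) ht] at h4
    subst h3 h4
    intro c hc hcP hcz hct
    have hct' : ¬ c < t' := fun hlt => h5 c hlt hcP
    split_ifs <;> omega

end Characterization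

/-! ### Counting three-letter ballot words -/

section Ballot

/-- In every nonempty final segment, the letter `0` is more frequent than the letter `1`, which is
at least as frequent as the letter `2`. -/
def Ballot : List (Fin 3) → Prop
  | [] => True
  | k :: l => Ballot l ∧ (k :: l).count 1 < (k :: l).count 0 ∧ (k :: l).count 2 ≤ (k :: l).count 1

/-- The first letter other than `2` exists and is `0`. -/
def LeadsZero : List (Fin 3) → Prop
  | [] => False
  | k :: l => k = 0 ∨ k = 2 ∧ LeadsZero l

/-- The letters `0`, `1` and `2` occur `x`, `y` and `z` times. -/
def HasContent (l : List (Fin 3)) (x y z : ℕ) : Prop :=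
  l.count 0 = x ∧ l.count 1 = y ∧ l.count 2 = z

theorem Ballot.count_lt {l : List (Fin 3)} (h : Ballot l) (hl : l ≠ []) :
    l.count 1 < l.count 0 ∧ l.count 2 ≤ l.count 1 := by
  cases l with
  | nil => exact absurd rfl hl
  | cons k l => exact h.2

theorem hasContent_cons_zero {l : List (Fin 3)} {x y z : ℕ} :
    HasContent (0 :: l) x y z ↔ ∃ x', x = x' + 1 ∧ HasContent l x' y z := by
  simp only [HasContent, List.count_cons_self,
    List.count_cons_of_ne (show (0 : Fin 3) ≠ 1 by decide),
    List.count_cons_of_ne (show (0 : Fin 3) ≠ 2 by decide)]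
  constructor
  · rintro ⟨h1, h2, h3⟩
    exact ⟨_, h1.symm, rfl, h2, h3⟩
  · rintro ⟨x', rfl, rfl, h2, h3⟩
    exact ⟨rfl, h2, h3⟩

theorem hasContent_cons_one {l : List (Fin 3)} {x y z : ℕ} :
    HasContent (1 :: l) x y z ↔ ∃ y', y = y' + 1 ∧ HasContent l x y' z := by
  simp only [HasContent, List.count_cons_self,
    List.count_cons_of_ne (show (1 : Fin 3) ≠ 0 by decide),
    List.count_cons_of_ne (show (1 : Fin 3) ≠ 2 by decide)]
  constructor
  · rintro ⟨h1, h2, h3⟩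
    exact ⟨_, h2.symm, h1, rfl, h3⟩
  · rintro ⟨x', rfl, h1, rfl, h3⟩
    exact ⟨h1, rfl, h3⟩

theorem hasContent_cons_two {l : List (Fin 3)} {x y z : ℕ} :
    HasContent (2 :: l) x y z ↔ ∃ z', z = z' + 1 ∧ HasContent l x y z' := by
  simp only [HasContent, List.count_cons_self,
    List.count_cons_of_ne (show (2 : Fin 3) ≠ 0 by decide),
    List.count_cons_of_ne (show (2 : Fin 3) ≠ 1 by decide)]
  constructor
  · rintro ⟨h1, h2, h3⟩
    exact ⟨_, h3.symm, h1, h2, rfl⟩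
  · rintro ⟨x', rfl, h1, h2, rfl⟩
    exact ⟨h1, h2, rfl⟩

theorem fin_three_cases (k : Fin 3) : k = 0 ∨ k = 1 ∨ k = 2 := by
  fin_cases k <;> simp

theorem eq_nil_of_hasContent {l : List (Fin 3)} (h : HasContent l 0 0 0) : l = [] := by
  cases l with
  | nil => rfl
  | cons k l =>
    rcases fin_three_cases k with rfl | rfl | rfl
    · simp [hasContent_cons_zero] at h
    · simp [hasContent_cons_one] at h
    · simp [hasContent_cons_two] at h

theorem HasContent.length_eq {l : List (Fin 3)} : ∀ {x y z : ℕ}, HasContent l x y z →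
    l.length = x + y + z := by
  induction l with
  | nil =>
    rintro x y z ⟨rfl, rfl, rfl⟩
    rfl
  | cons k l ih =>
    intro x y z h
    rw [List.length_cons]
    rcases fin_three_cases k with rfl | rfl | rfl
    · obtain ⟨x, rfl, h'⟩ := hasContent_cons_zero.1 h
      rw [ih h']
      ring
    · obtain ⟨x, rfl, h'⟩ := hasContent_cons_one.1 h
      rw [ih h']
      ring
    · obtain ⟨x, rfl, h'⟩ := hasContent_cons_two.1 h
      rw [ih h']
      ring

theorem ballot_cons_iff {k : Fin 3} {l : List (Fin 3)} {x y z : ℕ}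
    (h : HasContent (k :: l) x y z) : Ballot (k :: l) ↔ Ballot l ∧ y < x ∧ z ≤ y := by
  obtain ⟨rfl, rfl, rfl⟩ := h
  rfl

/-- The words in `F`, preceded by the letter `k`. -/
def consWords (k : Fin 3) (F : Finset (List (Fin 3))) : Finset (List (Fin 3)) :=
  F.map ⟨List.cons k, List.cons_injective⟩

theorem mem_consWords {k j : Fin 3} {F : Finset (List (Fin 3))} {l : List (Fin 3)} :
    j :: l ∈ consWords k F ↔ j = k ∧ l ∈ F := by
  simp only [consWords, Finset.mem_map, Function.Embedding.coeFn_mk, List.cons.injEq]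
  constructor
  · rintro ⟨l', h, rfl, rfl⟩
    exact ⟨rfl, h⟩
  · rintro ⟨rfl, h⟩
    exact ⟨l, h, rfl, rfl⟩

theorem nil_notMem_consWords {k : Fin 3} {F : Finset (List (Fin 3))} : [] ∉ consWords k F := by
  simp [consWords]

theorem card_consWords (k : Fin 3) (F : Finset (List (Fin 3))) : (consWords k F).card = F.card :=
  Finset.card_map _

theorem disjoint_consWords {j k : Fin 3} (h : j ≠ k) (F G : Finset (List (Fin 3))) :
    Disjoint (consWords j F) (consWords k G) := by
  rw [Finset.disjoint_left]
  intro l hl hl'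
  cases l with
  | nil => exact nil_notMem_consWords hl
  | cons i l => exact h ((mem_consWords.1 hl).1.symm.trans (mem_consWords.1 hl').1)

/-- The number of ballot words with given content. The product on the right-hand side vanishes just
outside of the range of contents in which ballot words exist, so that the recursion obtained by
removing the first letter needs no boundary cases. -/
theorem exists_finset_ballot (s : ℕ) : ∀ x y z : ℕ, x + y + z = s + 1 → y ≤ x → z ≤ y + 1 →
    ∃ F : Finset (List (Fin 3)), (∀ l, l ∈ F ↔ Ballot l ∧ HasContent l x y z) ∧
      (F.card : ℤ) * ((x + 1).factorial * (y + 1).factorial * z.factorial)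
        = s.factorial * ((x - y) * (y + 1 - z) * (x + 1 - z)) := by
  induction s with
  | zero =>
    intro x y z hs hyx hzy
    rcases Nat.eq_zero_or_pos x with rfl | hx
    · refine ⟨∅, fun l => ?_, ?_⟩
      · simp only [Finset.notMem_empty, false_iff]
        rintro ⟨h1, h2, h3, h4⟩
        have hl : l ≠ [] := by
          rintro rfl
          simp at h2 h3 h4
          omega
        have := h1.count_lt hl
        omega
      · obtain rfl : y = 0 := by omega
        simp
    · obtain ⟨rfl, rfl, rfl⟩ : x = 1 ∧ y = 0 ∧ z = 0 := by omega
      refine ⟨{[0]}, fun l => ?_, by simp⟩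
      rw [Finset.mem_singleton]
      constructor
      · rintro rfl
        exact ⟨⟨trivial, by decide, by decide⟩, by decide, by decide, by decide⟩
      · rintro ⟨-, h⟩
        cases l with
        | nil => simp [HasContent] at h
        | cons k l =>
          rcases fin_three_cases k with rfl | rfl | rfl
          · obtain ⟨x, hx, h1⟩ := hasContent_cons_zero.1 h
            obtain rfl : x = 0 := by omega
            rw [eq_nil_of_hasContent h1]
          · obtain ⟨y, hy, -⟩ := hasContent_cons_one.1 h
            omega
          · obtain ⟨z, hz, -⟩ := hasContent_cons_two.1 h
            omega
  | succ s ih =>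
    intro x y z hs hyx hzy
    by_cases hb : y < x ∧ z ≤ y
    · obtain ⟨x, rfl⟩ : ∃ x', x = x' + 1 := ⟨x - 1, by omega⟩
      obtain ⟨F0, hF0, c0⟩ := ih x y z (by omega) (by omega) (by omega)
      obtain ⟨F1, hF1, c1⟩ : ∃ F : Finset (List (Fin 3)),
          (∀ l, l ∈ F ↔ Ballot l ∧ ∃ y', y = y' + 1 ∧ HasContent l (x + 1) y' z) ∧
          (F.card : ℤ) * ((x + 1 + 1).factorial * (y + 1).factorial * z.factorial)
            = s.factorial * ((y + 1) * ((x + 1 - y + 1) * (y - z) * (x + 1 + 1 - z))) := by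
        cases y with
        | zero =>
          obtain rfl : z = 0 := by omega
          exact ⟨∅, fun l => by simp, by simp⟩
        | succ y =>
          obtain ⟨F, hF, hc⟩ := ih (x + 1) y z (by omega) (by omega) (by omega)
          refine ⟨F, fun l => by simp [hF], ?_⟩
          rw [Nat.factorial_succ (y + 1)]
          push_cast at hc ⊢
          linear_combination ((y : ℤ) + 1 + 1) * hc
      obtain ⟨F2, hF2, c2⟩ : ∃ F : Finset (List (Fin 3)),
          (∀ l, l ∈ F ↔ Ballot l ∧ ∃ z', z = z' + 1 ∧ HasContent l (x + 1) y z') ∧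
          (F.card : ℤ) * ((x + 1 + 1).factorial * (y + 1).factorial * z.factorial)
            = s.factorial * (z * ((x + 1 - y) * (y + 1 - z + 1) * (x + 1 + 1 - z + 1))) := by
        cases z with
        | zero => exact ⟨∅, fun l => by simp, by simp⟩
        | succ z =>
          obtain ⟨F, hF, hc⟩ := ih (x + 1) y z (by omega) (by omega) (by omega)
          refine ⟨F, fun l => by simp [hF], ?_⟩
          rw [Nat.factorial_succ z]
          push_cast at hc ⊢
          linear_combination ((z : ℤ) + 1) * hc
      refine ⟨consWords 0 F0 ∪ (consWords 1 F1 ∪ consWords 2 F2), fun l => ?_, ?_⟩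
      · cases l with
        | nil =>
          simp only [Finset.mem_union, nil_notMem_consWords, or_self, false_iff]
          rintro ⟨-, h1, -, -⟩
          simp at h1
        | cons k l =>
          simp only [Finset.mem_union, mem_consWords, hF0, hF1, hF2]
          have hbal : Ballot (k :: l) ∧ HasContent (k :: l) (x + 1) y z
              ↔ Ballot l ∧ HasContent (k :: l) (x + 1) y z := by
            refine and_congr_left fun h => ?_
            rw [ballot_cons_iff h]
            simp [hb]
          rw [hbal]
          rcases fin_three_cases k with rfl | rfl | rfl
          · simp [hasContent_cons_zero]
          · simp [hasContent_cons_one]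
          · simp [hasContent_cons_two]
      · rw [Finset.card_union_of_disjoint, Finset.card_union_of_disjoint, card_consWords,
          card_consWords, card_consWords]
        · have hs' : (s : ℤ) = x + y + z - 1 := by omega
          rw [Nat.factorial_succ s, Nat.factorial_succ (x + 1)] at *
          push_cast at c0 c1 c2 ⊢
          rw [hs'] at *
          linear_combination ((x : ℤ) + 1 + 1) * c0 + c1 + c2
        · exact disjoint_consWords (by decide) _ _
        · rw [Finset.disjoint_union_right]
          exact ⟨disjoint_consWords (by decide) _ _, disjoint_consWords (by decide) _ _⟩
    · refine ⟨∅, fun l => ?_, ?_⟩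
      · simp only [Finset.notMem_empty, false_iff]
        rintro ⟨h1, h2, h3, h4⟩
        have hl : l ≠ [] := by
          rintro rfl
          simp at h2 h3 h4
          omega
        have := h1.count_lt hl
        omega
      · rcases (show y = x ∨ z = y + 1 by omega) with rfl | rfl <;> simp

/-- The number of ballot words of content `(m + 2, m, j)` whose first letter other than `2` is
`0`. They start with `0` followed by a ballot word, or with `2`; the right-hand side is the closed
form of the resulting sum over `j`. -/
theorem exists_finset_leadsZero {m : ℕ} (j : ℕ) (hj : j ≤ m) :
    ∃ F : Finset (List (Fin 3)),
      (∀ l, l ∈ F ↔ Ballot l ∧ LeadsZero l ∧ HasContent l (m + 2) m j) ∧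
      (F.card : ℤ) * ((m + 2).factorial * (m + 1).factorial * j.factorial)
          * ((2 * m + 1) * (2 * m + 3))
        = (2 * m + j + 1).factorial * ((m + 1) * (m + 2) * (2 * m + 3)
            - 2 * (m + 2) * (2 * m + 1) * j + (2 * m + 1) * j ^ 2) := by
  induction j with
  | zero =>
    obtain ⟨F, hF, hc⟩ := exists_finset_ballot (2 * m) (m + 1) m 0 (by omega) (by omega) (by omega)
    refine ⟨consWords 0 F, fun l => ?_, ?_⟩
    · cases l with
      | nil => simp [nil_notMem_consWords, LeadsZero]
      | cons k l =>
        rw [mem_consWords, hF, LeadsZero]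
        constructor
        · rintro ⟨rfl, h1, h2⟩
          have h3 := hasContent_cons_zero.2 ⟨_, rfl, h2⟩
          exact ⟨(ballot_cons_iff h3).2 ⟨h1, by omega, by omega⟩, .inl rfl, h3⟩
        · rintro ⟨h1, rfl | ⟨rfl, -⟩, h3⟩
          · obtain ⟨x, hx, h4⟩ := hasContent_cons_zero.1 h3
            obtain rfl : x = m + 1 := by omega
            exact ⟨rfl, ((ballot_cons_iff h3).1 h1).1, h4⟩
          · obtain ⟨x, hx, -⟩ := hasContent_cons_two.1 h3
            omega
    · rw [card_consWords, add_zero, Nat.factorial_succ (2 * m)]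
      push_cast at hc ⊢
      linear_combination (2 * (m : ℤ) + 1) * (2 * m + 3) * hc
  | succ j ih =>
    obtain ⟨F, hF, hc⟩ := exists_finset_ballot (2 * m + j + 1) (m + 1) m (j + 1) (by omega)
      (by omega) (by omega)
    obtain ⟨E, hE, hd⟩ := ih (by omega)
    refine ⟨consWords 0 F ∪ consWords 2 E, fun l => ?_, ?_⟩
    · cases l with
      | nil => simp [nil_notMem_consWords, LeadsZero]
      | cons k l =>
        rw [Finset.mem_union, mem_consWords, mem_consWords, hF, hE, LeadsZero]
        constructor
        · rintro (⟨rfl, h1, h2⟩ | ⟨rfl, h1, h2, h3⟩)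
          · have h3 := hasContent_cons_zero.2 ⟨_, rfl, h2⟩
            exact ⟨(ballot_cons_iff h3).2 ⟨h1, by omega, by omega⟩, .inl rfl, h3⟩
          · have h4 := hasContent_cons_two.2 ⟨_, rfl, h3⟩
            exact ⟨(ballot_cons_iff h4).2 ⟨h1, by omega, by omega⟩, .inr ⟨rfl, h2⟩, h4⟩
        · rintro ⟨h1, rfl | ⟨rfl, h2⟩, h3⟩
          · obtain ⟨x, hx, h4⟩ := hasContent_cons_zero.1 h3
            obtain rfl : x = m + 1 := by omega
            exact .inl ⟨rfl, ((ballot_cons_iff h3).1 h1).1, h4⟩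
          · obtain ⟨x, hx, h4⟩ := hasContent_cons_two.1 h3
            obtain rfl : x = j := by omega
            exact .inr ⟨rfl, ((ballot_cons_iff h3).1 h1).1, h2, h4⟩
    · rw [Finset.card_union_of_disjoint (disjoint_consWords (by decide) _ _), card_consWords,
        card_consWords, show 2 * m + (j + 1) + 1 = 2 * m + j + 1 + 1 by ring,
        Nat.factorial_succ (2 * m + j + 1)]
      rw [Nat.factorial_succ j] at *
      push_cast at hc hd ⊢
      linear_combination (2 * (m : ℤ) + 1) * (2 * m + 3) * hc + ((j : ℤ) + 1) * hd

/-- The case `j = m` of `exists_finset_leadsZero`, where the quadratic factor equals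
`3 * (3 * m + 2)`. -/
theorem exists_finset_goodWords (m : ℕ) :
    ∃ F : Finset (List (Fin 3)),
      (∀ l, l ∈ F ↔ Ballot l ∧ LeadsZero l ∧ HasContent l (m + 2) m m) ∧
      F.card * ((m + 2).factorial * (m + 1).factorial * m.factorial)
          * ((2 * m + 1) * (2 * m + 3)) = 3 * (3 * m + 2).factorial := by
  obtain ⟨F, hF, hc⟩ := exists_finset_leadsZero m le_rfl
  refine ⟨F, hF, ?_⟩
  rw [show 2 * m + m + 1 = 3 * m + 1 by ring] at hc
  rw [Nat.factorial_succ (3 * m + 1)]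
  zify
  rw [hc]
  ring

end Ballot

/-! ### Partitions of the ring and words -/

section Words

variable {M : ℕ}

/-- The letters of `f` at the `d` sites from `y` on. -/
def wordFrom (f : ZMod M → Fin 3) (y d : ℕ) : List (Fin 3) :=
  (List.range' y d).map fun i : ℕ => f (i : ZMod M)

theorem wordFrom_succ (f : ZMod M → Fin 3) (y d : ℕ) :
    wordFrom f y (d + 1) = f y :: wordFrom f (y + 1) d := by
  simp [wordFrom, List.range'_succ]

theorem ballot_wordFrom (f : ZMod M → Fin 3) (d : ℕ) : ∀ y, y + d = M →
    (Ballot (wordFrom f y d) ↔ ∀ x, y ≤ x → x < M →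
      (wordFrom f x (M - x)).count 1 < (wordFrom f x (M - x)).count 0 ∧
      (wordFrom f x (M - x)).count 2 ≤ (wordFrom f x (M - x)).count 1) := by
  induction d with
  | zero =>
    intro y hy
    refine ⟨fun _ x h1 h2 => by omega, fun _ => trivial⟩
  | succ d ih =>
    intro y hy
    have e : wordFrom f y (M - y) = f y :: wordFrom f (y + 1) d := by
      rw [← wordFrom_succ]
      congr 1
      omega
    rw [wordFrom_succ, Ballot, ih (y + 1) (by omega), ← e]
    constructor
    · rintro ⟨h1, h2⟩ x hx hxM
      rcases hx.eq_or_lt with rfl | hx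
      · exact h2
      · exact h1 x hx hxM
    · intro h
      exact ⟨fun x hx hxM => h x (by omega) hxM, h y le_rfl (by omega)⟩

theorem leadsZero_wordFrom (f : ZMod M → Fin 3) (d : ℕ) : ∀ y, y + d = M →
    (LeadsZero (wordFrom f y d) ↔
      ∃ t : ℕ, y ≤ t ∧ t < M ∧ f t = 0 ∧ ∀ x : ℕ, y ≤ x → x < t → f x = 2) := by
  induction d with
  | zero =>
    intro y hy
    refine ⟨fun h => h.elim, ?_⟩
    rintro ⟨t, h1, h2, -⟩
    omega
  | succ d ih =>
    intro y hy
    rw [wordFrom_succ, LeadsZero, ih (y + 1) (by omega)]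
    constructor
    · rintro (h | ⟨h, t, h1, h2, h3, h4⟩)
      · exact ⟨y, le_rfl, by omega, h, fun x _ _ => by omega⟩
      · refine ⟨t, by omega, h2, h3, fun x hx hxt => ?_⟩
        rcases hx.eq_or_lt with rfl | hx
        · exact h
        · exact h4 x hx hxt
    · rintro ⟨t, h1, h2, h3, h4⟩
      rcases h1.eq_or_lt with rfl | h1
      · exact .inl h3
      · exact .inr ⟨h4 y le_rfl h1, t, h1, h2, h3, fun x hx hxt => h4 x (by omega) hxt⟩

theorem exists_wordFrom_eq (k : Fin 3) (l : List (Fin 3)) (hl : l.length + 1 = M) :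
    ∃ f : ZMod M → Fin 3, f 0 = k ∧ wordFrom f 1 (M - 1) = l := by
  refine ⟨fun z => (k :: l).getD z.val k, by simp, ?_⟩
  refine List.ext_getElem (by simp [wordFrom]; omega) fun i h1 h2 => ?_
  have h3 : 1 + i < M := by omega
  simp only [wordFrom, List.getElem_map, List.getElem_range', one_mul,
    ZMod.val_natCast_of_lt h3]
  rw [add_comm, List.getD_cons_succ, List.getD_eq_getElem _ _ h2]

variable [NeZero M]

/-- The set of sites with the letter `k`. -/
def fiber (f : ZMod M → Fin 3) (k : Fin 3) : Finset (ZMod M) := Finset.univ.filter fun z => f z = k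

theorem mem_fiber {f : ZMod M → Fin 3} {k : Fin 3} {z : ZMod M} : z ∈ fiber f k ↔ f z = k := by
  simp [fiber]

theorem count_wordFrom (f : ZMod M → Fin 3) (k : Fin 3) (d : ℕ) : ∀ y, y + d ≤ M →
    (wordFrom f y d).count k + prefixCount (fiber f k) y = prefixCount (fiber f k) (y + d) := by
  induction d with
  | zero => simp [wordFrom]
  | succ d ih =>
    intro y hy
    have h1 := ih (y + 1) (by omega)
    rw [prefixCount_succ _ (by omega)] at h1
    rw [wordFrom_succ, show y + (d + 1) = y + 1 + d by ring, ← h1, List.count_cons, ind]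
    simp only [beq_iff_eq, mem_fiber]
    omega

theorem count_wordFrom_eq (f : ZMod M → Fin 3) (k : Fin 3) {y d : ℕ} (h : y + d = M) :
    (wordFrom f y d).count k + prefixCount (fiber f k) y = (fiber f k).card := by
  rw [count_wordFrom f k d y h.le, h, prefixCount_full]

theorem wordFrom_injective {f g : ZMod M → Fin 3} (h0 : f 0 = g 0)
    (h : wordFrom f 1 (M - 1) = wordFrom g 1 (M - 1)) : f = g := by
  funext z
  obtain ⟨k, hk, rfl⟩ := exists_natCast z
  rcases Nat.eq_zero_or_pos k with rfl | hk0
  · rwa [Nat.cast_zero]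
  · rw [wordFrom, wordFrom, List.map_inj_left] at h
    exact h k (by rw [List.mem_range'_1]; omega)

end Words

section Bijection

variable {m : ℕ}

theorem isSplit_fiber {f : ZMod (3 * m + 3) → Fin 3} (h0 : f 0 = 1)
    (h : HasContent (wordFrom f 1 (3 * m + 2)) (m + 2) m m) :
    IsSplit (fiber f 0) (fiber f 1) (fiber f 2) := by
  obtain ⟨h1, h2, h3⟩ := h
  have hp : ∀ k, prefixCount (fiber f k) 1 = if k = 1 then 1 else 0 := by
    intro k
    have := prefixCount_succ (fiber f k) (y := 0) (by omega)
    rw [zero_add, prefixCount_zero, zero_add, ind] at this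
    simp only [mem_fiber, Nat.cast_zero, h0] at this
    rw [this]
    simp only [eq_comm]
  have hc := fun k => count_wordFrom_eq f k (y := 1) (d := 3 * m + 2) (by omega)
  have c0 := hc 0
  have c1 := hc 1
  have c2 := hc 2
  rw [hp, h1] at c0
  rw [hp, h2] at c1
  rw [hp, h3] at c2
  refine ⟨by simpa using c0.symm, by simpa using c1.symm, by simpa using c2.symm, fun z => ?_, ?_⟩
  · simp only [mem_fiber]
    exact fin_three_cases (f z)
  · rwa [mem_fiber]

theorem IsSplit.hasContent {f : ZMod (3 * m + 3) → Fin 3}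
    (h : IsSplit (fiber f 0) (fiber f 1) (fiber f 2)) :
    HasContent (wordFrom f 1 (3 * m + 2)) (m + 2) m m := by
  obtain ⟨h1, h2, h3⟩ := h.prefixCount_one
  have c0 := count_wordFrom_eq f 0 (y := 1) (d := 3 * m + 2) (by omega)
  have c1 := count_wordFrom_eq f 1 (y := 1) (d := 3 * m + 2) (by omega)
  have c2 := count_wordFrom_eq f 2 (y := 1) (d := 3 * m + 2) (by omega)
  rw [h.card_bottom] at c0
  rw [h.card_middle] at c1
  rw [h.card_top] at c2
  exact ⟨by omega, by omega, by omega⟩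

theorem goodPrefix_fiber_iff {f : ZMod (3 * m + 3) → Fin 3}
    (h : IsSplit (fiber f 0) (fiber f 1) (fiber f 2)) :
    GoodPrefix (fiber f 0) (fiber f 1) (fiber f 2) ↔
      Ballot (wordFrom f 1 (3 * m + 2)) ∧ LeadsZero (wordFrom f 1 (3 * m + 2)) := by
  rw [ballot_wordFrom f _ 1 (by omega), leadsZero_wordFrom f _ 1 (by omega), GoodPrefix]
  simp only [mem_fiber]
  refine and_congr_left fun _ => forall_congr' fun y => forall_congr' fun hy =>
    forall_congr' fun hyM => ?_
  have c0 := count_wordFrom_eq f 0 (y := y) (d := 3 * m + 3 - y) (by omega)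
  have c1 := count_wordFrom_eq f 1 (y := y) (d := 3 * m + 3 - y) (by omega)
  have c2 := count_wordFrom_eq f 2 (y := y) (d := 3 * m + 3 - y) (by omega)
  rw [h.card_bottom] at c0
  rw [h.card_middle] at c1
  rw [h.card_top] at c2
  omega

theorem isSplit_iff_mem_partitions {P Q R : Finset (ZMod (3 * m + 3))} :
    IsSplit P Q R ↔ [P, Q, R] ∈ partitions (3 * m + 3) [m + 2, m + 1, m] ∧ 0 ∈ Q := by
  rw [partitions, Finset.mem_filter, mem_rowLists]
  simp only [List.map_cons, List.map_nil, List.cons.injEq, and_true, List.mem_cons,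
    List.not_mem_nil, or_false, exists_eq_or_imp, exists_eq_left]
  constructor
  · rintro ⟨h1, h2, h3, h4, h5⟩
    exact ⟨⟨⟨h1, h2, h3⟩, h4⟩, h5⟩
  · rintro ⟨⟨⟨h1, h2, h3⟩, h4⟩, h5⟩
    exact ⟨h1, h2, h3, h4, h5⟩

/-- The word of a partition of the ring into three rows: `0`, `1` and `2` stand for the bottom, the
middle and the top row. -/
theorem IsSplit.exists_eq_fiber {P Q R : Finset (ZMod (3 * m + 3))} (h : IsSplit P Q R) :
    ∃ f : ZMod (3 * m + 3) → Fin 3, P = fiber f 0 ∧ Q = fiber f 1 ∧ R = fiber f 2 := by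
  refine ⟨fun z => if z ∈ P then 0 else if z ∈ Q then 1 else 2, ?_, ?_, ?_⟩ <;> ext z <;>
    obtain ⟨k, hk, rfl⟩ := exists_natCast z <;> rw [mem_fiber] <;>
    have h1 := h.ind_add hk <;>
    rcases ind_eq_one_or P (k : ZMod (3 * m + 3)) with ⟨p, p'⟩ | ⟨p, p'⟩ <;>
    rcases ind_eq_one_or Q (k : ZMod (3 * m + 3)) with ⟨q, q'⟩ | ⟨q, q'⟩ <;>
    rcases ind_eq_one_or R (k : ZMod (3 * m + 3)) with ⟨r, r'⟩ | ⟨r, r'⟩ <;>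
    first
      | omega
      | simp [p, q, r]

open Classical in
/-- The partitions of the ring for which the particle `n - 1` is directly right of the particle `n`
correspond to the ballot words whose first letter other than `2` is `0`: the word lists the rows of
the sites other than `0`. -/
theorem card_partitions_zero_one (m : ℕ) :
    ((partitions (3 * m + 3) [m + 2, m + 1, m]).filter fun L =>
        Follows ZMod.val (multiline ZMod.val L) 0 1 ∧ unused L = {0}).card
      * ((m + 2).factorial * (m + 1).factorial * m.factorial) * ((2 * m + 1) * (2 * m + 3))
      = 3 * (3 * m + 2).factorial := by
  obtain ⟨F, hF, hc⟩ := exists_finset_goodWords m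
  rw [← hc]
  congr 2
  symm
  have hex : ∀ l ∈ F, ∃ f : ZMod (3 * m + 3) → Fin 3, f 0 = 1 ∧ wordFrom f 1 (3 * m + 2) = l := by
    intro l hl
    obtain ⟨-, -, h1, h2, h3⟩ := (hF l).1 hl
    refine exists_wordFrom_eq 1 l ?_
    rw [HasContent.length_eq ⟨h1, h2, h3⟩]
    ring
  choose! w hw0 hw using hex
  have hsplit : ∀ l ∈ F, IsSplit (fiber (w l) 0) (fiber (w l) 1) (fiber (w l) 2) := fun l hl =>
    isSplit_fiber (hw0 l hl) (by rw [hw l hl]; exact ((hF l).1 hl).2.2)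
  refine Finset.card_bij (fun l _ => [fiber (w l) 0, fiber (w l) 1, fiber (w l) 2]) ?_ ?_ ?_
  · intro l hl
    refine Finset.mem_filter.2 ⟨(isSplit_iff_mem_partitions.1 (hsplit l hl)).1, ?_⟩
    rw [follows_unused_iff (hsplit l hl), goodPrefix_fiber_iff (hsplit l hl), hw l hl]
    exact ⟨((hF l).1 hl).1, ((hF l).1 hl).2.1⟩
  · intro l hl l' hl' heq
    simp only [List.cons.injEq, and_true] at heq
    rw [← hw l hl, ← hw l' hl']
    congr 1
    funext z
    obtain ⟨h0, h1, h2⟩ := heq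
    have key : ∀ k, fiber (w l) k = fiber (w l') k := by
      intro k
      rcases fin_three_cases k with rfl | rfl | rfl
      · exact h0
      · exact h1
      · exact h2
    have : z ∈ fiber (w l') (w l z) := by
      rw [← key, mem_fiber]
    exact (mem_fiber.1 this).symm
  · intro L hL
    obtain ⟨h1, h2, h3⟩ := Finset.mem_filter.1 hL
    obtain ⟨P, Q, R, rfl⟩ : ∃ P Q R, L = [P, Q, R] := by
      rw [partitions, Finset.mem_filter, mem_rowLists] at h1
      exact List.length_eq_three.1 (show L.length = 3 by simpa using congrArg List.length h1.1)
    have h0 : (0 : ZMod (3 * m + 3)) ∈ Q \ fed ZMod.val Q R := by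
      have h4 : Q \ fed ZMod.val Q R = {0} := h3
      rw [h4]
      exact Finset.mem_singleton_self 0
    have hs := isSplit_iff_mem_partitions.2 ⟨h1, (Finset.mem_sdiff.1 h0).1⟩
    have hg := (follows_unused_iff hs).1 ⟨h2, h3⟩
    obtain ⟨f, rfl, rfl, rfl⟩ := hs.exists_eq_fiber
    have hl : wordFrom f 1 (3 * m + 2) ∈ F := by
      rw [hF]
      obtain ⟨h4, h5⟩ := (goodPrefix_fiber_iff hs).1 hg
      exact ⟨h4, h5, hs.hasContent⟩
    refine ⟨_, hl, ?_⟩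
    have : w (wordFrom f 1 (3 * m + 2)) = f :=
      wordFrom_injective ((hw0 _ hl).trans (mem_fiber.1 hs.zero_mem).symm) (hw _ hl)
    simp only [this]

end Bijection

/-! ### The two-point correlations -/

section Correlations

open Classical in
/-- The correlation of two particles that are layers of three rows whose upper two differ in size by
one. The factor `M` counts the positions of the unused site. -/
theorem correlation_eq_card {n : ℕ} [NeZero n] (hn : 1 < n) {q r M : ℕ} [NeZero M]
    (hnq : q < n) (hqr : q = r + 1) (hM : n + q + r = M) {i j : Fin n} (hij : i ≠ j) {a b : ℕ}
    (ha : ∀ N, ∀ σ : Config n N, layer (labelSets [n, q, r] σ) a = {σ i})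
    (hb : ∀ N, ∀ σ : Config n N, layer (labelSets [n, q, r] σ) b = {σ j}) :
    correlation (limitLaw n) i j
      = ((n.factorial * q.factorial * r.factorial : ℕ) : ℝ)
        * ((M * ((partitions M [n, q, r]).filter fun L =>
          Follows ZMod.val (multiline ZMod.val L) a b ∧ unused L = {0}).card : ℕ) : ℝ)
        / M.factorial := by
  have hs : [n, q, r].Pairwise (· > ·) := by
    simp only [List.pairwise_cons, List.mem_cons, List.not_mem_nil, or_false, forall_eq_or_imp,
      forall_eq, false_imp_iff, implies_true, List.Pairwise.nil, and_true]
    omega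
  have hprod : ∏ k : Fin [n, q, r].length, ([n, q, r].get k).factorial
      = n.factorial * q.factorial * r.factorial :=
    Fin.prod_univ_three fun k : Fin 3 => ([n, q, r].get k).factorial
  rw [correlation_limitLaw hn hs hij ha hb, integral_follows (M := M) (by simp; omega),
    card_partitions_follows hqr, hprod]

theorem layer_labelSets_two {n N q r : ℕ} (σ : Config n N) (i : Fin n) (hq : q = i + 1)
    (hr : r = i) : layer (labelSets [n, q, r] σ) 1 = {σ i} := by
  rw [← labelSet_succ_sdiff, ← hq, ← hr]
  rfl

theorem layer_labelSets_one {n N q : ℕ} (σ : Config n N) (i : Fin n) (hi : (i : ℕ) = 0) :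
    layer (labelSets [n, q, 1] σ) 2 = {σ i} := by
  have h0 : labelSet σ i = ∅ := by
    rw [hi]
    simp [labelSet]
  have h1 := labelSet_succ_sdiff σ i
  rw [h0, hi, zero_add] at h1
  rw [← h1]
  rfl

theorem layer_labelSets_last {n N q r : ℕ} (σ : Config n N) (i : Fin n) (hn : n = i + 1)
    (hq : q = i) : layer (labelSets [n, q, r] σ) 0 = {σ i} := by
  have h1 := labelSet_succ_sdiff σ i
  rw [← hn, ← hq] at h1
  rw [← h1]
  rfl

theorem correlation_two_one {n : ℕ} [NeZero n] (hn : 3 ≤ n) {i j : Fin n} (hi : (i : ℕ) = 1)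
    (hj : (j : ℕ) = 0) :
    correlation (limitLaw n) i j = 4 / (((n : ℝ) + 1) * ((n : ℝ) + 2)) := by
  rw [correlation_eq_card (q := 2) (r := 1) (M := n + 3) (a := 1) (b := 2) (by omega) (by omega)
    rfl rfl (by rintro rfl; omega) (fun N σ => layer_labelSets_two σ _ (by omega) hi.symm)
    (fun N σ => layer_labelSets_one σ _ hj), card_partitions_one_two hn]
  have := Nat.factorial_ne_zero n
  simp only [Nat.factorial_succ, Nat.factorial_zero]
  push_cast
  field_simp
  ring

theorem correlation_one_two {n : ℕ} [NeZero n] (hn : 3 ≤ n) {i j : Fin n} (hi : (i : ℕ) = 0)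
    (hj : (j : ℕ) = 1) : correlation (limitLaw n) i j = 4 / ((n : ℝ) + 2) := by
  rw [correlation_eq_card (q := 2) (r := 1) (M := n + 3) (a := 2) (b := 1) (by omega) (by omega)
    rfl rfl (by rintro rfl; omega) (fun N σ => layer_labelSets_one σ _ hi)
    (fun N σ => layer_labelSets_two σ _ (by omega) hj.symm), card_partitions_two_one hn]
  have := Nat.factorial_ne_zero n
  simp only [Nat.factorial_succ, Nat.factorial_zero]
  push_cast
  field_simp
  ring

theorem correlation_last {m : ℕ} {i j : Fin (m + 2)} (hi : (i : ℕ) = m + 1) (hj : (j : ℕ) = m) :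
    correlation (limitLaw (m + 2)) i j
      = 3 / ((2 * (m : ℝ) + 1) * (2 * m + 3)) := by
  rw [correlation_eq_card (q := m + 1) (r := m) (M := 3 * m + 3) (a := 0) (b := 1) (by omega)
    (by omega) rfl (by omega) (by rintro rfl; omega)
    (fun N σ => layer_labelSets_last σ _ (by omega) hi.symm)
    (fun N σ => layer_labelSets_two σ _ (by omega) hj.symm)]
  have h := congrArg (Nat.cast : ℕ → ℝ) (card_partitions_zero_one m)
  have h1 : ((3 * m + 2).factorial : ℝ) ≠ 0 := by exact_mod_cast Nat.factorial_ne_zero _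
  have h2 : (2 * (m : ℝ) + 1) * (2 * m + 3) ≠ 0 := by positivity
  have h3 : ((3 * m + 3).factorial : ℝ) ≠ 0 := by exact_mod_cast Nat.factorial_ne_zero _
  have h4 : ((3 * m + 3).factorial : ℝ) = (3 * m + 3) * (3 * m + 2).factorial := by
    rw [Nat.factorial_succ (3 * m + 2)]
    push_cast
    ring
  push_cast at h ⊢
  rw [div_eq_div_iff h3 h2, h4]
  linear_combination (3 * (m : ℝ) + 3) * h

end Correlations

theorem mainTheorem5 (n : ℕ) (hn : 3 ≤ n) :
    (∀ N, n ≤ N → ∃! p : PMF (Config n N), IsStationaryDist p) ∧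
    (∃! μ : ProbabilityMeasure (Fin n → UnitAddCircle), IsContinuousTASEP n μ) ∧
    ∀ μ : ProbabilityMeasure (Fin n → UnitAddCircle), IsContinuousTASEP n μ →
      -- labels 2 and 1
      (correlation μ ⟨1, by omega⟩ ⟨0, by omega⟩
          = (n : ℝ) / ((n + 1).choose 2 : ℝ) - (n : ℝ) / ((n + 2).choose 2 : ℝ) ∧
        correlation μ ⟨1, by omega⟩ ⟨0, by omega⟩ = 4 / (((n : ℝ) + 1) * ((n : ℝ) + 2))) ∧
      -- labels 1 and 2
      (correlation μ ⟨0, by omega⟩ ⟨1, by omega⟩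
          = (n : ℝ) / ((n + 2).choose 2 : ℝ) + (n : ℝ) / ((n + 1).choose 2 : ℝ) ∧
        correlation μ ⟨0, by omega⟩ ⟨1, by omega⟩ = 4 / ((n : ℝ) + 2)) ∧
      -- labels n and n - 1
      (correlation μ ⟨n - 1, by omega⟩ ⟨n - 2, by omega⟩
          = (n : ℝ) ^ 2 / ((2 * n - 1).choose 2 : ℝ)
            - (n : ℝ) * ((n : ℝ) - 2) / ((2 * n - 2).choose 2 : ℝ)
            - (n : ℝ) / ((2 * n).choose 2 : ℝ) ∧
        correlation μ ⟨n - 1, by omega⟩ ⟨n - 2, by omega⟩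
          = 3 / ((2 * (n : ℝ) - 1) * (2 * (n : ℝ) - 3))) := by
  have : NeZero n := ⟨by omega⟩
  refine ⟨fun N hN => existsUnique_isStationaryDist (by omega) (by omega) hN,
    ⟨limitLaw n, (isContinuousTASEP_iff (by omega) _).2 rfl,
      fun μ hμ => (isContinuousTASEP_iff (by omega) μ).1 hμ⟩, fun μ hμ => ?_⟩
  rw [(isContinuousTASEP_iff (by omega) μ).1 hμ]
  have h1 : (((n + 1).choose 2 : ℕ) : ℝ) = ((n : ℝ) + 1) * n / 2 := by
    rw [Nat.cast_choose_two]
    push_cast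
    ring
  have h2 : (((n + 2).choose 2 : ℕ) : ℝ) = ((n : ℝ) + 2) * (n + 1) / 2 := by
    rw [Nat.cast_choose_two]
    push_cast
    ring
  have hn0 : (n : ℝ) ≠ 0 := by
    exact_mod_cast (by omega : n ≠ 0)
  have c21 := correlation_two_one hn (i := ⟨1, by omega⟩) (j := ⟨0, by omega⟩) rfl rfl
  have c12 := correlation_one_two hn (i := ⟨0, by omega⟩) (j := ⟨1, by omega⟩) rfl rfl
  refine ⟨⟨?_, c21⟩, ⟨?_, c12⟩, ?_⟩
  · rw [c21, h1, h2]
    field_simp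
    ring
  · rw [c12, h1, h2]
    field_simp
    ring
  obtain ⟨m, rfl⟩ : ∃ m, n = m + 2 := ⟨n - 2, by omega⟩
  have h3 : correlation (limitLaw (m + 2)) ⟨m + 2 - 1, by omega⟩ ⟨m + 2 - 2, by omega⟩
      = 3 / ((2 * ((m + 2 : ℕ) : ℝ) - 1) * (2 * ((m + 2 : ℕ) : ℝ) - 3)) := by
    refine (correlation_last rfl rfl).trans ?_
    push_cast
    congr 1
    ring
  refine ⟨?_, h3⟩
  rw [h3, show 2 * (m + 2) - 1 = 2 * m + 3 by omega, show 2 * (m + 2) - 2 = 2 * m + 2 by omega,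
    Nat.cast_choose_two, Nat.cast_choose_two, Nat.cast_choose_two]
  push_cast
  have e1 : 2 * ((m : ℝ) + 2) - 1 = 2 * m + 3 := by ring
  have e2 : 2 * ((m : ℝ) + 2) - 3 = 2 * m + 1 := by ring
  have e3 : 2 * (m : ℝ) + 3 - 1 = 2 * (m + 1) := by ring
  have e4 : 2 * (m : ℝ) + 2 - 1 = 2 * m + 1 := by ring
  have e5 : (m : ℝ) + 2 - 2 = m := by ring
  rw [e1, e2, e3, e4, e5]
  have p1 : 2 * (m : ℝ) + 3 ≠ 0 := by positivity
  have p2 : 2 * (m : ℝ) + 1 ≠ 0 := by positivity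
  have p3 : (m : ℝ) + 1 ≠ 0 := by positivity
  have p4 : (m : ℝ) + 2 ≠ 0 := by positivity
  have e6 : 2 * (m : ℝ) + 2 = 2 * (m + 1) := by ring
  rw [e6]
  field_simp
  ring
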